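/- Let $n\ge 1$ and $p,q>1$, let $|x|_q=\bigl(\sum_{i=1}^n|x_i|^q\bigr)^{1/q}$ and $V(x)=\frac1p|x|_q^p$ for $x\in\mathbb R^n$, and let $\mu$ be the probability measure on $\mathbb R^n$ with $d\mu=C e^{-V(x)}\,dx$, where $C\ge 0$ is a constant. For $\lambda\in\mathbb R$ consider the inequality $$\mathrm{Var}_\mu f\le\lambda\int_{\mathbb R^n}\bigl\langle (D^2V)^{-1}\nabla f,\nabla f\bigr\rangle\,d\mu \qquad (\ast)$$ for even locally Lipschitz functions $f:\mathbb R^n\to\mathbb R$. Both sides are understood in $[0,\infty]$, with $\mathrm{Var}_\mu f=\infty$ if $f\notin L^2(\mu)$; the integrand is defined for almost every $x$. (For $\lambda\le0$ the right-hand side of $(\ast)$ is read as $0$.) If $$\lambda\ge\max\Bigl(1-\frac1p,\ 1-\frac1q,\ \frac{1}{2\bigl(1+\frac{q-2}{n}\bigr)}\Bigr),$$ then $(\ast)$ holds for every even locally Lipschitz $f$. Moreover, $(\ast)$ holds for all even locally Lipschitz $f$ with $\lambda=1-\frac1p$, and this constant is sharp, i.e. $1-\frac1p$ is the smallest $\lambda$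 for which $(\ast)$ holds for all even locally Lipschitz $f$, in each of the following cases: 1. $q\ge 2$ and $p\ge q$; 2. $q\le 2$, $n+2(q-2)\ne0$ (automatic for $n\ge2$) and $p\ge\dfrac{2(n+q-2)}{n+2(q-2)}=2-\dfrac{2(q-2)}{n+2(q-2)}$. -/

import Mathlib

noncomputable section

/-- The potential `V(x) = |x|_q ^ p / p = (∑ᵢ |xᵢ| ^ q) ^ (p / q) / p` on `ℝⁿ`. -/
def lqPotential (n : ℕ) (p q : ℝ) (x : EuclideanSpace ℝ (Fin n)) : ℝ :=
  (1 / p) * (∑ i, |x i| ^ q) ^ (p / q)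

/-- The Hessian `D²V(x)`, as a linear operator: the derivative of the gradient field of `V`. -/
def hessianOp {n : ℕ} (V : EuclideanSpace ℝ (Fin n) → ℝ) (x : EuclideanSpace ℝ (Fin n)) :
    EuclideanSpace ℝ (Fin n) →L[ℝ] EuclideanSpace ℝ (Fin n) :=
  fderiv ℝ (gradient V) x

/-- The integrand `⟨(D²V(x))⁻¹ ∇f(x), ∇f(x)⟩` of the Brascamp–Lieb inequality. -/
def blIntegrand {n : ℕ} (V f : EuclideanSpace ℝ (Fin n) → ℝ)
    (x : EuclideanSpace ℝ (Fin n)) : ℝ :=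
  inner ℝ ((hessianOp V x).inverse (gradient f x)) (gradient f x)

/-- The strong Brascamp–Lieb inequality with constant `lam` on the set of even functions:
`Var_μ f ≤ lam * ∫ ⟨(D²V)⁻¹ ∇f, ∇f⟩ dμ` for every even locally Lipschitz `f`. Both sides take
values in `[0, ∞]`; the variance of a function outside `L²(μ)` is `∞`, so when the right-hand side
is finite, the inequality includes that `f` is in `L²(μ)`. -/
def StrongBrascampLieb {n : ℕ} (μ : MeasureTheory.Measure (EuclideanSpace ℝ (Fin n)))
    (V : EuclideanSpace ℝ (Fin n) → ℝ) (lam : ℝ) : Prop :=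
  ∀ f : EuclideanSpace ℝ (Fin n) → ℝ, LocallyLipschitz f → Function.Even f →
    ProbabilityTheory.evariance f μ ≤
      ENNReal.ofReal lam * ∫⁻ x, ENNReal.ofReal (blIntegrand V f x) ∂μ

end

open MeasureTheory Set Filter Topology

/-! In polar coordinates for the ℓ^q norm, `μ` is the law of rθ with r and θ independent: θ follows
the cone measure σ on the ℓ^q unit sphere, and r has density proportional to r^(n-1) exp(-r^p/p).
The quadratic form of (D²V)⁻¹ on ∇f splits accordingly. At rθ it equals r^(2-p) (T/(q-1) +
E²/(p-1)), where E is the radial derivative of f and T ≥ 0 a weighted square of its tangential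
gradient (`lqForm_smul`).

Radial directions. The law of total variance splits Var_μ f into the mean over r of Var_σ f(r·) and
the variance in r of the spherical mean. The latter obeys a sharp weighted Poincaré inequality
(`pairVar_radialMeasure_le`). For the former, a ground state inequality with ground state r^p
(`lintegral_sq_radialMeasure_le`) is applied to r ↦ f(rθ) - f(rθ') for each pair (θ, θ'). Together
they bound Var_μ f by the mean of n r^(-p) Var_σ f(r·) + r^(2-p) E²/p. Since 1/p = (1 - 1/p)/(p -
1), the second term costs the constant 1 - 1/p, and what remains is a Poincaré inequality on the
sphere for even functions: n Var_σ f(r·) ≤ λ/(q-1) ∫ r² T dσ (`pairVar_le_of_sphere`).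

Sphere. The measure σ does not depend on p, so this inequality can be extracted from the case p = q,
where the measure is a product. The restriction of f - m to the sphere of radius r, m being its
mean, is extended to a γ-homogeneous function; the inequality for the product measure is applied to
it, and the best γ is chosen (`pairVar_sphere_le`).

Product measure. An even function is decomposed by its parity in each coordinate
(`pairVar_pi_evenMeasure_le`). The part even in every coordinate is handled by Efron–Stein and the
half-line Poincaré inequality, which costs 1 - 1/q. Every other nonzero part is odd in at least two
coordinates; Hardy's inequality in two of them, each used for one half, costs 1/2.

Sharpness. Testing on f = V gives Var V = n/p and energy n/(p-1), which forces λ ≥ 1 - 1/p.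

All variances are written as double integrals of squared differences (`pairVar`) with values in [0,
∞], so that no integrability of f has to be known beforehand. -/

/-! ### Radial measures on the half-line -/

/-- The measure on `(0, ∞)` with density `k r ^ (d - 1) exp (-r ^ p / p)`. -/
noncomputable def radialMeasure (k d p : ℝ) : Measure ℝ :=
  (volume.restrict (Ioi 0)).withDensity
    (fun r => ENNReal.ofReal (k * (r ^ (d - 1) * Real.exp (-(r ^ p / p)))))

/-- Half of the double integral of `(f x - f y) ^ 2`: the variance of `f` with respect to a
probability measure, for functions that need not be integrable. -/
noncomputable def pairVar {α : Type*} [MeasurableSpace α] (μ : Measure α) (f : α → ℝ) : ENNReal :=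
  2⁻¹ * ∫⁻ x, ∫⁻ y, ENNReal.ofReal ((f x - f y) ^ 2) ∂μ ∂μ

instance {k d p : ℝ} : SFinite (radialMeasure k d p) := by
  unfold radialMeasure; infer_instance

theorem measurable_radialDensity (k d p : ℝ) :
    Measurable fun r : ℝ => ENNReal.ofReal (k * (r ^ (d - 1) * Real.exp (-(r ^ p / p)))) := by
  fun_prop

theorem integrableOn_radial {s p : ℝ} (hs : -1 < s) (hp : 0 < p) :
    IntegrableOn (fun r : ℝ => r ^ s * Real.exp (-(r ^ p / p))) (Ioi 0) := by
  have h := integrableOn_rpow_mul_exp_neg_mul_rpow hs hp (b := 1 / p) (by positivity)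
  refine h.congr_fun (fun x _ => ?_) measurableSet_Ioi
  simp only
  congr 2; ring

theorem tendsto_radial_atTop {d p : ℝ} (hp : 0 < p) :
    Tendsto (fun r : ℝ => r ^ d * Real.exp (-(r ^ p / p))) atTop (𝓝 0) := by
  have h := (tendsto_rpow_mul_exp_neg_mul_atTop_nhds_zero (d / p) (1 / p) (by positivity)).comp
    (tendsto_rpow_atTop hp)
  refine h.congr' ?_
  filter_upwards [eventually_gt_atTop 0] with r hr
  simp only [Function.comp_apply]
  rw [← Real.rpow_mul hr.le, mul_div_cancel₀ _ hp.ne']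
  congr 2; ring

/-- This exact derivative drives all the one-dimensional estimates: r^p - d times the radial density
has an explicit primitive, which vanishes at infinity and, when d > 0, at the origin. -/
theorem hasDerivAt_radial {d p r : ℝ} (hp : 0 < p) (hr : 0 < r) :
    HasDerivAt (fun r : ℝ => -(r ^ d * Real.exp (-(r ^ p / p))))
      ((r ^ p - d) * (r ^ (d - 1) * Real.exp (-(r ^ p / p)))) r := by
  have h1 := Real.hasDerivAt_rpow_const (x := r) (p := d) (Or.inl hr.ne')
  have h2 : HasDerivAt (fun r : ℝ => Real.exp (-(r ^ p / p)))
      (Real.exp (-(r ^ p / p)) * -(p * r ^ (p - 1) / p)) r :=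
    ((Real.hasDerivAt_rpow_const (x := r) (p := p) (Or.inl hr.ne')).div_const p).neg.exp
  refine (h1.mul h2).neg.congr_deriv ?_
  have e1 : r ^ d = r ^ (d - 1) * r := by
    rw [← Real.rpow_add_one hr.ne']; ring_nf
  have e2 : r ^ p = r ^ (p - 1) * r := by
    rw [← Real.rpow_add_one hr.ne']; ring_nf
  rw [e1, e2]; field_simp; ring

theorem integrableOn_radial_deriv {d p : ℝ} (hd : 0 < d) (hp : 0 < p) :
    IntegrableOn (fun r : ℝ => (r ^ p - d) * (r ^ (d - 1) * Real.exp (-(r ^ p / p)))) (Ioi 0) := by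
  have h1 := integrableOn_radial (s := p + (d - 1)) (p := p) (by linarith) hp
  have h2 := (integrableOn_radial (s := d - 1) (p := p) (by linarith) hp).const_mul d
  refine (h1.sub h2).congr_fun (fun x hx => ?_) measurableSet_Ioi
  simp only [Pi.sub_apply]
  rw [Real.rpow_add hx]; ring

theorem integral_Ioi_radial {d p u : ℝ} (hd : 0 < d) (hp : 0 < p) (hu : 0 ≤ u) :
    ∫ r in Ioi u, (r ^ p - d) * (r ^ (d - 1) * Real.exp (-(r ^ p / p))) =
      u ^ d * Real.exp (-(u ^ p / p)) := by
  have hc : Continuous fun r : ℝ => -(r ^ d * Real.exp (-(r ^ p / p))) := by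
    have := Real.continuous_rpow_const hd.le
    have := Real.continuous_rpow_const hp.le
    fun_prop
  rw [integral_Ioi_of_hasDerivAt_of_tendsto (m := 0) hc.continuousWithinAt
    (fun x hx => hasDerivAt_radial hp (hu.trans_lt hx))
    ((integrableOn_radial_deriv hd hp).mono_set (Ioi_subset_Ioi hu))]
  · ring
  · simpa using (tendsto_radial_atTop (d := d) hp).neg

theorem integral_Ioc_radial {d p u : ℝ} (hd : 0 < d) (hp : 0 < p) (hu : 0 ≤ u) :
    ∫ r in Ioc 0 u, (r ^ p - d) * (r ^ (d - 1) * Real.exp (-(r ^ p / p))) =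
      -(u ^ d * Real.exp (-(u ^ p / p))) := by
  have hi := integrableOn_radial_deriv hd hp
  have h := setIntegral_union (μ := volume) (Ioc_disjoint_Ioi (a := 0) (le_refl u))
    measurableSet_Ioi (hi.mono_set Ioc_subset_Ioi_self) (hi.mono_set (Ioi_subset_Ioi hu))
  rw [Ioc_union_Ioi_eq_Ioi hu, integral_Ioi_radial hd hp le_rfl, integral_Ioi_radial hd hp hu,
    Real.zero_rpow hd.ne'] at h
  linarith

theorem lintegral_radialMeasure (k d p : ℝ) (φ : ℝ → ENNReal) (hφ : Measurable φ) :
    ∫⁻ r, φ r ∂radialMeasure k d p = ∫⁻ r in Ioi 0,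
      ENNReal.ofReal (k * (r ^ (d - 1) * Real.exp (-(r ^ p / p)))) * φ r := by
  rw [radialMeasure, lintegral_withDensity_eq_lintegral_mul _ (measurable_radialDensity k d p) hφ]
  rfl

theorem setLIntegral_radialMeasure (k d p : ℝ) {S : Set ℝ} (hS : MeasurableSet S) (φ : ℝ → ENNReal)
    (hφ : Measurable φ) :
    ∫⁻ r in S, φ r ∂radialMeasure k d p = ∫⁻ r in Ioi 0 ∩ S,
      ENNReal.ofReal (k * (r ^ (d - 1) * Real.exp (-(r ^ p / p)))) * φ r := by
  rw [← lintegral_indicator hS, lintegral_radialMeasure _ _ _ _ (hφ.indicator hS), inter_comm,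
    ← Measure.restrict_restrict hS, ← lintegral_indicator hS]
  refine lintegral_congr fun r => ?_
  by_cases h : r ∈ S <;> simp [h]

theorem setLIntegral_radialMeasure_ofReal {k d p : ℝ} (hk : 0 ≤ k) {S : Set ℝ}
    (hS : MeasurableSet S) (φ : ℝ → ℝ) (hφ : Measurable φ) (hφ0 : ∀ r ∈ S, 0 < r → 0 ≤ φ r)
    (hi : IntegrableOn (fun r => φ r * (r ^ (d - 1) * Real.exp (-(r ^ p / p)))) (Ioi 0 ∩ S)) :
    ∫⁻ r in S, ENNReal.ofReal (φ r) ∂radialMeasure k d p =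
      ENNReal.ofReal (k * ∫ r in Ioi 0 ∩ S, φ r * (r ^ (d - 1) * Real.exp (-(r ^ p / p)))) := by
  rw [setLIntegral_radialMeasure _ _ _ hS _ hφ.ennreal_ofReal, ← integral_const_mul,
    ofReal_integral_eq_lintegral_ofReal (hi.const_mul k)]
  · refine setLIntegral_congr_fun (measurableSet_Ioi.inter hS) fun r hr => ?_
    have hr0 : 0 < r := hr.1
    rw [← ENNReal.ofReal_mul (by positivity)]
    congr 1; ring
  · refine (ae_restrict_mem (measurableSet_Ioi.inter hS)).mono fun r hr => ?_
    have hr0 : 0 < r := hr.1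
    have := hφ0 r hr.2 hr0
    simp only [Pi.zero_apply]
    positivity

theorem ae_pos_radialMeasure (k d p : ℝ) : ∀ᵐ r ∂radialMeasure k d p, 0 < r :=
  (withDensity_absolutelyContinuous _ _).ae_le (ae_restrict_mem measurableSet_Ioi)

/-! ### Increments and the Cauchy–Schwarz inequality -/

theorem sq_lintegral_mul_le {α : Type*} [MeasurableSpace α] (μ : Measure α) {f g : α → ENNReal}
    (hf : AEMeasurable f μ) (hg : AEMeasurable g μ) :
    (∫⁻ a, f a * g a ∂μ) ^ 2 ≤ (∫⁻ a, f a ^ 2 ∂μ) * ∫⁻ a, g a ^ 2 ∂μ := by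
  have h := ENNReal.lintegral_mul_le_Lp_mul_Lq μ Real.HolderConjugate.two_two hf hg
  calc (∫⁻ a, f a * g a ∂μ) ^ 2 ≤ ((∫⁻ a, f a ^ (2:ℝ) ∂μ) ^ (1 / (2:ℝ)) *
        (∫⁻ a, g a ^ (2:ℝ) ∂μ) ^ (1 / (2:ℝ))) ^ 2 := by gcongr; exact h
    _ = _ := by
      rw [mul_pow, ← ENNReal.rpow_natCast, ← ENNReal.rpow_natCast, ← ENNReal.rpow_mul,
        ← ENNReal.rpow_mul]
      norm_num

/-- Cauchy–Schwarz against the weight u^(a-1), the derivative of u^a/a, so that equality holds for h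
= u^a. It serves with a = p in the Poincaré inequality and a = q - 1 in Hardy's. -/
theorem ofReal_sq_sub_le {a s t : ℝ} (ha : 0 < a) (hs : 0 ≤ s) (hst : s ≤ t) {h η : ℝ → ℝ}
    (hη : Measurable η)
    (hh : ENNReal.ofReal |h t - h s| ≤ ∫⁻ u in Ioc s t, ENNReal.ofReal |η u|) :
    ENNReal.ofReal ((h t - h s) ^ 2) ≤ ENNReal.ofReal ((t ^ a - s ^ a) / a) *
      ∫⁻ u in Ioc s t, ENNReal.ofReal (u ^ (1 - a) * η u ^ 2) := by
  have h1 : ∫⁻ u in Ioc s t, ENNReal.ofReal (u ^ (a - 1)) =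
      ENNReal.ofReal ((t ^ a - s ^ a) / a) := by
    have hi := intervalIntegral.intervalIntegrable_rpow' (a := s) (b := t) (r := a - 1)
      (by linarith)
    rw [← ofReal_integral_eq_lintegral_ofReal ((intervalIntegrable_iff_integrableOn_Ioc_of_le
      hst).1 hi), ← intervalIntegral.integral_of_le hst, integral_rpow (Or.inl (by linarith))]
    · simp
    · refine (ae_restrict_mem measurableSet_Ioc).mono fun u hu => ?_
      exact Real.rpow_nonneg (hs.trans hu.1.le) _
  have h2 : ∫⁻ u in Ioc s t, ENNReal.ofReal |η u| = ∫⁻ u in Ioc s t,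
      ENNReal.ofReal (u ^ ((a - 1) / 2)) * ENNReal.ofReal (u ^ ((1 - a) / 2) * |η u|) := by
    refine setLIntegral_congr_fun measurableSet_Ioc fun u hu => ?_
    have hu0 : 0 < u := hs.trans_lt hu.1
    rw [← ENNReal.ofReal_mul (by positivity), ← mul_assoc, ← Real.rpow_add hu0]
    ring_nf
    simp
  have h3 := sq_lintegral_mul_le (volume.restrict (Ioc s t))
    (f := fun u => ENNReal.ofReal (u ^ ((a - 1) / 2)))
    (g := fun u => ENNReal.ofReal (u ^ ((1 - a) / 2) * |η u|)) (by fun_prop) (by fun_prop)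
  rw [← sq_abs, ENNReal.ofReal_pow (abs_nonneg _)]
  refine (pow_le_pow_left₀ (zero_le) hh 2).trans ?_
  rw [h2]
  refine h3.trans_eq ?_
  rw [← h1]
  congr 1
  · refine setLIntegral_congr_fun measurableSet_Ioc fun u hu => ?_
    have hu0 : 0 < u := hs.trans_lt hu.1
    rw [← ENNReal.ofReal_pow (by positivity), ← Real.rpow_natCast, ← Real.rpow_mul hu0.le]
    congr 2; push_cast; ring
  · refine setLIntegral_congr_fun measurableSet_Ioc fun u hu => ?_
    have hu0 : 0 < u := hs.trans_lt hu.1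
    rw [← ENNReal.ofReal_pow (by positivity), mul_pow, sq_abs, ← Real.rpow_natCast (u ^ _) 2,
      ← Real.rpow_mul hu0.le]
    congr 3; push_cast; ring

theorem lintegral_setLIntegral_swap {γ : Type*} [MeasurableSpace γ] (α : Measure γ) [SFinite α]
    {S : Set (γ × ℝ)} (hS : MeasurableSet S) {ψ : ℝ → ENNReal} (hψ : Measurable ψ) :
    ∫⁻ z, (∫⁻ u in {u | (z, u) ∈ S}, ψ u) ∂α = ∫⁻ u, ψ u * α {z | (z, u) ∈ S} := by
  have e : ∀ z, ∫⁻ u in {u | (z, u) ∈ S}, ψ u = ∫⁻ u, S.indicator (fun w => ψ w.2) (z, u) := by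
    intro z
    rw [← lintegral_indicator (show MeasurableSet {u | (z, u) ∈ S} from measurable_prodMk_left hS)]
    rfl
  simp_rw [e]
  rw [lintegral_lintegral_swap (f := fun z u => S.indicator (fun w => ψ w.2) (z, u))
    ((hψ.comp measurable_snd).indicator hS).aemeasurable]
  refine lintegral_congr fun u => ?_
  rw [← setLIntegral_const,
    ← lintegral_indicator (show MeasurableSet {z | (z, u) ∈ S} from measurable_prodMk_right hS)]
  rfl

/-! ### One-dimensional inequalities -/

theorem integral_radialMeasure_total {k d p : ℝ} (hk : 0 ≤ k) (hd : 0 < d) (hp : 0 < p)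
    [IsProbabilityMeasure (radialMeasure k d p)] :
    k * ∫ r in Ioi 0, r ^ (d - 1) * Real.exp (-(r ^ p / p)) = 1 := by
  have h := setLIntegral_radialMeasure_ofReal (k := k) (d := d) (p := p) hk (S := univ)
    MeasurableSet.univ (fun _ => 1) measurable_const (fun _ _ _ => zero_le_one)
    (by simpa using integrableOn_radial (by linarith) hp)
  simp only [ENNReal.ofReal_one, inter_univ, one_mul, Measure.restrict_univ, lintegral_const,
    measure_univ] at h
  have h0 : 0 ≤ k * ∫ r in Ioi 0, r ^ (d - 1) * Real.exp (-(r ^ p / p)) :=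
    mul_nonneg hk (setIntegral_nonneg measurableSet_Ioi fun r hr => by
      have : (0:ℝ) < r := hr
      positivity)
  rw [← ENNReal.ofReal_one] at h
  exact ((ENNReal.ofReal_eq_ofReal_iff zero_le_one h0).1 h).symm

/-- Write t^p - s^p = (t^p - d) + (d - s^p). The first summand integrates over t ≥ u, and the second
over s < u, to the same explicit boundary value; the complementary factors are the masses of the two
sides of u, which add up to 1. -/
theorem setLIntegral_radialMeasure_kernel {k d p u : ℝ} (hk : 0 ≤ k) (hd : 0 < d) (hp : 0 < p)
    [IsProbabilityMeasure (radialMeasure k d p)] (hu : 0 < u) :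
    ∫⁻ z in Iio u ×ˢ Ici u, ENNReal.ofReal ((z.2 ^ p - z.1 ^ p) / p)
        ∂((radialMeasure k d p).prod (radialMeasure k d p)) =
      ENNReal.ofReal (k * (u ^ d * Real.exp (-(u ^ p / p))) / p) := by
  set D : ℝ → ℝ := fun r => r ^ (d - 1) * Real.exp (-(r ^ p / p)) with hD
  set W := u ^ d * Real.exp (-(u ^ p / p)) with hW
  have hDi : IntegrableOn D (Ioi 0) := integrableOn_radial (by linarith) hp
  have hGi : IntegrableOn (fun r => (r ^ p - d) * D r) (Ioi 0) := integrableOn_radial_deriv hd hp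
  have sub1 : Ioi u ⊆ Ioi 0 := Ioi_subset_Ioi hu.le
  have sub2 : Ioc 0 u ⊆ Ioi 0 := Ioc_subset_Ioi_self
  set A := k * ∫ r in Ioc 0 u, D r with hA
  set B := k * ∫ r in Ioi u, D r with hB
  have hAB : A + B = 1 := by
    rw [hA, hB, ← mul_add, ← setIntegral_union (Ioc_disjoint_Ioi le_rfl) measurableSet_Ioi
      (hDi.mono_set sub2) (hDi.mono_set sub1), Ioc_union_Ioi_eq_Ioi hu.le]
    exact integral_radialMeasure_total hk hd hp
  have hW1 : ∫ r in Ioi u, (r ^ p - d) * D r = W := integral_Ioi_radial hd hp hu.le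
  have hW2 : ∫ r in Ioc 0 u, (r ^ p - d) * D r = -W := integral_Ioc_radial hd hp hu.le
  have hs1 : Ioi (0 : ℝ) ∩ Ici u = Ici u := inter_eq_right.2 fun x hx => hu.trans_le hx
  have hs2 : Ioi (0 : ℝ) ∩ Iio u = Ioo 0 u := Ioi_inter_Iio
  have hin : ∀ s, 0 < s → s < u →
      ∫⁻ t in Ici u, ENNReal.ofReal ((t ^ p - s ^ p) / p) ∂radialMeasure k d p =
        ENNReal.ofReal ((k * W + (d - s ^ p) * B) / p) ∧ 0 ≤ (k * W + (d - s ^ p) * B) / p := by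
    intro s hs hsu
    have e : (fun r => (r ^ p - s ^ p) / p * D r) =
        fun r => 1 / p * ((r ^ p - d) * D r) + (d - s ^ p) / p * D r := by
      ext r; ring
    have hnn : ∀ r ∈ Ici u, 0 < r → 0 ≤ (r ^ p - s ^ p) / p := fun r hr hr0 =>
      div_nonneg (sub_nonneg.2 (Real.rpow_le_rpow hs.le (hsu.le.trans hr) hp.le)) hp.le
    have hi : IntegrableOn (fun r => (r ^ p - s ^ p) / p * D r) (Ioi 0) := by
      rw [e]; exact (hGi.const_mul _).add (hDi.const_mul _)
    have hval : k * ∫ r in Ici u, (r ^ p - s ^ p) / p * D r =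
        (k * W + (d - s ^ p) * B) / p := by
      rw [integral_Ici_eq_integral_Ioi, e, integral_add ((hGi.mono_set sub1).const_mul _)
        ((hDi.mono_set sub1).const_mul _), integral_const_mul, integral_const_mul, hW1, hB]
      ring
    constructor
    · rw [setLIntegral_radialMeasure_ofReal hk measurableSet_Ici _ (by fun_prop) hnn
        (hi.mono_set inter_subset_left), hs1, hval]
    · rw [← hval]
      refine mul_nonneg hk (setIntegral_nonneg measurableSet_Ici fun r hr => ?_)
      have h0 : 0 < r := hu.trans_le hr
      exact mul_nonneg (hnn r hr h0) (by simp only [hD]; positivity)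
  rw [← Measure.prod_restrict, lintegral_prod _ (by fun_prop)]
  have hpos : ∀ᵐ s ∂(radialMeasure k d p).restrict (Iio u), 0 < s ∧ s < u := by
    filter_upwards [ae_restrict_of_ae (ae_pos_radialMeasure k d p),
      ae_restrict_mem measurableSet_Iio] with s h1 h2 using ⟨h1, h2⟩
  rw [lintegral_congr_ae (hpos.mono fun s hs => (hin s hs.1 hs.2).1)]
  have e : (fun s => (k * W + (d - s ^ p) * B) / p * D s) =
      fun s => k * W / p * D s - B / p * ((s ^ p - d) * D s) := by
    ext r; ring
  have hi : IntegrableOn (fun s => (k * W + (d - s ^ p) * B) / p * D s) (Ioi 0) := by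
    rw [e]; exact (hDi.const_mul _).sub (hGi.const_mul _)
  rw [setLIntegral_radialMeasure_ofReal hk measurableSet_Iio _ (by fun_prop)
    (fun s h1 h2 => (hin s h2 h1).2) (hi.mono_set inter_subset_left), hs2]
  congr 1
  rw [← integral_Ioc_eq_integral_Ioo, e, integral_sub ((hDi.mono_set sub2).const_mul _)
    ((hGi.mono_set sub2).const_mul _), integral_const_mul, integral_const_mul, hW2]
  linear_combination (k * W / p) * hAB

theorem measurableSet_mem_Ioc {γ : Type*} [MeasurableSpace γ] {a b c : γ → ℝ} (ha : Measurable a)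
    (hb : Measurable b) (hc : Measurable c) : MeasurableSet {w | c w ∈ Ioc (a w) (b w)} :=
  (measurableSet_lt ha hc).inter (measurableSet_le hc hb)

theorem measurable_setLIntegral_Ioc {ψ : ℝ → ENNReal} (hψ : Measurable ψ) :
    Measurable fun z : ℝ × ℝ => ∫⁻ u in Ioc z.1 z.2, ψ u := by
  have hS : MeasurableSet {w : (ℝ × ℝ) × ℝ | w.2 ∈ Ioc w.1.1 w.1.2} :=
    measurableSet_mem_Ioc (by fun_prop) (by fun_prop) (by fun_prop)
  have e : (fun z : ℝ × ℝ => ∫⁻ u in Ioc z.1 z.2, ψ u) =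
      fun z => ∫⁻ u, indicator {w : (ℝ × ℝ) × ℝ | w.2 ∈ Ioc w.1.1 w.1.2} (fun w => ψ w.2) (z, u) := by
    ext z
    rw [← lintegral_indicator measurableSet_Ioc]
    rfl
  rw [e]
  exact ((hψ.comp measurable_snd).indicator hS).lintegral_prod_right'

/-- Tonelli: a point u lies in (s, t] exactly when (s, t) lies in the quadrant s < u ≤ t. -/
theorem lintegral_lintegral_setLIntegral_Ioc (ρ : Measure ℝ) [SFinite ρ] {c : ℝ × ℝ → ENNReal}
    (hc : Measurable c) {ψ : ℝ → ENNReal} (hψ : Measurable ψ) :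
    ∫⁻ s, ∫⁻ t, c (s, t) * (∫⁻ u in Ioc s t, ψ u) ∂ρ ∂ρ =
      ∫⁻ u, ψ u * ∫⁻ z in Iio u ×ˢ Ici u, c z ∂ρ.prod ρ := by
  have hS : MeasurableSet {w : (ℝ × ℝ) × ℝ | w.2 ∈ Ioc w.1.1 w.1.2} :=
    measurableSet_mem_Ioc (by fun_prop) (by fun_prop) (by fun_prop)
  have hF := measurable_setLIntegral_Ioc hψ
  have e1 : ∫⁻ s, ∫⁻ t, c (s, t) * (∫⁻ u in Ioc s t, ψ u) ∂ρ ∂ρ =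
      ∫⁻ z, (∫⁻ u in Ioc z.1 z.2, ψ u) ∂(ρ.prod ρ).withDensity c := by
    rw [lintegral_withDensity_eq_lintegral_mul _ hc hF, lintegral_prod _ (hc.mul hF).aemeasurable]
    rfl
  rw [e1]
  refine (lintegral_setLIntegral_swap ((ρ.prod ρ).withDensity c) hS hψ).trans ?_
  refine lintegral_congr fun u => ?_
  have e3 : {z : ℝ × ℝ | (z, u) ∈ {w : (ℝ × ℝ) × ℝ | w.2 ∈ Ioc w.1.1 w.1.2}} =
      Iio u ×ˢ Ici u := by
    ext z; simp
  rw [e3, withDensity_apply _ (measurableSet_Iio.prod measurableSet_Ici)]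

theorem lintegral_radialMeasure_increment {k d p : ℝ} (hk : 0 ≤ k) (hd : 0 < d) (hp : 0 < p)
    [IsProbabilityMeasure (radialMeasure k d p)] {η : ℝ → ℝ} (hη : Measurable η) :
    ∫⁻ s, ∫⁻ t, ENNReal.ofReal ((t ^ p - s ^ p) / p) *
        (∫⁻ u in Ioc s t, ENNReal.ofReal (u ^ (1 - p) * η u ^ 2))
        ∂radialMeasure k d p ∂radialMeasure k d p =
      ENNReal.ofReal (1 / p) *
        ∫⁻ u, ENNReal.ofReal (u ^ (2 - p) * η u ^ 2) ∂radialMeasure k d p := by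
  rw [lintegral_lintegral_setLIntegral_Ioc (radialMeasure k d p)
    (c := fun z => ENNReal.ofReal ((z.2 ^ p - z.1 ^ p) / p))
    (ψ := fun u => ENNReal.ofReal (u ^ (1 - p) * η u ^ 2)) (by fun_prop) (by fun_prop),
    lintegral_radialMeasure _ _ _ _ (by fun_prop), ← lintegral_const_mul _
      (by fun_prop), ← lintegral_indicator measurableSet_Ioi]
  refine lintegral_congr fun u => ?_
  by_cases hu : 0 < u
  · rw [setLIntegral_radialMeasure_kernel hk hd hp hu, indicator_of_mem (by exact hu),
      ← ENNReal.ofReal_mul (by positivity), ← ENNReal.ofReal_mul (by positivity),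
      ← ENNReal.ofReal_mul (by positivity)]
    congr 1
    have x1 : u ^ (2 - p) = u ^ (1 - p) * u := by
      rw [← Real.rpow_add_one hu.ne']; ring_nf
    have x2 : u ^ d = u ^ (d - 1) * u := by
      rw [← Real.rpow_add_one hu.ne']; ring_nf
    rw [x1, x2]; field_simp
  · rw [indicator_of_notMem (by exact hu)]
    have h0 : radialMeasure k d p (Iio u) = 0 := by
      refine measure_mono_null (fun x hx => ?_) (ae_iff.1 (ae_pos_radialMeasure k d p))
      exact not_lt.2 ((le_of_lt hx).trans (not_lt.1 hu))
    rw [setLIntegral_measure_zero _ _ (by rw [Measure.prod_prod, h0, zero_mul]), mul_zero]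

/-- Symmetrisation: a bound available for ordered pairs only is used in both orders, and the
resulting factor 2 cancels the one half in `pairVar`. -/
theorem pairVar_le_of_le_add {α : Type*} [MeasurableSpace α] (ρ : Measure α) [SFinite ρ]
    {h : α → ℝ} {K : α × α → ENNReal} (hK : Measurable K)
    (hle : ∀ᵐ s ∂ρ, ∀ᵐ t ∂ρ, ENNReal.ofReal ((h s - h t) ^ 2) ≤ K (s, t) + K (t, s)) :
    pairVar ρ h ≤ ∫⁻ s, ∫⁻ t, K (s, t) ∂ρ ∂ρ := by
  have hsw : ∫⁻ s, ∫⁻ t, K (t, s) ∂ρ ∂ρ = ∫⁻ s, ∫⁻ t, K (s, t) ∂ρ ∂ρ :=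
    lintegral_lintegral_swap (hK.comp measurable_swap).aemeasurable
  have hsum : ∫⁻ s, ∫⁻ t, (K (s, t) + K (t, s)) ∂ρ ∂ρ =
      ∫⁻ s, ∫⁻ t, K (s, t) ∂ρ ∂ρ + ∫⁻ s, ∫⁻ t, K (t, s) ∂ρ ∂ρ := by
    rw [← lintegral_add_left hK.lintegral_prod_right']
    exact lintegral_congr fun s => lintegral_add_left (hK.comp measurable_prodMk_left) _
  calc pairVar ρ h ≤ 2⁻¹ * ∫⁻ s, ∫⁻ t, (K (s, t) + K (t, s)) ∂ρ ∂ρ :=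
        mul_le_mul_right (lintegral_mono_ae (hle.mono fun s hs => lintegral_mono_ae hs)) _
    _ = _ := by
        rw [hsum, hsw, ← two_mul, ← mul_assoc, ENNReal.inv_mul_cancel two_ne_zero (by simp),
          one_mul]

/-- The Poincaré inequality for radial measures, with the weight given by their Stein kernel. -/
theorem pairVar_radialMeasure_le {k d p : ℝ} (hk : 0 ≤ k) (hd : 0 < d) (hp : 0 < p)
    [IsProbabilityMeasure (radialMeasure k d p)] {h η : ℝ → ℝ} (hη : Measurable η)
    (hh : ∀ s t, 0 < s → s ≤ t →
      ENNReal.ofReal |h t - h s| ≤ ∫⁻ u in Ioc s t, ENNReal.ofReal |η u|) :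
    pairVar (radialMeasure k d p) h ≤
      ENNReal.ofReal (1 / p) *
        ∫⁻ u, ENNReal.ofReal (u ^ (2 - p) * η u ^ 2) ∂radialMeasure k d p := by
  rw [← lintegral_radialMeasure_increment hk hd hp hη]
  -- For pairs in the wrong order the interval `Ioc` is empty and this kernel vanishes.
  refine pairVar_le_of_le_add _ (K := fun z => ENNReal.ofReal ((z.2 ^ p - z.1 ^ p) / p) *
    (∫⁻ u in Ioc z.1 z.2, ENNReal.ofReal (u ^ (1 - p) * η u ^ 2))) ?_ ?_
  · have := measurable_setLIntegral_Ioc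
      (ψ := fun u => ENNReal.ofReal (u ^ (1 - p) * η u ^ 2)) (by fun_prop)
    fun_prop
  filter_upwards [ae_pos_radialMeasure k d p] with s hs
  filter_upwards [ae_pos_radialMeasure k d p] with t ht
  rcases le_total s t with hst | hst
  · rw [sub_sq_comm]
    exact (ofReal_sq_sub_le hp hs.le hst hη (hh s t hs hst)).trans le_self_add
  · exact (ofReal_sq_sub_le hp ht.le hst hη (hh t s ht hst)).trans le_add_self

/-- Only the tail beyond u enters, so d = 0 is admissible; that is the case Hardy's inequality
needs. For d > 0 the point u must lie beyond the sign change of r^p - d, because `ENNReal.ofReal`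
would cut off negative values. -/
theorem setLIntegral_Ici_radialMeasure {k d p u : ℝ} (hk : 0 ≤ k) (hu : 0 < u)
    (hp : 0 < p) (hd : d = 0 ∨ 0 < d ∧ d ≤ u ^ p) :
    ∫⁻ r in Ici u, ENNReal.ofReal (r ^ p - d) * ENNReal.ofReal (r ^ (d - 1) *
      Real.exp (-(r ^ p / p)) * k) = ENNReal.ofReal (k * (u ^ d * Real.exp (-(u ^ p / p)))) := by
  have hdu : d ≤ u ^ p := by
    rcases hd with h | h
    · rw [h]; positivity
    · exact h.2
  have hnn : ∀ r ∈ Ici u, 0 < r ∧ 0 ≤ r ^ p - d := fun r hr =>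
    ⟨hu.trans_le hr, sub_nonneg.2 (hdu.trans (Real.rpow_le_rpow hu.le hr hp.le))⟩
  have hi : IntegrableOn (fun r : ℝ => (r ^ p - d) * (r ^ (d - 1) * Real.exp (-(r ^ p / p))))
      (Ioi u) := by
    rcases hd with h | h
    · subst h
      refine ((integrableOn_radial (s := p + (0 - 1)) (by linarith) hp).mono_set
        (Ioi_subset_Ioi hu.le)).congr_fun (fun r hr => ?_) measurableSet_Ioi
      simp only [sub_zero]
      rw [Real.rpow_add (hu.trans hr)]; ring_nf
    · exact (integrableOn_radial_deriv h.1 hp).mono_set (Ioi_subset_Ioi hu.le)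
  have hval : ∫ r in Ioi u, (r ^ p - d) * (r ^ (d - 1) * Real.exp (-(r ^ p / p))) =
      u ^ d * Real.exp (-(u ^ p / p)) := by
    rw [integral_Ioi_of_hasDerivAt_of_tendsto (m := 0)
      (hasDerivAt_radial (d := d) hp hu).continuousAt.continuousWithinAt
      (fun x hx => hasDerivAt_radial hp (hu.trans hx)) hi]
    · ring
    · simpa using (tendsto_radial_atTop (d := d) hp).neg
  rw [← hval, ← integral_const_mul, setLIntegral_congr Ioi_ae_eq_Ici.symm,
    ofReal_integral_eq_lintegral_ofReal (hi.const_mul k)]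
  · refine setLIntegral_congr_fun measurableSet_Ioi fun r hr => ?_
    have := hnn r (mem_Ici.2 (le_of_lt (mem_Ioi.1 hr)))
    have h0 := this.1
    rw [← ENNReal.ofReal_mul this.2]
    congr 1; ring
  · refine (ae_restrict_mem measurableSet_Ioi).mono fun r hr => ?_
    have := hnn r (mem_Ici.2 (le_of_lt (mem_Ioi.1 hr)))
    have h0 := this.1
    have h1 := this.2
    simp only [Pi.zero_apply]
    positivity

theorem setLIntegral_Ioo_radialMeasure {k d p u : ℝ} (hk : 0 ≤ k) (hu : 0 < u)
    (hp : 0 < p) (hd : 0 < d) (hdu : u ^ p ≤ d) :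
    ∫⁻ r in Ioo 0 u, ENNReal.ofReal (d - r ^ p) * ENNReal.ofReal (r ^ (d - 1) *
      Real.exp (-(r ^ p / p)) * k) = ENNReal.ofReal (k * (u ^ d * Real.exp (-(u ^ p / p)))) := by
  have hi := (integrableOn_radial_deriv hd hp).mono_set (s := Ioc 0 u) Ioc_subset_Ioi_self
  have hval := integral_Ioc_radial hd hp hu.le
  have hnn : ∀ r ∈ Ioc 0 u, 0 < r ∧ 0 ≤ d - r ^ p := fun r hr =>
    ⟨hr.1, sub_nonneg.2 ((Real.rpow_le_rpow hr.1.le hr.2 hp.le).trans hdu)⟩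
  rw [neg_eq_iff_eq_neg.1 hval.symm, ← mul_neg_one, mul_comm _ (-1 : ℝ), ← mul_assoc,
    ← integral_const_mul, setLIntegral_congr Ioo_ae_eq_Ioc,
    ofReal_integral_eq_lintegral_ofReal (hi.const_mul _)]
  · refine setLIntegral_congr_fun measurableSet_Ioc fun r hr => ?_
    have := hnn r hr
    have h0 := this.1
    rw [← ENNReal.ofReal_mul this.2]
    congr 1; ring
  · refine (ae_restrict_mem measurableSet_Ioc).mono fun r hr => ?_
    have := hnn r hr
    have h0 := this.1
    have h1 : 0 ≤ (d - r ^ p) * (r ^ (d - 1) * Real.exp (-(r ^ p / p))) * k := by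
      have := this.2
      positivity
    simp only [Pi.zero_apply]
    linarith

/-- Hardy's inequality on the half-line for the weight `exp (-t ^ q / q)`. -/
theorem lintegral_sq_radialMeasure_le_of_zero {k q : ℝ} (hk : 0 ≤ k) (hq : 1 < q) {h η : ℝ → ℝ}
    (hη : Measurable η)
    (hh : ∀ t, 0 < t → ENNReal.ofReal |h t| ≤ ∫⁻ u in Ioc 0 t, ENNReal.ofReal |η u|) :
    ∫⁻ t, ENNReal.ofReal (h t ^ 2) ∂radialMeasure k 1 q ≤ ENNReal.ofReal (1 / (q - 1)) *
      ∫⁻ u, ENNReal.ofReal (u ^ (2 - q) * η u ^ 2) ∂radialMeasure k 1 q := by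
  set ψ : ℝ → ENNReal := fun u => ENNReal.ofReal (u ^ (2 - q) * η u ^ 2) with hψ
  have hψm : Measurable ψ := by fun_prop
  set c : ℝ → ENNReal := fun t => ENNReal.ofReal (t ^ (q - 1) / (q - 1)) with hc
  have hcm : Measurable c := by fun_prop
  have hq1 : 0 < q - 1 := by linarith
  have h1 : ∀ᵐ t ∂radialMeasure k 1 q, ENNReal.ofReal (h t ^ 2) ≤
      c t * ∫⁻ u in Ioc 0 t, ψ u := by
    filter_upwards [ae_pos_radialMeasure k 1 q] with t ht
    -- The hypothesis bounds `h t` itself and says nothing of `h 0`, so the value at 0 is reset to 0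
    -- before the increment from 0 to t is taken.
    have := ofReal_sq_sub_le (h := fun x => if x = 0 then 0 else h x) hq1 le_rfl ht.le hη
      (by simpa [ht.ne'] using hh t ht)
    simp only [ht.ne', if_false, if_true, sub_zero, Real.zero_rpow hq1.ne'] at this
    convert this using 7
    ring
  have hS : MeasurableSet {w : ℝ × ℝ | w.2 ∈ Ioc 0 w.1} :=
    measurableSet_mem_Ioc (by fun_prop) (by fun_prop) (by fun_prop)
  have hF : Measurable fun t => ∫⁻ u in Ioc 0 t, ψ u :=
    (measurable_setLIntegral_Ioc hψm).comp (measurable_const.prodMk measurable_id)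
  have h2 : ∫⁻ t, c t * (∫⁻ u in Ioc 0 t, ψ u) ∂radialMeasure k 1 q =
      ∫⁻ u, ψ u * (radialMeasure k 1 q).withDensity c {t | u ∈ Ioc 0 t} := by
    refine Eq.trans ?_ (lintegral_setLIntegral_swap _ hS hψm)
    exact (lintegral_withDensity_eq_lintegral_mul _ hcm hF).symm
  refine (lintegral_mono_ae h1).trans_eq ?_
  rw [h2, lintegral_radialMeasure _ _ _ _ hψm, ← lintegral_const_mul _ (by fun_prop),
    ← lintegral_indicator measurableSet_Ioi]
  refine lintegral_congr fun u => ?_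
  by_cases hu : 0 < u
  · rw [indicator_of_mem (by exact hu)]
    have e : {t | u ∈ Ioc 0 t} = Ici u := by ext; simp [hu]
    have hs1 : Ioi (0 : ℝ) ∩ Ici u = Ici u := inter_eq_right.2 fun x hx => hu.trans_le hx
    rw [e, withDensity_apply _ measurableSet_Ici, setLIntegral_radialMeasure _ _ _
      measurableSet_Ici _ hcm, hs1]
    -- The integral of t^(q-1) exp(-t^q/q) over [u, ∞) is exactly exp(-u^q/q), the density at u:
    -- Fubini reproduces the original measure with the factor 1/(q-1).
    have := setLIntegral_Ici_radialMeasure (k := k * (1 / (q - 1))) (u := u) (p := q) (d := 0)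
      (by positivity) hu (by linarith) (Or.inl rfl)
    rw [mul_comm]
    have e2 : ∫⁻ r in Ici u, ENNReal.ofReal (k * (r ^ ((1:ℝ) - 1) * Real.exp (-(r ^ q / q)))) * c r =
        ENNReal.ofReal (k * (1 / (q - 1)) * (u ^ (0:ℝ) * Real.exp (-(u ^ q / q)))) := by
      rw [← this]
      refine setLIntegral_congr_fun measurableSet_Ici fun r hr => ?_
      have hr0 : 0 < r := hu.trans_le hr
      simp only [hc]
      rw [← ENNReal.ofReal_mul (by positivity), ← ENNReal.ofReal_mul (by simp; positivity)]
      congr 1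
      rw [sub_self, zero_sub, sub_zero, Real.rpow_zero, Real.rpow_neg_one, Real.rpow_sub_one hr0.ne']
      ring
    rw [e2, hψ, ← mul_assoc, ← ENNReal.ofReal_mul (by positivity),
      ← ENNReal.ofReal_mul (by positivity), ← ENNReal.ofReal_mul (by positivity)]
    congr 1
    rw [sub_self]
    ring
  · rw [indicator_of_notMem (by exact hu)]
    have e : {t | u ∈ Ioc 0 t} = ∅ := by ext; simp [hu]
    rw [e, measure_empty, mul_zero]

/-- With P = r^p, Q = s^p and b the increment of h, this is the convexity inequality (x + b)²/P ≤
x²/Q + b²/(P - Q), followed by the weighted Cauchy–Schwarz bound for b². Both are equalities for h =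
u^p, the ground state. -/
theorem ofReal_sq_mul_rpow_le {p s r : ℝ} (hp : 0 < p) (hs : 0 < s) (hsr : s ≤ r) {h η : ℝ → ℝ}
    (hη : Measurable η)
    (hh : ENNReal.ofReal |h r - h s| ≤ ∫⁻ u in Ioc s r, ENNReal.ofReal |η u|) :
    ENNReal.ofReal (h r ^ 2 * r ^ (-p)) ≤ ENNReal.ofReal (h s ^ 2 * s ^ (-p)) +
      ENNReal.ofReal (1 / p) * ∫⁻ u in Ioc s r, ENNReal.ofReal (u ^ (1 - p) * η u ^ 2) := by
  have hr : 0 < r := hs.trans_le hsr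
  have h1 := ofReal_sq_sub_le hp hs.le hsr hη hh
  generalize (∫⁻ u in Ioc s r, ENNReal.ofReal (u ^ (1 - p) * η u ^ 2)) = I at h1 ⊢
  by_cases hItop : I = ⊤
  · rw [hItop, ENNReal.mul_top (by simpa using hp)]; simp
  lift I to NNReal using hItop
  rw [← ENNReal.ofReal_coe_nnreal] at h1 ⊢
  have hPQ : s ^ p ≤ r ^ p := Real.rpow_le_rpow hs.le hsr hp.le
  have hQ : 0 < s ^ p := by positivity
  have hP : 0 < r ^ p := by positivity
  rw [← ENNReal.ofReal_mul (div_nonneg (sub_nonneg.2 hPQ) hp.le)] at h1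
  replace h1 := (ENNReal.ofReal_le_ofReal_iff
    (mul_nonneg (div_nonneg (sub_nonneg.2 hPQ) hp.le) I.2)).1 h1
  rw [← ENNReal.ofReal_mul (by positivity), ← ENNReal.ofReal_add (by positivity) (by positivity)]
  refine ENNReal.ofReal_le_ofReal ?_
  rw [Real.rpow_neg hr.le, Real.rpow_neg hs.le, ← div_eq_mul_inv, div_le_iff₀ hP]
  set P := r ^ p
  set Q := s ^ p
  set J : ℝ := 1 / p * I with hJ
  have hJ0 : 0 ≤ J := by positivity
  have h2 : (h r - h s) ^ 2 ≤ (P - Q) * J := by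
    rw [hJ, show (P - Q) * (1 / p * (I : ℝ)) = (P - Q) / p * I by ring]
    exact h1
  rcases hPQ.eq_or_lt with he | hlt
  · rw [← he, sub_self, zero_mul] at h2
    have : h r = h s := by
      have := pow_eq_zero_iff (two_ne_zero) |>.1 (le_antisymm h2 (sq_nonneg _))
      linarith
    rw [this, ← he, add_mul, inv_mul_cancel_right₀ hQ.ne']
    have := mul_nonneg hJ0 hQ.le
    linarith
  · have hD : 0 < P - Q := sub_pos.2 hlt
    set b := h r - h s with hb
    have hb' : h r = h s + b := by rw [hb]; ring
    have hbJ : b ^ 2 / (P - Q) ≤ J := by rwa [div_le_iff₀' hD]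
    -- The defect in the convexity inequality as an explicit square.
    have e : (h s ^ 2 * Q⁻¹ + b ^ 2 / (P - Q)) * P - (h s + b) ^ 2 =
        (h s * (P - Q) - Q * b) ^ 2 / (Q * (P - Q)) := by
      have := hD.ne'
      field_simp
      ring
    have e0 : 0 ≤ (h s * (P - Q) - Q * b) ^ 2 / (Q * (P - Q)) := by positivity
    have e1 : b ^ 2 / (P - Q) * P ≤ J * P := mul_le_mul_of_nonneg_right hbJ hP.le
    rw [hb']
    linarith

/-- The ground state inequality for radial measures, with ground state `r ^ p`. -/
theorem lintegral_sq_radialMeasure_le {k d p : ℝ} (hk : 0 ≤ k) (hd : 0 < d) (hp : 0 < p)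
    {h η : ℝ → ℝ} (hm : Measurable h) (hη : Measurable η)
    (hh : ∀ s t, 0 < s → s ≤ t →
      ENNReal.ofReal |h t - h s| ≤ ∫⁻ u in Ioc s t, ENNReal.ofReal |η u|) :
    ∫⁻ r, ENNReal.ofReal (h r ^ 2) ∂radialMeasure k d p ≤
      ∫⁻ r, ENNReal.ofReal (d * (h r ^ 2 * r ^ (-p))) ∂radialMeasure k d p +
      ENNReal.ofReal (1 / p) *
        ∫⁻ u, ENNReal.ofReal (u ^ (2 - p) * η u ^ 2) ∂radialMeasure k d p := by
  set ρ := radialMeasure k d p with hρ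
  -- The turning point, where r^p - d changes sign. `G` and `H` are the positive and negative parts
  -- of r^p - d, and φ = h² r^(-p) is compared across R, always from the smaller radius to the
  -- larger one.
  set R := d ^ (1 / p) with hR
  have hR0 : 0 < R := by positivity
  have hRp : R ^ p = d := by rw [hR, ← Real.rpow_mul hd.le, one_div_mul_cancel hp.ne', Real.rpow_one]
  set φ : ℝ → ENNReal := fun r => ENNReal.ofReal (h r ^ 2 * r ^ (-p)) with hφ
  have hφm : Measurable φ := by fun_prop
  set ψ : ℝ → ENNReal := fun u => ENNReal.ofReal (u ^ (1 - p) * η u ^ 2) with hψ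
  have hψm : Measurable ψ := by fun_prop
  set G : ℝ → ENNReal := fun r => ENNReal.ofReal (r ^ p - d) with hG
  have hGm : Measurable G := by fun_prop
  set H : ℝ → ENNReal := fun r => ENNReal.ofReal (d - r ^ p) with hH
  have hHm : Measurable H := by fun_prop
  set W : ℝ → ENNReal := fun u => ENNReal.ofReal (k * (u ^ d * Real.exp (-(u ^ p / p)))) with hW
  have hWm : Measurable W := by fun_prop
  have hpos := ae_pos_radialMeasure k d p
  have hGi : ∀ u, R ≤ u → ρ.withDensity G (Ici u) = W u := fun u hu => by
    have hu0 := hR0.trans_le hu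
    rw [withDensity_apply _ measurableSet_Ici, hρ, setLIntegral_radialMeasure _ _ _
      measurableSet_Ici _ hGm, inter_eq_right.2 (Ici_subset_Ioi.2 hu0)]
    refine Eq.trans ?_ (setLIntegral_Ici_radialMeasure hk hu0 hp
      (Or.inr ⟨hd, hRp ▸ Real.rpow_le_rpow hR0.le hu hp.le⟩))
    exact lintegral_congr fun r => by rw [mul_comm, mul_comm k]
  have hHi : ∀ u, 0 < u → u ≤ R → ρ.withDensity H (Iio u) = W u := fun u hu hu' => by
    rw [withDensity_apply _ measurableSet_Iio, hρ, setLIntegral_radialMeasure _ _ _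
      measurableSet_Iio _ hHm, Ioi_inter_Iio]
    refine Eq.trans ?_ (setLIntegral_Ioo_radialMeasure hk hu hp hd
      (hRp ▸ Real.rpow_le_rpow hu.le hu' hp.le))
    exact lintegral_congr fun r => by rw [mul_comm, mul_comm k]
  have hF1 : Measurable fun t => ∫⁻ u in Ioc R t, ψ u :=
    (measurable_setLIntegral_Ioc hψm).comp (measurable_const.prodMk measurable_id)
  have hF2 : Measurable fun t => ∫⁻ u in Ioc t R, ψ u :=
    (measurable_setLIntegral_Ioc hψm).comp (measurable_id.prodMk measurable_const)
  have hS1 : MeasurableSet {w : ℝ × ℝ | w.2 ∈ Ioc R w.1} :=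
    measurableSet_mem_Ioc (by fun_prop) (by fun_prop) (by fun_prop)
  have hS2 : MeasurableSet {w : ℝ × ℝ | w.2 ∈ Ioc w.1 R} :=
    measurableSet_mem_Ioc (by fun_prop) (by fun_prop) (by fun_prop)
  have up : ∫⁻ r, G r * (∫⁻ u in Ioc R r, ψ u) ∂ρ = ∫⁻ u in Ioi R, W u * ψ u := by
    refine (lintegral_withDensity_eq_lintegral_mul _ hGm hF1).symm.trans ?_
    refine (lintegral_setLIntegral_swap _ hS1 hψm).trans ?_
    rw [← lintegral_indicator measurableSet_Ioi]
    refine lintegral_congr fun u => ?_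
    by_cases hu : R < u
    · have e : {z | (z, u) ∈ {w : ℝ × ℝ | w.2 ∈ Ioc R w.1}} = Ici u := by ext; simp [hu]
      rw [e, hGi u hu.le, indicator_of_mem (by exact hu), mul_comm]
    · have e : {z | (z, u) ∈ {w : ℝ × ℝ | w.2 ∈ Ioc R w.1}} = ∅ := by ext; simp [hu]
      rw [e, indicator_of_notMem (by exact hu), measure_empty, mul_zero]
  have lo : ∫⁻ r, H r * (∫⁻ u in Ioc r R, ψ u) ∂ρ = ∫⁻ u in Ioc 0 R, W u * ψ u := by
    refine (lintegral_withDensity_eq_lintegral_mul _ hHm hF2).symm.trans ?_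
    refine (lintegral_setLIntegral_swap _ hS2 hψm).trans ?_
    rw [← lintegral_indicator measurableSet_Ioc]
    refine lintegral_congr fun u => ?_
    by_cases hu : u ≤ R
    · have e : {z | (z, u) ∈ {w : ℝ × ℝ | w.2 ∈ Ioc w.1 R}} = Iio u := by ext; simp [hu]
      rw [e]
      by_cases hu0 : 0 < u
      · rw [hHi u hu0 hu, indicator_of_mem (by exact ⟨hu0, hu⟩), mul_comm]
      · rw [indicator_of_notMem (fun h => hu0 h.1), withDensity_apply _ measurableSet_Iio,
          setLIntegral_measure_zero, mul_zero]
        refine measure_mono_null (fun x hx => ?_) (ae_iff.1 hpos)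
        exact not_lt.2 ((le_of_lt hx).trans (not_lt.1 hu0))
    · have e : {z | (z, u) ∈ {w : ℝ × ℝ | w.2 ∈ Ioc w.1 R}} = ∅ := by ext; simp [hu]
      rw [e, indicator_of_notMem (fun h => hu h.2), measure_empty, mul_zero]
  -- `G` beyond R and `H` below R have the same total integral `W R`, so the value `φ R` passes from
  -- this bound to the next one without loss.
  have s1 : ∫⁻ r, φ r * G r ∂ρ ≤ φ R * W R + ENNReal.ofReal (1 / p) * ∫⁻ u in Ioi R, W u * ψ u := by
    rw [← up, ← hGi R le_rfl, withDensity_apply _ measurableSet_Ici,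
      ← lintegral_indicator measurableSet_Ici, ← lintegral_const_mul _ (hGm.indicator
      measurableSet_Ici), ← lintegral_const_mul (f := fun r => G r * ∫⁻ u in Ioc R r, ψ u) _ (hGm.mul hF1),
      ← lintegral_add_left (by exact (hGm.indicator measurableSet_Ici).const_mul _)]
    refine lintegral_mono_ae (hpos.mono fun r hr => ?_)
    rcases le_or_gt R r with hRr | hRr
    · rw [indicator_of_mem (by exact hRr)]
      refine (mul_le_mul_left (ofReal_sq_mul_rpow_le hp hR0 hRr hη (hh R r hR0 hRr)) _).trans_eq ?_
      ring
    · have : G r = 0 := ENNReal.ofReal_eq_zero.2 (sub_nonpos.2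
        (hRp ▸ Real.rpow_le_rpow hr.le hRr.le hp.le))
      simp [this]
  have s2 : φ R * W R ≤ ∫⁻ r, φ r * H r ∂ρ + ENNReal.ofReal (1 / p) * ∫⁻ u in Ioc 0 R, W u * ψ u := by
    rw [← lo, ← hHi R hR0 le_rfl, withDensity_apply _ measurableSet_Iio,
      ← lintegral_indicator measurableSet_Iio, ← lintegral_const_mul _ (hHm.indicator
      measurableSet_Iio), ← lintegral_const_mul (f := fun r => H r * ∫⁻ u in Ioc r R, ψ u) _ (hHm.mul hF2),
      ← lintegral_add_left (by exact hφm.mul hHm)]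
    refine lintegral_mono_ae (hpos.mono fun r hr => ?_)
    rcases lt_or_ge r R with hRr | hRr
    · rw [indicator_of_mem (by exact hRr)]
      refine (mul_le_mul_left (ofReal_sq_mul_rpow_le hp hr hRr.le hη (hh r R hr hRr.le)) _).trans_eq ?_
      ring
    · rw [indicator_of_notMem (by exact not_lt.2 hRr), mul_zero]
      exact zero_le
  have s3 : ENNReal.ofReal (1 / p) * (∫⁻ u in Ioc 0 R, W u * ψ u) +
      ENNReal.ofReal (1 / p) * ∫⁻ u in Ioi R, W u * ψ u = ENNReal.ofReal (1 / p) *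
        ∫⁻ u, ENNReal.ofReal (u ^ (2 - p) * η u ^ 2) ∂ρ := by
    rw [← mul_add, ← lintegral_union measurableSet_Ioi (Ioc_disjoint_Ioi le_rfl),
      Ioc_union_Ioi_eq_Ioi hR0.le, hρ, lintegral_radialMeasure _ _ _ _ (by fun_prop)]
    congr 1
    refine setLIntegral_congr_fun measurableSet_Ioi fun u hu => ?_
    have hu0 : 0 < u := hu
    simp only [hW, hψ]
    rw [← ENNReal.ofReal_mul (by positivity), ← ENNReal.ofReal_mul (by positivity)]
    congr 1
    have x1 : u ^ (2 - p) = u ^ (1 - p) * u := by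
      rw [← Real.rpow_add_one hu0.ne']; ring_nf
    have x2 : u ^ d = u ^ (d - 1) * u := by
      rw [← Real.rpow_add_one hu0.ne']; ring_nf
    rw [x1, x2]; ring
  set D := ENNReal.ofReal (1 / p) * ∫⁻ u, ENNReal.ofReal (u ^ (2 - p) * η u ^ 2) ∂ρ with hD
  -- This is the claim in disguise: h² - d φ = φ (r^p - d) = φ G - φ H, so it remains to subtract
  -- the integral of φ H.
  have s4 : ∫⁻ r, φ r * G r ∂ρ ≤ ∫⁻ r, φ r * H r ∂ρ + D := by
    rw [← s3, ← add_assoc]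
    exact s1.trans (add_le_add_left s2 _)
  have s5 : ∫⁻ r, ENNReal.ofReal (h r ^ 2) ∂ρ + ∫⁻ r, φ r * H r ∂ρ =
      ∫⁻ r, ENNReal.ofReal (d * (h r ^ 2 * r ^ (-p))) ∂ρ + ∫⁻ r, φ r * G r ∂ρ := by
    rw [← lintegral_add_left (by fun_prop), ← lintegral_add_left (by fun_prop)]
    refine lintegral_congr_ae (hpos.mono fun r hr => ?_)
    have e : h r ^ 2 = h r ^ 2 * r ^ (-p) * r ^ p := by
      rw [mul_assoc, ← Real.rpow_add hr]; simp
    have e' : 0 ≤ h r ^ 2 * r ^ (-p) := by positivity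
    have er : 0 < r ^ p := by positivity
    simp only [hφ, hH, hG]
    rw [← ENNReal.ofReal_mul e', ← ENNReal.ofReal_mul e']
    rcases le_total (r ^ p) d with hle | hle
    · rw [ENNReal.ofReal_of_nonpos (p := _ * (r ^ p - d))
        (mul_nonpos_of_nonneg_of_nonpos e' (by linarith)), add_zero, ← ENNReal.ofReal_add
        (by positivity) (mul_nonneg e' (by linarith))]
      congr 1
      linear_combination e
    · rw [ENNReal.ofReal_of_nonpos (p := _ * (d - r ^ p))
        (mul_nonpos_of_nonneg_of_nonpos e' (by linarith)), add_zero, ← ENNReal.ofReal_add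
        (by positivity) (mul_nonneg e' (by linarith))]
      congr 1
      linear_combination e
  -- The subtraction needs a finite integral; if it is infinite, φ H ≤ d φ makes the right-hand side
  -- infinite too.
  by_cases htop : ∫⁻ r, φ r * H r ∂ρ = ⊤
  · have : ∫⁻ r, φ r * H r ∂ρ ≤ ∫⁻ r, ENNReal.ofReal (d * (h r ^ 2 * r ^ (-p))) ∂ρ := by
      refine lintegral_mono_ae (hpos.mono fun r hr => ?_)
      simp only [hφ, hH]
      have e' : 0 ≤ h r ^ 2 * r ^ (-p) := by positivity
      have er : 0 < r ^ p := by positivity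
      rw [← ENNReal.ofReal_mul e', mul_comm d]
      exact ENNReal.ofReal_le_ofReal (mul_le_mul_of_nonneg_left (by linarith) e')
    rw [htop, top_le_iff] at this
    rw [this]; simp
  · refine (ENNReal.add_le_add_iff_right htop).1 ?_
    rw [s5, add_assoc, add_comm D]
    exact add_le_add_right s4 _

/-! ### Variance as a double integral -/

section PairVar

variable {α β : Type*} [MeasurableSpace α] [MeasurableSpace β]

theorem measurable_lintegral_lintegral_sq {μ : Measure β} [SFinite μ] {f : α → β → ℝ}
    (hf : Measurable fun z : α × β => f z.1 z.2) : Measurable fun x => pairVar μ (f x) := by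
  unfold pairVar
  refine Measurable.const_mul ?_ _
  have h1 : Measurable fun w : (α × β) × β => ENNReal.ofReal ((f w.1.1 w.1.2 - f w.1.1 w.2) ^ 2) := by
    have a1 : Measurable fun w : (α × β) × β => f w.1.1 w.1.2 := hf.comp measurable_fst
    have a2 : Measurable fun w : (α × β) × β => f w.1.1 w.2 :=
      hf.comp ((measurable_fst.comp measurable_fst).prodMk measurable_snd)
    fun_prop
  exact (h1.lintegral_prod_right' (ν := μ)).lintegral_prod_right' (ν := μ)

theorem pairVar_comp {μ : Measure α} {ν : Measure β} [SFinite ν] {g : α → β}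
    (hg : MeasurePreserving g μ ν) {f : β → ℝ} (hf : Measurable f) :
    pairVar μ (fun x => f (g x)) = pairVar ν f := by
  unfold pairVar
  have h1 : Measurable fun z : β × β => ENNReal.ofReal ((f z.1 - f z.2) ^ 2) := by fun_prop
  rw [← hg.lintegral_comp h1.lintegral_prod_right']
  congr 1
  refine lintegral_congr fun x => ?_
  exact hg.lintegral_comp (f := fun y => ENNReal.ofReal ((f (g x) - f y) ^ 2)) (by fun_prop)

/-- Two different functions are allowed because the law of total variance compares two different
slices of one function. -/
theorem lintegral_lintegral_ofReal_sq_sub {μ : Measure β} [IsProbabilityMeasure μ] {u v : β → ℝ}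
    (hu : MemLp u 2 μ) (hv : MemLp v 2 μ) :
    ∫⁻ y, ∫⁻ y', ENNReal.ofReal ((u y - v y') ^ 2) ∂μ ∂μ =
      ENNReal.ofReal (∫ y, u y ^ 2 ∂μ + ∫ y, v y ^ 2 ∂μ - 2 * ((∫ y, u y ∂μ) * ∫ y, v y ∂μ)) := by
  have iu := hu.integrable (by norm_num)
  have iv := hv.integrable (by norm_num)
  have iu2 := hu.integrable_sq
  have iv2 := hv.integrable_sq
  have e1 : ∀ y, ∫⁻ y', ENNReal.ofReal ((u y - v y') ^ 2) ∂μ =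
      ENNReal.ofReal (u y ^ 2 + ∫ y, v y ^ 2 ∂μ - 2 * (u y * ∫ y, v y ∂μ)) := by
    intro y
    have e : (fun y' => (u y - v y') ^ 2) = fun y' => u y ^ 2 + v y' ^ 2 - 2 * u y * v y' := by
      ext; ring
    have i1 : Integrable (fun y' => u y ^ 2 + v y' ^ 2) μ := (integrable_const _).add iv2
    have i2 : Integrable (fun y' => 2 * u y * v y') μ := iv.const_mul _
    rw [← ofReal_integral_eq_lintegral_ofReal (by rw [e]; exact i1.sub i2)
      (ae_of_all _ fun _ => sq_nonneg _), e, integral_sub i1 i2,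
      integral_add (integrable_const _) iv2, integral_const_mul]
    simp [mul_assoc]
  simp_rw [e1]
  have i1 : Integrable (fun y => u y ^ 2 + ∫ y, v y ^ 2 ∂μ) μ := iu2.add (integrable_const _)
  have i2 : Integrable (fun y => 2 * (u y * ∫ y, v y ∂μ)) μ := (iu.mul_const _).const_mul _
  have i3 : Integrable (fun y => u y ^ 2 + ∫ y, v y ^ 2 ∂μ - 2 * (u y * ∫ y, v y ∂μ)) μ := i1.sub i2
  rw [← ofReal_integral_eq_lintegral_ofReal i3, integral_sub i1 i2,
    integral_add iu2 (integrable_const _), integral_const_mul, integral_mul_const]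
  · simp
  · refine ae_of_all _ fun y => ?_
    have h : 0 ≤ ∫ y', (u y - v y') ^ 2 ∂μ := integral_nonneg fun _ => sq_nonneg _
    have e : (fun y' => (u y - v y') ^ 2) = fun y' => u y ^ 2 + v y' ^ 2 - 2 * u y * v y' := by
      ext; ring
    have i1 : Integrable (fun y' => u y ^ 2 + v y' ^ 2) μ := (integrable_const _).add iv2
    have i2 : Integrable (fun y' => 2 * u y * v y') μ := iv.const_mul _
    rw [e, integral_sub i1 i2, integral_add (integrable_const _) iv2, integral_const_mul] at h
    simpa [mul_assoc] using h

theorem pairVar_eq_ofReal {μ : Measure β} [IsProbabilityMeasure μ] {u : β → ℝ}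
    (hu : MemLp u 2 μ) :
    pairVar μ u = ENNReal.ofReal (∫ y, u y ^ 2 ∂μ - (∫ y, u y ∂μ) ^ 2) := by
  unfold pairVar
  rw [lintegral_lintegral_ofReal_sq_sub hu hu, show (2⁻¹ : ENNReal) = ENNReal.ofReal (2⁻¹) by
    rw [ENNReal.ofReal_inv_of_pos two_pos]; simp, ← ENNReal.ofReal_mul (by norm_num)]
  congr 1; ring

theorem sq_integral_le {μ : Measure β} [IsProbabilityMeasure μ] {u : β → ℝ}
    (hu : MemLp u 2 μ) : (∫ y, u y ∂μ) ^ 2 ≤ ∫ y, u y ^ 2 ∂μ := by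
  have iu := hu.integrable (by norm_num)
  have iu2 := hu.integrable_sq
  set m := ∫ y, u y ∂μ with hm
  have h : 0 ≤ ∫ y, (u y - m) ^ 2 ∂μ := integral_nonneg fun _ => sq_nonneg _
  have e : (fun y => (u y - m) ^ 2) = fun y => u y ^ 2 - 2 * m * u y + m ^ 2 := by ext; ring
  have i1 : Integrable (fun y => u y ^ 2 - 2 * m * u y) μ := iu2.sub (iu.const_mul _)
  rw [e, integral_add i1 (integrable_const _),
    integral_sub iu2 (iu.const_mul _), integral_const_mul, ← hm] at h
  simp at h
  linarith

theorem lintegral_sq_eq_pairVar_add {μ : Measure β} [IsProbabilityMeasure μ] {u : β → ℝ}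
    (hu : MemLp u 2 μ) :
    ∫⁻ y, ENNReal.ofReal (u y ^ 2) ∂μ = pairVar μ u + ENNReal.ofReal ((∫ y, u y ∂μ) ^ 2) := by
  rw [pairVar_eq_ofReal hu, ← ENNReal.ofReal_add (sub_nonneg.2 (sq_integral_le hu)) (sq_nonneg _),
    ← ofReal_integral_eq_lintegral_ofReal hu.integrable_sq (ae_of_all _ fun _ => sq_nonneg _)]
  congr 1; ring

/-- The law of total variance. -/
theorem pairVar_prod {a : Measure α} {b : Measure β} [IsProbabilityMeasure a]
    [IsProbabilityMeasure b] {f : α × β → ℝ} (hf : Measurable f)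
    (hL : ∀ᵐ t ∂a, MemLp (fun y => f (t, y)) 2 b) :
    pairVar (a.prod b) f =
      ∫⁻ t, pairVar b (fun y => f (t, y)) ∂a + pairVar a (fun t => ∫ y, f (t, y) ∂b) := by
  set U : α → ℝ := fun t => ∫ y, f (t, y) ^ 2 ∂b with hU
  set m : α → ℝ := fun t => ∫ y, f (t, y) ∂b with hm
  have hmm : Measurable m := (hf.stronglyMeasurable.integral_prod_right').measurable
  have hpm : Measurable fun t => pairVar b (fun y => f (t, y)) :=
    measurable_lintegral_lintegral_sq (f := fun t y => f (t, y)) hf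
  -- The mean squared difference between independent points of two slices is the sum of the slice
  -- variances and the squared difference of the slice means.
  have key : ∀ᵐ t ∂a, ∀ᵐ t' ∂a, ∫⁻ y, ∫⁻ y', ENNReal.ofReal ((f (t, y) - f (t', y')) ^ 2) ∂b ∂b =
      pairVar b (fun y => f (t, y)) + pairVar b (fun y => f (t', y)) +
        ENNReal.ofReal ((m t - m t') ^ 2) := by
    filter_upwards [hL] with t ht
    filter_upwards [hL] with t' ht'
    have h1 := sq_integral_le ht
    have h2 := sq_integral_le ht'
    rw [lintegral_lintegral_ofReal_sq_sub ht ht', pairVar_eq_ofReal ht, pairVar_eq_ofReal ht',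
      ← ENNReal.ofReal_add (by linarith) (by linarith), ← ENNReal.ofReal_add (by linarith)
      (sq_nonneg _)]
    congr 1
    simp only [hm]; ring
  have hG : Measurable fun w : (α × β) × (α × β) => ENNReal.ofReal ((f w.1 - f w.2) ^ 2) := by
    fun_prop
  have e1 : ∫⁻ z, ∫⁻ z', ENNReal.ofReal ((f z - f z') ^ 2) ∂a.prod b ∂a.prod b =
      ∫⁻ t, ∫⁻ t', ∫⁻ y, ∫⁻ y', ENNReal.ofReal ((f (t, y) - f (t', y')) ^ 2) ∂b ∂b ∂a ∂a := by
    rw [lintegral_prod _ hG.lintegral_prod_right'.aemeasurable]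
    refine lintegral_congr fun t => ?_
    have e2 : ∀ y, ∫⁻ z', ENNReal.ofReal ((f (t, y) - f z') ^ 2) ∂a.prod b =
        ∫⁻ t', ∫⁻ y', ENNReal.ofReal ((f (t, y) - f (t', y')) ^ 2) ∂b ∂a := fun y =>
      lintegral_prod _ (by fun_prop)
    simp_rw [e2]
    rw [lintegral_lintegral_swap]
    have : Measurable fun w : (β × α) × β =>
        ENNReal.ofReal ((f (t, w.1.1) - f (w.1.2, w.2)) ^ 2) := by fun_prop
    exact (this.lintegral_prod_right' (ν := b)).aemeasurable
  have e3 : ∫⁻ t, ∫⁻ t', (pairVar b (fun y => f (t, y)) + pairVar b (fun y => f (t', y)) +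
        ENNReal.ofReal ((m t - m t') ^ 2)) ∂a ∂a =
      2 * ∫⁻ t, pairVar b (fun y => f (t, y)) ∂a +
        ∫⁻ t, ∫⁻ t', ENNReal.ofReal ((m t - m t') ^ 2) ∂a ∂a := by
    have e4 : ∀ t, ∫⁻ t', (pairVar b (fun y => f (t, y)) + pairVar b (fun y => f (t', y)) +
        ENNReal.ofReal ((m t - m t') ^ 2)) ∂a = pairVar b (fun y => f (t, y)) +
        ∫⁻ t', pairVar b (fun y => f (t', y)) ∂a + ∫⁻ t', ENNReal.ofReal ((m t - m t') ^ 2) ∂a := by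
      intro t
      rw [lintegral_add_left (by fun_prop), lintegral_add_left (by fun_prop)]
      simp
    simp_rw [e4]
    rw [lintegral_add_left (by fun_prop), lintegral_add_left (by fun_prop)]
    simp [two_mul]
  have e5 : pairVar (a.prod b) f = 2⁻¹ * (2 * ∫⁻ t, pairVar b (fun y => f (t, y)) ∂a +
        ∫⁻ t, ∫⁻ t', ENNReal.ofReal ((m t - m t') ^ 2) ∂a ∂a) := by
    rw [← e3]
    unfold pairVar at key ⊢
    rw [e1]
    congr 1
    exact lintegral_congr_ae (key.mono fun t ht => lintegral_congr_ae ht)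
  rw [e5, mul_add, ← mul_assoc, ENNReal.inv_mul_cancel two_ne_zero (by simp), one_mul]
  rfl

theorem ofReal_sq_integral_le {b : Measure β} [IsProbabilityMeasure b] {u : β → ℝ}
    (hu : MemLp u 2 b) : ENNReal.ofReal ((∫ y, u y ∂b) ^ 2) ≤ ∫⁻ y, ENNReal.ofReal (u y ^ 2) ∂b := by
  rw [← ofReal_integral_eq_lintegral_ofReal hu.integrable_sq (ae_of_all _ fun _ => sq_nonneg _)]
  exact ENNReal.ofReal_le_ofReal (sq_integral_le hu)

/-- Convexity of the variance: Jensen's inequality applied to each difference f(s, ·) - f(t, ·). -/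
theorem pairVar_integral_le {a : Measure α} {b : Measure β} [IsProbabilityMeasure a]
    [IsProbabilityMeasure b] {f : α × β → ℝ} (hf : Measurable f)
    (hL : ∀ᵐ t ∂a, MemLp (fun y => f (t, y)) 2 b) :
    pairVar a (fun t => ∫ y, f (t, y) ∂b) ≤ ∫⁻ y, pairVar a (fun t => f (t, y)) ∂b := by
  have hG : Measurable fun w : β × (α × α) =>
      ENNReal.ofReal ((f (w.2.1, w.1) - f (w.2.2, w.1)) ^ 2) := by fun_prop
  have e : ∫⁻ y, pairVar a (fun t => f (t, y)) ∂b =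
      2⁻¹ * ∫⁻ s, ∫⁻ t, ∫⁻ y, ENNReal.ofReal ((f (s, y) - f (t, y)) ^ 2) ∂b ∂a ∂a := by
    unfold pairVar
    rw [lintegral_const_mul]
    · congr 1
      rw [lintegral_lintegral_swap]
      · refine lintegral_congr fun s => ?_
        rw [lintegral_lintegral_swap]
        have : Measurable fun w : β × α => ENNReal.ofReal ((f (s, w.1) - f (w.2, w.1)) ^ 2) := by
          fun_prop
        exact this.aemeasurable
      · have : Measurable fun w : (β × α) × α =>
            ENNReal.ofReal ((f (w.1.2, w.1.1) - f (w.2, w.1.1)) ^ 2) := by fun_prop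
        exact (this.lintegral_prod_right' (ν := a)).aemeasurable
    · have : Measurable fun w : (β × α) × α =>
            ENNReal.ofReal ((f (w.1.2, w.1.1) - f (w.2, w.1.1)) ^ 2) := by fun_prop
      exact (this.lintegral_prod_right' (ν := a)).lintegral_prod_right' (ν := a)
  rw [e]
  unfold pairVar
  refine mul_le_mul_right (lintegral_mono_ae ?_) _
  filter_upwards [hL] with s hs
  refine lintegral_mono_ae ?_
  filter_upwards [hL] with t ht
  rw [← integral_sub (hs.integrable (by norm_num)) (ht.integrable (by norm_num))]
  exact ofReal_sq_integral_le (hs.sub ht)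

/-- Truncation of a real number to the interval `[-k, k]`. -/
def truncate (k x : ℝ) : ℝ := max (-k) (min k x)

theorem measurable_truncate (k : ℝ) : Measurable (truncate k) := by
  unfold truncate; fun_prop

theorem abs_truncate_le {k : ℝ} (hk : 0 ≤ k) (x : ℝ) : |truncate k x| ≤ k := by
  unfold truncate
  rw [abs_le]
  exact ⟨le_max_left _ _, max_le (by linarith) (min_le_left _ _)⟩

theorem truncate_of_abs_le {k x : ℝ} (h : |x| ≤ k) : truncate k x = x := by
  unfold truncate
  rw [abs_le] at h
  rw [min_eq_right h.2, max_eq_right h.1]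

theorem sq_truncate_sub_le (k x y : ℝ) : (truncate k x - truncate k y) ^ 2 ≤ (x - y) ^ 2 := by
  refine sq_le_sq.2 ?_
  unfold truncate
  refine (abs_max_sub_max_le_max _ _ _ _).trans ?_
  simp only [sub_self, abs_zero]
  refine max_le (abs_nonneg _) ((abs_min_sub_min_le_max _ _ _ _).trans ?_)
  simp

/-- Fatou's lemma: at each pair of points the truncated differences are eventually the true ones.
This removes boundedness assumptions. -/
theorem pairVar_le_of_truncate {μ : Measure α} [SFinite μ] {f : α → ℝ} (hf : Measurable f)
    {B : ENNReal} (h : ∀ k : ℕ, pairVar μ (fun x => truncate k (f x)) ≤ B) : pairVar μ f ≤ B := by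
  set G : ℕ → α × α → ENNReal := fun k z =>
    ENNReal.ofReal ((truncate k (f z.1) - truncate k (f z.2)) ^ 2) with hG
  have hGm : ∀ k, Measurable (G k) := fun k => by
    have := measurable_truncate k
    simp only [hG]; fun_prop
  have h1 : ∀ k : ℕ, pairVar μ (fun x => truncate k (f x)) = 2⁻¹ * ∫⁻ z, G k z ∂μ.prod μ := by
    intro k
    rw [lintegral_prod _ (hGm k).aemeasurable]
    rfl
  have h2 : pairVar μ f = 2⁻¹ * ∫⁻ z, liminf (fun k => G k z) atTop ∂μ.prod μ := by
    unfold pairVar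
    congr 1
    rw [lintegral_prod _ (Measurable.liminf hGm).aemeasurable]
    refine lintegral_congr fun x => lintegral_congr fun y => ?_
    refine (Tendsto.liminf_eq (tendsto_const_nhds.congr' ?_)).symm
    obtain ⟨N, hN⟩ := exists_nat_ge (max |f x| |f y|)
    filter_upwards [eventually_ge_atTop N] with k hk
    have hk' : (N : ℝ) ≤ k := by exact_mod_cast hk
    simp only [hG]
    rw [truncate_of_abs_le ((le_max_left _ _).trans (hN.trans hk')),
      truncate_of_abs_le ((le_max_right _ _).trans (hN.trans hk'))]
  rw [h2]
  calc 2⁻¹ * ∫⁻ z, liminf (fun k => G k z) atTop ∂μ.prod μ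
      ≤ 2⁻¹ * liminf (fun k => ∫⁻ z, G k z ∂μ.prod μ) atTop :=
        mul_le_mul_right (lintegral_liminf_le hGm) _
    _ ≤ 2⁻¹ * (2 * B) := by
        refine mul_le_mul_right (liminf_le_of_le (by isBoundedDefault) fun b hb => ?_) _
        obtain ⟨k, hk⟩ := hb.exists
        have := h k
        rw [h1] at this
        calc b ≤ ∫⁻ z, G k z ∂μ.prod μ := hk
          _ = 2 * (2⁻¹ * ∫⁻ z, G k z ∂μ.prod μ) := by
            rw [← mul_assoc, ENNReal.mul_inv_cancel two_ne_zero (by simp), one_mul]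
          _ ≤ 2 * B := mul_le_mul_right this _
    _ = B := by rw [← mul_assoc, ENNReal.inv_mul_cancel two_ne_zero (by simp), one_mul]

theorem pairVar_mono {μ : Measure α} {f g : α → ℝ}
    (h : ∀ x y, (f x - f y) ^ 2 ≤ (g x - g y) ^ 2) : pairVar μ f ≤ pairVar μ g :=
  mul_le_mul_right (lintegral_mono fun _ => lintegral_mono fun _ =>
    ENNReal.ofReal_le_ofReal (h _ _)) _

end PairVar

/-! ### The Efron–Stein inequality -/

section EfronStein

variable {ν : Measure ℝ} [IsProbabilityMeasure ν]

theorem measurable_fin_cons (n : ℕ) :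
    Measurable fun z : ℝ × (Fin n → ℝ) => (Fin.cons z.1 z.2 : Fin (n + 1) → ℝ) := by
  refine measurable_pi_iff.2 fun i => ?_
  refine Fin.cases ?_ (fun j => ?_) i
  · simpa using measurable_fst
  · simp only [Fin.cons_succ]; fun_prop

theorem measurable_update_uncurry {n : ℕ} (i : Fin n) :
    Measurable fun z : (Fin n → ℝ) × ℝ => Function.update z.1 i z.2 := by
  refine measurable_pi_iff.2 fun j => ?_
  by_cases h : j = i
  · subst h; simpa using measurable_snd
  · simp only [Function.update_of_ne h]; fun_prop

/-- Induction on n: total variance splits off the coordinate 0, convexity bounds the variance of the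
averaged slice, and the induction hypothesis treats the others. Boundedness only makes the slices
square integrable. -/
theorem efronStein_of_bounded {n : ℕ} {f : (Fin n → ℝ) → ℝ} (hf : Measurable f) {M : ℝ}
    (hM : ∀ x, |f x| ≤ M) :
    pairVar (Measure.pi fun _ => ν) f ≤
      ∑ i, ∫⁻ x, pairVar ν (fun t => f (Function.update x i t)) ∂Measure.pi fun _ => ν := by
  induction n with
  | zero =>
    have : pairVar (Measure.pi fun _ : Fin 0 => ν) f = 0 := by
      have e : ∀ x y : Fin 0 → ℝ, ENNReal.ofReal ((f x - f y) ^ 2) = 0 := fun x y => by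
        rw [Subsingleton.elim x y]; simp
      simp [pairVar, e]
    rw [this]; exact zero_le
  | succ n ih =>
    have hmp := (measurePreserving_piFinSuccAbove (fun _ : Fin (n + 1) => ν) 0).symm
    have hcons := measurable_fin_cons n
    have hmp' : MeasurePreserving
        (fun z : ℝ × (Fin n → ℝ) => (Fin.cons z.1 z.2 : Fin (n + 1) → ℝ))
        (ν.prod (Measure.pi fun _ => ν)) (Measure.pi fun _ => ν) := by
      convert hmp using 1
      ext z i
      simp [MeasurableEquiv.piFinSuccAbove, Fin.insertNthEquiv]
    set π := Measure.pi fun _ : Fin n => ν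
    have hf' : Measurable fun z : ℝ × (Fin n → ℝ) => f (Fin.cons z.1 z.2) := hf.comp hcons
    have hL : ∀ t, MemLp (fun y : Fin n → ℝ => f (Fin.cons t y)) 2 π := fun t =>
      MemLp.of_bound (hf'.comp measurable_prodMk_left).aestronglyMeasurable M
        (ae_of_all _ fun y => hM _)
    have hup : ∀ i : Fin (n + 1), Measurable fun x =>
        pairVar ν (fun t => f (Function.update x i t)) := fun i => by
      refine measurable_lintegral_lintegral_sq (f := fun x t => f (Function.update x i t)) ?_
      exact hf.comp (measurable_update_uncurry i)
    rw [← pairVar_comp hmp' hf, pairVar_prod hf' (ae_of_all _ hL), Fin.sum_univ_succ, add_comm]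
    refine add_le_add ?_ ?_
    · refine (pairVar_integral_le hf' (ae_of_all _ hL)).trans_eq ?_
      have e := hmp'.lintegral_comp (hup 0)
      rw [lintegral_prod (fun z : ℝ × (Fin n → ℝ) => pairVar ν fun t =>
        f (Function.update (Fin.cons z.1 z.2 : Fin (n + 1) → ℝ) 0 t))
        ((hup 0).comp hcons).aemeasurable] at e
      rw [← e]
      simp [Fin.update_cons_zero]
    · calc _ ≤ ∫⁻ t, ∑ i, ∫⁻ y, pairVar ν
              (fun s => f (Fin.cons t (Function.update y i s))) ∂π ∂ν :=
            lintegral_mono fun t => ih (f := fun y => f (Fin.cons t y : Fin (n + 1) → ℝ))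
              (hf'.comp (measurable_prodMk_left (x := t))) (fun y => hM _)
        _ = _ := by
            have hc : ∀ (t s : ℝ) (y : Fin n → ℝ) (i : Fin n),
                (Fin.cons t (Function.update y i s) : Fin (n + 1) → ℝ) =
                Function.update (Fin.cons t y : Fin (n + 1) → ℝ) i.succ s :=
              fun t s y i => Fin.cons_update _ _ _ _
            have hm : ∀ i : Fin n, Measurable fun z : ℝ × (Fin n → ℝ) => pairVar ν fun s =>
                f (Function.update (Fin.cons z.1 z.2 : Fin (n + 1) → ℝ) i.succ s) := fun i =>
              (hup i.succ).comp hcons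
            simp only [hc]
            have hm2 : ∀ i : Fin n, Measurable fun t : ℝ => ∫⁻ y, pairVar ν fun s =>
                f (Function.update (Fin.cons t y : Fin (n + 1) → ℝ) i.succ s) ∂π := fun i =>
              Measurable.lintegral_prod_right' (f := fun z : ℝ × (Fin n → ℝ) => pairVar ν fun s =>
                f (Function.update (Fin.cons z.1 z.2 : Fin (n + 1) → ℝ) i.succ s)) (hm i)
            refine (lintegral_finsetSum _ fun i _ => hm2 i).trans ?_
            refine Finset.sum_congr rfl fun i _ => ?_
            have e := hmp'.lintegral_comp (hup i.succ)
            rw [lintegral_prod (fun z : ℝ × (Fin n → ℝ) => pairVar ν fun s =>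
              f (Function.update (Fin.cons z.1 z.2 : Fin (n + 1) → ℝ) i.succ s))
              (hm i).aemeasurable] at e
            exact e

/-- The Efron–Stein inequality. -/
theorem efronStein {n : ℕ} {f : (Fin n → ℝ) → ℝ} (hf : Measurable f) :
    pairVar (Measure.pi fun _ => ν) f ≤
      ∑ i, ∫⁻ x, pairVar ν (fun t => f (Function.update x i t)) ∂Measure.pi fun _ => ν := by
  refine pairVar_le_of_truncate hf fun k => ?_
  refine (efronStein_of_bounded ((measurable_truncate k).comp hf)
    (fun x => abs_truncate_le k.cast_nonneg _)).trans ?_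
  exact Finset.sum_le_sum fun i _ => lintegral_mono fun x =>
    pairVar_mono fun s t => sq_truncate_sub_le _ _ _

end EfronStein

/-! ### Sign changes and Walsh components -/

section Walsh

variable {n : ℕ}

/-- Componentwise sign change. -/
def signMul (ε : Fin n → ℤˣ) (x : Fin n → ℝ) : Fin n → ℝ := fun i => ((ε i : ℤ) : ℝ) * x i

/-- The Walsh character of the set `S` of coordinates. -/
def walshChar (S : Finset (Fin n)) (ε : Fin n → ℤˣ) : ℝ := ∏ i ∈ S, ((ε i : ℤ) : ℝ)

/-- The Walsh coefficient of a function of the signs. -/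
noncomputable def walshCoeff (S : Finset (Fin n)) (v : (Fin n → ℤˣ) → ℝ) : ℝ :=
  (1 / 2 ^ n) * ∑ ε, walshChar S ε * v ε

theorem unit_mul_self_cast (u : ℤˣ) : ((u : ℤ) : ℝ) * ((u : ℤ) : ℝ) = 1 := by
  rcases Int.units_eq_one_or u with h | h <;> simp [h]

theorem abs_unit_cast (u : ℤˣ) : |((u : ℤ) : ℝ)| = 1 := by
  rcases Int.units_eq_one_or u with h | h <;> simp [h]

theorem walshChar_mul (S : Finset (Fin n)) (ε δ : Fin n → ℤˣ) :
    walshChar S (ε * δ) = walshChar S ε * walshChar S δ := by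
  simp [walshChar, Finset.prod_mul_distrib]

theorem signMul_signMul (ε δ : Fin n → ℤˣ) (x : Fin n → ℝ) :
    signMul ε (signMul δ x) = signMul (ε * δ) x := by
  ext i; simp [signMul, mul_assoc]

theorem measurable_signMul (ε : Fin n → ℤˣ) : Measurable (signMul ε) := by
  unfold signMul; fun_prop

theorem signMul_update (ε : Fin n → ℤˣ) (x : Fin n → ℝ) (i : Fin n) (t : ℝ) :
    signMul ε (Function.update x i t) =
      Function.update (signMul ε x) i (((ε i : ℤ) : ℝ) * t) := by
  ext j
  by_cases h : j = i
  · subst h; simp [signMul]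
  · simp [signMul, h]

/-- Expanding the product of 1 + ε_i δ_i over subsets gives the sum; a factor vanishes as soon as
the signs differ somewhere. -/
theorem sum_walshChar_mul (ε δ : Fin n → ℤˣ) :
    ∑ S : Finset (Fin n), walshChar S ε * walshChar S δ = if ε = δ then 2 ^ n else 0 := by
  have h := Finset.prod_one_add (f := fun i => ((ε i : ℤ) : ℝ) * ((δ i : ℤ) : ℝ)) Finset.univ
  simp only [Finset.powerset_univ, Finset.prod_mul_distrib] at h
  simp only [walshChar]
  rw [← h]
  split_ifs with he
  · subst he
    simp [unit_mul_self_cast]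
    norm_num
  · obtain ⟨i, hi⟩ := Function.ne_iff.1 he
    refine Finset.prod_eq_zero (Finset.mem_univ i) ?_
    rcases Int.units_eq_one_or (ε i) with h1 | h1 <;> rcases Int.units_eq_one_or (δ i) with h2 | h2
      <;> simp_all

/-- Parseval's identity for Walsh coefficients. -/
theorem sum_walshCoeff_sq (v : (Fin n → ℤˣ) → ℝ) :
    ∑ S : Finset (Fin n), walshCoeff S v ^ 2 = (1 / 2 ^ n) * ∑ ε, v ε ^ 2 := by
  have h : ∀ S : Finset (Fin n), walshCoeff S v ^ 2 = (1 / 2 ^ n) ^ 2 *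
      ∑ ε, ∑ δ, walshChar S ε * walshChar S δ * (v ε * v δ) := by
    intro S
    rw [walshCoeff, mul_pow, sq (∑ ε, _), Finset.sum_mul_sum]
    congr 1
    exact Finset.sum_congr rfl fun ε _ => Finset.sum_congr rfl fun δ _ => by ring
  simp_rw [h]
  rw [← Finset.mul_sum, Finset.sum_comm]
  have h2 : ∀ ε : Fin n → ℤˣ, ∑ S : Finset (Fin n),
      ∑ δ, walshChar S ε * walshChar S δ * (v ε * v δ) = 2 ^ n * v ε ^ 2 := by
    intro ε
    rw [Finset.sum_comm]
    simp_rw [← Finset.sum_mul, sum_walshChar_mul]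
    simp
    ring
  simp_rw [h2]
  rw [← Finset.mul_sum, ← mul_assoc]
  congr 1
  field_simp

/-- The component of `f` that is odd in the coordinates in `S` and even in the others. -/
noncomputable def walshPart (S : Finset (Fin n)) (f : (Fin n → ℝ) → ℝ) (x : Fin n → ℝ) : ℝ :=
  walshCoeff S fun ε => f (signMul ε x)

theorem walshPart_signMul (S : Finset (Fin n)) (f : (Fin n → ℝ) → ℝ) (δ : Fin n → ℤˣ)
    (x : Fin n → ℝ) : walshPart S f (signMul δ x) = walshChar S δ * walshPart S f x := by
  unfold walshPart walshCoeff
  rw [mul_left_comm]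
  congr 1
  rw [Finset.mul_sum, ← Equiv.sum_comp (Equiv.mulRight δ)]
  simp_rw [signMul_signMul]
  refine Finset.sum_congr rfl fun ε _ => ?_
  have hδ : δ * δ = 1 := by ext i; simp
  simp only [Equiv.coe_mulRight, walshChar_mul, mul_assoc, hδ, mul_one]
  ring

theorem measurable_walshPart (S : Finset (Fin n)) {f : (Fin n → ℝ) → ℝ} (hf : Measurable f) :
    Measurable (walshPart S f) := by
  unfold walshPart walshCoeff
  refine Measurable.const_mul (Finset.measurable_sum _ fun ε _ => Measurable.const_mul ?_ _) _
  exact hf.comp (measurable_signMul ε)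

/-- The partial derivative of `walshPart S f` in the coordinate `i`, when `g` is that of `f`. -/
noncomputable def walshDeriv (S : Finset (Fin n)) (i : Fin n) (g : (Fin n → ℝ) → ℝ)
    (x : Fin n → ℝ) : ℝ :=
  walshCoeff S fun ε => ((ε i : ℤ) : ℝ) * g (signMul ε x)

theorem measurable_walshDeriv (S : Finset (Fin n)) (i : Fin n) {g : (Fin n → ℝ) → ℝ}
    (hg : Measurable g) : Measurable (walshDeriv S i g) := by
  unfold walshDeriv walshCoeff
  refine Measurable.const_mul (Finset.measurable_sum _ fun ε _ => Measurable.const_mul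
    (Measurable.const_mul ?_ _) _) _
  exact hg.comp (measurable_signMul ε)

theorem sum_walshDeriv_sq (i : Fin n) (g : (Fin n → ℝ) → ℝ) (x : Fin n → ℝ) :
    ∑ S : Finset (Fin n), walshDeriv S i g x ^ 2 = (1 / 2 ^ n) * ∑ ε, g (signMul ε x) ^ 2 := by
  unfold walshDeriv
  rw [sum_walshCoeff_sq]
  congr 1
  refine Finset.sum_congr rfl fun ε _ => ?_
  rw [mul_pow, sq, unit_mul_self_cast, one_mul]

theorem sum_walshPart_sq (f : (Fin n → ℝ) → ℝ) (x : Fin n → ℝ) :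
    ∑ S : Finset (Fin n), walshPart S f x ^ 2 = (1 / 2 ^ n) * ∑ ε, f (signMul ε x) ^ 2 :=
  sum_walshCoeff_sq _

/-- Flipping every sign multiplies the component by (-1)^|S|, yet evenness of f leaves it unchanged.
This is how evenness enters the product inequality: parts odd in a single coordinate disappear. -/
theorem walshPart_eq_zero_of_odd_card {S : Finset (Fin n)} (hS : Odd S.card)
    {f : (Fin n → ℝ) → ℝ} (hf : ∀ x, f (-x) = f x) (x : Fin n → ℝ) : walshPart S f x = 0 := by
  have h1 := walshPart_signMul S f (fun _ => -1) x
  have h2 : walshPart S f (signMul (fun _ => -1) x) = walshPart S f x := by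
    unfold walshPart
    congr 1
    ext ε
    rw [← hf (signMul ε x)]
    congr 1
    ext i
    simp [signMul]
  have h3 : walshChar S (fun _ : Fin n => (-1 : ℤˣ)) = -1 := by
    simp [walshChar, hS.neg_one_pow]
  rw [h2, h3] at h1
  linarith

theorem walshPart_update_neg (S : Finset (Fin n)) (f : (Fin n → ℝ) → ℝ) (x : Fin n → ℝ) (i : Fin n)
    (t : ℝ) : walshPart S f (Function.update x i (-t)) =
      (if i ∈ S then -1 else 1) * walshPart S f (Function.update x i t) := by
  have h := walshPart_signMul S f (Function.update 1 i (-1)) (Function.update x i t)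
  have h2 : signMul (Function.update 1 i (-1)) (Function.update x i t) =
      Function.update x i (-t) := by
    ext j
    by_cases h : j = i
    · subst h; simp [signMul]
    · simp [signMul, h]
  rw [h2] at h
  rw [h]
  congr 1
  unfold walshChar
  split_ifs with hi
  · rw [Finset.prod_eq_single_of_mem i hi]
    · simp
    · intro j _ hj; simp [hj]
  · refine Finset.prod_eq_one fun j hj => ?_
    have : j ≠ i := fun h => hi (h ▸ hj)
    simp [this]

end Walsh

/-! ### Functions with an integrable derivative -/

/-- `φ` is a primitive of the locally integrable function `ψ`. -/
def IsPrimitive (φ ψ : ℝ → ℝ) : Prop :=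
  ∀ s t, IntervalIntegrable ψ volume s t ∧ φ t - φ s = ∫ u in s..t, ψ u

namespace IsPrimitive

variable {φ ψ : ℝ → ℝ}

theorem ofReal_abs_sub_le (h : IsPrimitive φ ψ) {s t : ℝ} (hst : s ≤ t) :
    ENNReal.ofReal |φ t - φ s| ≤ ∫⁻ u in Ioc s t, ENNReal.ofReal |ψ u| := by
  have h1 := ((intervalIntegrable_iff_integrableOn_Ioc_of_le hst).1 (h s t).1)
  rw [(h s t).2, intervalIntegral.integral_of_le hst, ← ofReal_integral_eq_lintegral_ofReal h1.abs
    (ae_of_all _ fun _ => abs_nonneg _)]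
  exact ENNReal.ofReal_le_ofReal abs_integral_le_integral_abs

theorem const_mul (h : IsPrimitive φ ψ) (c : ℝ) :
    IsPrimitive (fun t => c * φ t) (fun t => c * ψ t) := fun s t =>
  ⟨(h s t).1.const_mul c, by
    rw [intervalIntegral.integral_const_mul, ← (h s t).2]; ring⟩

theorem sum {ι : Type*} {I : Finset ι} {φ ψ : ι → ℝ → ℝ} (h : ∀ i ∈ I, IsPrimitive (φ i) (ψ i)) :
    IsPrimitive (fun t => ∑ i ∈ I, φ i t) (fun t => ∑ i ∈ I, ψ i t) := fun s t => by
  constructor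
  · have := IntervalIntegrable.sum I fun i hi => (h i hi s t).1
    have e : (fun t => ∑ i ∈ I, ψ i t) = ∑ i ∈ I, ψ i := by
      funext t; simp
    rwa [e]
  · rw [intervalIntegral.integral_finsetSum fun i hi => (h i hi s t).1, ← Finset.sum_sub_distrib]
    exact Finset.sum_congr rfl fun i hi => (h i hi s t).2

theorem comp_mul (h : IsPrimitive φ ψ) {c : ℝ} (hc : c ≠ 0) :
    IsPrimitive (fun t => φ (c * t)) (fun t => c * ψ (c * t)) := fun s t => by
  constructor
  · have := (h (c * s) (c * t)).1.comp_mul_left (c := c)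
    rw [mul_div_cancel_left₀ _ hc, mul_div_cancel_left₀ _ hc] at this
    exact this.const_mul c
  · rw [intervalIntegral.integral_const_mul, intervalIntegral.mul_integral_comp_mul_left]
    exact (h _ _).2

theorem comp_neg (h : IsPrimitive φ ψ) :
    IsPrimitive (fun t => φ (-t)) (fun t => -ψ (-t)) := by
  simpa using h.comp_mul (c := -1) (by norm_num)

end IsPrimitive

/-! ### The even measure on the line -/

/-- The measure on `ℝ` with density `k exp (-|t| ^ q / q)`, as a sum over the two half-lines. -/
noncomputable def evenMeasure (k q : ℝ) : Measure ℝ :=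
  radialMeasure k 1 q + (radialMeasure k 1 q).map Neg.neg

theorem lintegral_evenMeasure (k q : ℝ) {F : ℝ → ENNReal} (hF : Measurable F) :
    ∫⁻ t, F t ∂evenMeasure k q =
      ∫⁻ t, F t ∂radialMeasure k 1 q + ∫⁻ t, F (-t) ∂radialMeasure k 1 q := by
  rw [evenMeasure, lintegral_add_measure, lintegral_map hF measurable_neg]

theorem lintegral_evenMeasure_of_even {k q : ℝ} {F : ℝ → ENNReal} (hF : Measurable F)
    (he : ∀ t, F (-t) = F t) : ∫⁻ t, F t ∂evenMeasure k q = ∫⁻ t, F t ∂radialMeasure (2 * k) 1 q := by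
  rw [lintegral_evenMeasure k q hF]
  simp_rw [he]
  rw [lintegral_radialMeasure _ _ _ _ hF, lintegral_radialMeasure _ _ _ _ hF, ← two_mul,
    ← lintegral_const_mul _ (by fun_prop)]
  refine lintegral_congr fun t => ?_
  rw [mul_assoc 2 k, ENNReal.ofReal_mul two_pos.le, mul_assoc]
  simp

theorem measurePreserving_neg_evenMeasure (k q : ℝ) :
    MeasurePreserving Neg.neg (evenMeasure k q) (evenMeasure k q) := by
  refine ⟨measurable_neg, ?_⟩
  rw [evenMeasure, Measure.map_add _ _ measurable_neg, Measure.map_map measurable_neg measurable_neg,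
    add_comm]
  congr 1
  simp

theorem isProbabilityMeasure_radialMeasure_two_mul {k q : ℝ}
    [IsProbabilityMeasure (evenMeasure k q)] : IsProbabilityMeasure (radialMeasure (2 * k) 1 q) := by
  constructor
  have := lintegral_evenMeasure_of_even (k := k) (q := q) (F := fun _ => 1) measurable_const fun _ => rfl
  simpa using this.symm

/-- An even function depends on |t| only, so its variance is that under the half-line measure with
doubled constant, where the radial Poincaré inequality with d = 1 applies. -/
theorem pairVar_evenMeasure_le {k q : ℝ} (hk : 0 ≤ k) (hq : 0 < q)
    [IsProbabilityMeasure (evenMeasure k q)] {φ ψ : ℝ → ℝ} (hφm : Measurable φ) (hψm : Measurable ψ)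
    (h : IsPrimitive φ ψ) (hφ : ∀ t, φ (-t) = φ t) (hψ : ∀ t, ψ (-t) ^ 2 = ψ t ^ 2) :
    pairVar (evenMeasure k q) φ ≤
      ENNReal.ofReal (1 / q) * ∫⁻ u, ENNReal.ofReal (|u| ^ (2 - q) * ψ u ^ 2) ∂evenMeasure k q := by
  have := isProbabilityMeasure_radialMeasure_two_mul (k := k) (q := q)
  have h1 := pairVar_radialMeasure_le (by positivity) one_pos hq hψm
    (fun s t _ hst => h.ofReal_abs_sub_le hst) (k := 2 * k)
  have h2 : pairVar (evenMeasure k q) φ = pairVar (radialMeasure (2 * k) 1 q) φ := by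
    unfold pairVar
    have hm : Measurable fun z : ℝ × ℝ => ENNReal.ofReal ((φ z.1 - φ z.2) ^ 2) := by fun_prop
    rw [← lintegral_evenMeasure_of_even hm.lintegral_prod_right' (fun t => by simp only [hφ])]
    congr 1
    refine lintegral_congr fun s => ?_
    exact lintegral_evenMeasure_of_even (by fun_prop) (fun t => by simp only [hφ])
  rw [h2, lintegral_evenMeasure_of_even (by fun_prop) (fun t => by rw [abs_neg, hψ])]
  refine h1.trans_eq ?_
  congr 1
  refine lintegral_congr_ae ((ae_pos_radialMeasure _ _ _).mono fun u hu => ?_)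
  simp only
  rw [abs_of_pos hu]

/-- Vanishing at 0 decouples the two half-lines, and Hardy's inequality is applied on each. -/
theorem lintegral_sq_evenMeasure_le {k q : ℝ} (hk : 0 ≤ k) (hq : 1 < q) {φ ψ : ℝ → ℝ}
    (hφm : Measurable φ) (hψm : Measurable ψ) (h : IsPrimitive φ ψ) (h0 : φ 0 = 0) :
    ∫⁻ t, ENNReal.ofReal (φ t ^ 2) ∂evenMeasure k q ≤ ENNReal.ofReal (1 / (q - 1)) *
      ∫⁻ u, ENNReal.ofReal (|u| ^ (2 - q) * ψ u ^ 2) ∂evenMeasure k q := by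
  rw [lintegral_evenMeasure _ _ (by fun_prop), lintegral_evenMeasure _ _ (by fun_prop), mul_add]
  have key : ∀ {φ ψ : ℝ → ℝ}, Measurable ψ → IsPrimitive φ ψ → φ 0 = 0 →
      ∫⁻ t, ENNReal.ofReal (φ t ^ 2) ∂radialMeasure k 1 q ≤ ENNReal.ofReal (1 / (q - 1)) *
      ∫⁻ u, ENNReal.ofReal (|u| ^ (2 - q) * ψ u ^ 2) ∂radialMeasure k 1 q := by
    intro φ ψ hψm h h0
    refine (lintegral_sq_radialMeasure_le_of_zero hk hq hψm (fun t ht => ?_)).trans_eq ?_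
    · simpa [h0] using h.ofReal_abs_sub_le ht.le
    · congr 1
      refine lintegral_congr_ae ((ae_pos_radialMeasure _ _ _).mono fun u hu => ?_)
      simp only
      rw [abs_of_pos hu]
  refine add_le_add (key hψm h h0) ((key (by fun_prop) h.comp_neg (by simpa using h0)).trans_eq ?_)
  simp

/-! ### Products of even measures -/

section Product

variable {n : ℕ} {ν : Measure ℝ} [IsProbabilityMeasure ν]

theorem measurePreserving_signMul (hν : MeasurePreserving Neg.neg ν ν) (ε : Fin n → ℤˣ) :
    MeasurePreserving (signMul ε) (Measure.pi fun _ => ν) (Measure.pi fun _ => ν) := by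
  refine measurePreserving_pi (fun _ => ν) (fun _ => ν) (f := fun i t => ((ε i : ℤ) : ℝ) * t)
    fun i => ?_
  rcases Int.units_eq_one_or (ε i) with h | h
  · simp only [h, Units.val_one, Int.cast_one, one_mul]
    exact MeasurePreserving.id ν
  · simpa [h] using hν

theorem lintegral_ofReal_sign_average (hν : MeasurePreserving Neg.neg ν ν) {F : (Fin n → ℝ) → ℝ}
    (hF : Measurable F) (h0 : ∀ x, 0 ≤ F x) :
    ∫⁻ x, ENNReal.ofReal (F x) ∂Measure.pi (fun _ => ν) =
      ∫⁻ x, ENNReal.ofReal ((1 / 2 ^ n) * ∑ ε, F (signMul ε x)) ∂Measure.pi (fun _ => ν) := by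
  have h1 : ∀ x, ENNReal.ofReal ((1 / 2 ^ n) * ∑ ε, F (signMul ε x)) =
      ENNReal.ofReal (1 / 2 ^ n) * ∑ ε, ENNReal.ofReal (F (signMul ε x)) := fun x => by
    rw [ENNReal.ofReal_mul (by positivity), ENNReal.ofReal_sum_of_nonneg fun _ _ => h0 _]
  have hm : ∀ ε, Measurable fun x => ENNReal.ofReal (F (signMul ε x)) := fun ε =>
    (hF.comp (measurable_signMul ε)).ennreal_ofReal
  simp_rw [h1]
  rw [lintegral_const_mul _ (Finset.measurable_sum _ fun ε _ => hm ε),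
    lintegral_finsetSum _ fun ε _ => hm ε]
  have h2 : ∀ ε : Fin n → ℤˣ, ∫⁻ x, ENNReal.ofReal (F (signMul ε x)) ∂Measure.pi (fun _ => ν) =
      ∫⁻ x, ENNReal.ofReal (F x) ∂Measure.pi (fun _ => ν) := fun ε =>
    (measurePreserving_signMul hν ε).lintegral_comp hF.ennreal_ofReal
  simp_rw [h2]
  rw [Finset.sum_const, nsmul_eq_mul, ← mul_assoc]
  have h3 : ENNReal.ofReal (1 / 2 ^ n) * ((Finset.univ : Finset (Fin n → ℤˣ)).card : ENNReal) = 1 := by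
    rw [← ENNReal.ofReal_natCast, ← ENNReal.ofReal_mul (by positivity)]
    simp
  rw [h3, one_mul]

theorem sum_univ_eq_empty_add (a : Finset (Fin n) → ℝ) :
    ∑ S, a S = a ∅ + ∑ S ∈ Finset.univ.erase ∅, a S :=
  (Finset.add_sum_erase _ _ (Finset.mem_univ _)).symm

/-- Changing signs independently in x and in y preserves the measure. Averaging (f x - f y)² over
these signs keeps only the fully even component in the cross term, and Parseval's identity turns the
rest into the second moments of the other components. -/
theorem pairVar_pi_le_walsh (hν : MeasurePreserving Neg.neg ν ν) {f : (Fin n → ℝ) → ℝ}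
    (hf : Measurable f) :
    pairVar (Measure.pi fun _ => ν) f ≤ pairVar (Measure.pi fun _ => ν) (walshPart ∅ f) +
      ∑ S ∈ Finset.univ.erase (∅ : Finset (Fin n)),
        ∫⁻ x, ENNReal.ofReal (walshPart S f x ^ 2) ∂Measure.pi fun _ => ν := by
  set π := Measure.pi fun _ : Fin n => ν with hπ
  set f₀ := walshPart ∅ f with hf0
  have hf0m : Measurable f₀ := measurable_walshPart _ hf
  set R : (Fin n → ℝ) → ℝ := fun x => ∑ S ∈ Finset.univ.erase (∅ : Finset (Fin n)),
    walshPart S f x ^ 2 with hR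
  have hRm : Measurable R := Finset.measurable_sum _ fun S _ => (measurable_walshPart S hf).pow_const 2
  have hR0 : ∀ x, 0 ≤ R x := fun x => Finset.sum_nonneg fun _ _ => sq_nonneg _
  -- One identity serves twice, first with a = f x for the signs of y and then with a = f₀ y for the
  -- signs of x.
  have avg : ∀ a x, (1 / 2 ^ n) * ∑ ε, (a - f (signMul ε x)) ^ 2 =
      a ^ 2 - 2 * a * f₀ x + (f₀ x ^ 2 + R x) := by
    intro a x
    have e1 : f₀ x ^ 2 + R x = (1 / 2 ^ n) * ∑ ε, f (signMul ε x) ^ 2 := by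
      rw [← sum_walshPart_sq, sum_univ_eq_empty_add]
    have e2 : f₀ x = (1 / 2 ^ n) * ∑ ε, f (signMul ε x) := by
      simp [hf0, walshPart, walshCoeff, walshChar]
    have e3 : (1 / 2 ^ n : ℝ) * ∑ _ε : Fin n → ℤˣ, a ^ 2 = a ^ 2 := by simp
    rw [e1, ← e3]
    conv_rhs => rw [e2]
    simp only [Finset.mul_sum]
    rw [← Finset.sum_sub_distrib, ← Finset.sum_add_distrib]
    exact Finset.sum_congr rfl fun ε _ => by ring
  have s1 : ∫⁻ x, ∫⁻ y, ENNReal.ofReal ((f x - f y) ^ 2) ∂π ∂π =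
      ∫⁻ x, ∫⁻ y, ENNReal.ofReal ((f₀ x - f₀ y) ^ 2 + R x + R y) ∂π ∂π := by
    have a1 : ∀ x, ∫⁻ y, ENNReal.ofReal ((f x - f y) ^ 2) ∂π =
        ∫⁻ y, ENNReal.ofReal (f x ^ 2 - 2 * f x * f₀ y + (f₀ y ^ 2 + R y)) ∂π := fun x => by
      rw [lintegral_ofReal_sign_average hν (by fun_prop) fun _ => sq_nonneg _]
      simp_rw [avg]
      rfl
    have a2 : ∀ y, ∫⁻ x, ENNReal.ofReal (f x ^ 2 - 2 * f x * f₀ y + (f₀ y ^ 2 + R y)) ∂π =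
        ∫⁻ x, ENNReal.ofReal ((f₀ x - f₀ y) ^ 2 + R x + R y) ∂π := fun y => by
      have e : ∀ x, f x ^ 2 - 2 * f x * f₀ y + (f₀ y ^ 2 + R y) = (f₀ y - f x) ^ 2 + R y :=
        fun x => by ring
      simp_rw [e]
      rw [lintegral_ofReal_sign_average hν (by fun_prop) fun x => add_nonneg (sq_nonneg _) (hR0 y)]
      refine lintegral_congr fun x => ?_
      rw [Finset.sum_add_distrib, mul_add, avg]
      congr 1
      simp
      ring
    simp_rw [a1]
    rw [lintegral_lintegral_swap (by fun_prop)]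
    simp_rw [a2]
    rw [lintegral_lintegral_swap (by fun_prop)]
  have s2 : ∀ x, ∫⁻ y, ENNReal.ofReal ((f₀ x - f₀ y) ^ 2 + R x + R y) ∂π =
      ∫⁻ y, ENNReal.ofReal ((f₀ x - f₀ y) ^ 2) ∂π + ENNReal.ofReal (R x) +
        ∫⁻ y, ENNReal.ofReal (R y) ∂π := fun x => by
    have e : ∀ y, ENNReal.ofReal ((f₀ x - f₀ y) ^ 2 + R x + R y) =
        ENNReal.ofReal ((f₀ x - f₀ y) ^ 2) + ENNReal.ofReal (R x) + ENNReal.ofReal (R y) := fun y => by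
      rw [ENNReal.ofReal_add (add_nonneg (sq_nonneg _) (hR0 x)) (hR0 y),
        ENNReal.ofReal_add (sq_nonneg _) (hR0 x)]
    simp_rw [e]
    rw [lintegral_add_left (by fun_prop), lintegral_add_left (by fun_prop)]
    simp
  have hm : Measurable fun x => ∫⁻ y, ENNReal.ofReal ((f₀ x - f₀ y) ^ 2) ∂π :=
    Measurable.lintegral_prod_right' (f := fun z : (Fin n → ℝ) × (Fin n → ℝ) =>
      ENNReal.ofReal ((f₀ z.1 - f₀ z.2) ^ 2)) (by fun_prop)
  have s3 : ∫⁻ y, ENNReal.ofReal (R y) ∂π = ∑ S ∈ Finset.univ.erase (∅ : Finset (Fin n)),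
        ∫⁻ x, ENNReal.ofReal (walshPart S f x ^ 2) ∂π := by
    rw [← lintegral_finsetSum _ fun S _ => ((measurable_walshPart S hf).pow_const 2).ennreal_ofReal]
    refine lintegral_congr fun x => ?_
    exact ENNReal.ofReal_sum_of_nonneg fun _ _ => sq_nonneg _
  unfold pairVar
  rw [s1]
  simp_rw [s2]
  rw [lintegral_add_left (by fun_prop), lintegral_add_left hm, lintegral_const, measure_univ, mul_one,
    s3, add_assoc, ← two_mul, mul_add, ← mul_assoc, ENNReal.inv_mul_cancel two_ne_zero (by simp),
    one_mul]

theorem measurePreserving_update (i : Fin n) :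
    MeasurePreserving (fun z : (Fin n → ℝ) × ℝ => Function.update z.1 i z.2)
      ((Measure.pi fun _ => ν).prod ν) (Measure.pi fun _ => ν) := by
  refine ⟨measurable_update_uncurry i, (Measure.pi_eq fun s hs => ?_).symm⟩
  rw [Measure.map_apply (measurable_update_uncurry i) (MeasurableSet.univ_pi hs)]
  have e : (fun z : (Fin n → ℝ) × ℝ => Function.update z.1 i z.2) ⁻¹' (univ.pi s) =
      (univ.pi (Function.update s i univ)) ×ˢ s i := by
    ext z
    simp only [mem_preimage, Set.mem_pi, mem_univ, true_implies, mem_prod]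
    constructor
    · intro h
      refine ⟨fun j => ?_, by simpa using h i⟩
      by_cases hj : j = i
      · subst hj; simp
      · simpa [hj] using h j
    · rintro ⟨h1, h2⟩ j
      by_cases hj : j = i
      · subst hj; simpa using h2
      · simpa [hj] using h1 j
  rw [e, Measure.prod_prod, Measure.pi_pi, ← Finset.mul_prod_erase _ _ (Finset.mem_univ i),
    ← Finset.mul_prod_erase _ (fun j => ν (s j)) (Finset.mem_univ i)]
  simp only [Function.update_self, measure_univ, one_mul]
  rw [mul_comm]
  congr 1
  refine Finset.prod_congr rfl fun j hj => ?_
  rw [Function.update_of_ne (Finset.ne_of_mem_erase hj)]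

theorem lintegral_lintegral_update (i : Fin n) {F : (Fin n → ℝ) → ENNReal} (hF : Measurable F) :
    ∫⁻ x, ∫⁻ t, F (Function.update x i t) ∂ν ∂Measure.pi (fun _ => ν) =
      ∫⁻ x, F x ∂Measure.pi (fun _ => ν) := by
  have e := (measurePreserving_update (ν := ν) i).lintegral_comp hF
  rw [lintegral_prod (fun z : (Fin n → ℝ) × ℝ => F (Function.update z.1 i z.2))
    (hF.comp (measurable_update_uncurry i)).aemeasurable] at e
  exact e

end Product

/-! ### The inequality for products of even measures (the case p = q) -/

section ProductInequality

variable {n : ℕ}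

theorem isPrimitive_walshPart {f : (Fin n → ℝ) → ℝ} {g : (Fin n → ℝ) → ℝ} {x : Fin n → ℝ} {i : Fin n}
    (S : Finset (Fin n))
    (h : ∀ ε : Fin n → ℤˣ, IsPrimitive (fun t => f (Function.update (signMul ε x) i t))
      (fun t => g (Function.update (signMul ε x) i t))) :
    IsPrimitive (fun t => walshPart S f (Function.update x i t))
      (fun t => walshDeriv S i g (Function.update x i t)) := by
  unfold walshPart walshDeriv walshCoeff
  refine (IsPrimitive.sum fun ε _ => IsPrimitive.const_mul ?_ _).const_mul _
  simp_rw [signMul_update]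
  refine (h ε).comp_mul ?_
  rcases Int.units_eq_one_or (ε i) with h | h <;> simp [h]

theorem walshDeriv_signMul (S : Finset (Fin n)) (i : Fin n) (g : (Fin n → ℝ) → ℝ)
    (δ : Fin n → ℤˣ) (x : Fin n → ℝ) :
    walshDeriv S i g (signMul δ x) = walshChar S δ * ((δ i : ℤ) : ℝ) * walshDeriv S i g x := by
  unfold walshDeriv walshCoeff
  rw [mul_left_comm]
  congr 1
  rw [Finset.mul_sum, ← Equiv.sum_comp (Equiv.mulRight δ)]
  simp_rw [signMul_signMul]
  refine Finset.sum_congr rfl fun ε _ => ?_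
  have hδ : δ * δ = 1 := by ext i; simp
  simp only [Equiv.coe_mulRight, walshChar_mul, mul_assoc, hδ, mul_one, Pi.mul_apply, Units.val_mul,
    Int.cast_mul]
  ring

theorem walshDeriv_empty_update_neg_sq (i : Fin n) (g : (Fin n → ℝ) → ℝ) (x : Fin n → ℝ) (t : ℝ) :
    walshDeriv ∅ i g (Function.update x i (-t)) ^ 2 =
      walshDeriv ∅ i g (Function.update x i t) ^ 2 := by
  have h := walshDeriv_signMul ∅ i g (Function.update 1 i (-1)) (Function.update x i t)
  have h2 : signMul (Function.update 1 i (-1)) (Function.update x i t) =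
      Function.update x i (-t) := by
    ext j
    by_cases h : j = i
    · subst h; simp [signMul]
    · simp [signMul, h]
  rw [h2] at h
  rw [h]
  simp [walshChar]

/-- The strong Brascamp–Lieb inequality for the product measure on even functions. -/
theorem pairVar_pi_evenMeasure_le {k q c : ℝ} (hk : 0 ≤ k) (hq : 1 < q)
    [IsProbabilityMeasure (evenMeasure k q)] {f : (Fin n → ℝ) → ℝ} {g : Fin n → (Fin n → ℝ) → ℝ}
    (hf : Measurable f) (hg : ∀ i, Measurable (g i)) (heven : ∀ x, f (-x) = f x)
    (hfg : ∀ i, ∀ᵐ x ∂Measure.pi fun _ => evenMeasure k q,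
      IsPrimitive (fun t => f (Function.update x i t)) (fun t => g i (Function.update x i t)))
    (hc1 : 1 - 1 / q ≤ c) (hc2 : 1 / 2 ≤ c) :
    pairVar (Measure.pi fun _ => evenMeasure k q) f ≤ ENNReal.ofReal (c / (q - 1)) *
      ∑ i, ∫⁻ x, ENNReal.ofReal (|x i| ^ (2 - q) * g i x ^ 2)
        ∂Measure.pi fun _ => evenMeasure k q := by
  set ν := evenMeasure k q with hν
  set π := Measure.pi fun _ : Fin n => ν with hπ
  have hq1 : 0 < q - 1 := by linarith
  have hneg : MeasurePreserving Neg.neg ν ν := measurePreserving_neg_evenMeasure k q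
  have hm : ∀ S i, Measurable fun x : Fin n → ℝ =>
      ENNReal.ofReal (|x i| ^ (2 - q) * walshDeriv S i (g i) x ^ 2) := fun S i => by
    have := measurable_walshDeriv S i (hg i)
    fun_prop
  set D : Finset (Fin n) → Fin n → ENNReal := fun S i =>
    ∫⁻ x, ENNReal.ofReal (|x i| ^ (2 - q) * walshDeriv S i (g i) x ^ 2) ∂π with hD
  -- The weight depends on |x i| only, so the energy is the orthogonal sum of the energies of the
  -- parity components, and each component can be treated on its own.
  have hsum : ∀ i, ∑ S, D S i = ∫⁻ x, ENNReal.ofReal (|x i| ^ (2 - q) * g i x ^ 2) ∂π := by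
    intro i
    have hgi := hg i
    rw [← lintegral_finsetSum _ fun S _ => hm S i,
      lintegral_ofReal_sign_average (F := fun x => |x i| ^ (2 - q) * g i x ^ 2) hneg (by fun_prop)
      fun x => by positivity]
    refine lintegral_congr fun x => ?_
    rw [← ENNReal.ofReal_sum_of_nonneg fun _ _ => by positivity, ← Finset.mul_sum,
      sum_walshDeriv_sq, ← mul_assoc, mul_comm (|x i| ^ (2 - q)), mul_assoc, Finset.mul_sum]
    congr 3
    ext ε
    simp [signMul, abs_mul, abs_unit_cast]
  have hae : ∀ S i, ∀ᵐ x ∂π, IsPrimitive (fun t => walshPart S f (Function.update x i t))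
      (fun t => walshDeriv S i (g i) (Function.update x i t)) := by
    intro S i
    have : ∀ᵐ x ∂π, ∀ ε : Fin n → ℤˣ, IsPrimitive (fun t => f (Function.update (signMul ε x) i t))
        (fun t => g i (Function.update (signMul ε x) i t)) :=
      ae_all_iff.2 fun ε => (measurePreserving_signMul hneg ε).quasiMeasurePreserving.ae (hfg i)
    exact this.mono fun x hx => isPrimitive_walshPart S hx
  have hupd : ∀ (x : Fin n → ℝ) i, Measurable fun t : ℝ => Function.update x i t := fun x i =>
    (measurable_update_uncurry i).comp measurable_prodMk_left
  -- The constant is 1/q = (1 - 1/q)/(q - 1), whence the condition `hc1`.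
  have h0 : pairVar π (walshPart ∅ f) ≤ ∑ i, ENNReal.ofReal (1 / q) * D ∅ i := by
    refine (efronStein (measurable_walshPart ∅ hf)).trans (Finset.sum_le_sum fun i _ => ?_)
    simp only [hD]
    rw [← lintegral_lintegral_update i (hm ∅ i), ← lintegral_const_mul']
    · refine lintegral_mono_ae ((hae ∅ i).mono fun x hx => ?_)
      refine (pairVar_evenMeasure_le hk (by linarith) ((measurable_walshPart ∅ hf).comp (hupd x i))
        ((measurable_walshDeriv ∅ i (hg i)).comp (hupd x i)) hx (fun t => ?_)
        (fun t => walshDeriv_empty_update_neg_sq i (g i) x t)).trans_eq ?_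
      · simp only [Function.comp_apply, walshPart_update_neg, Finset.notMem_empty, if_false, one_mul]
      · simp [hν]
    · exact ENNReal.ofReal_ne_top
  -- Oddness in the coordinate i makes the component vanish at x i = 0, so Hardy's inequality holds
  -- on each line in that direction.
  have h1 : ∀ S : Finset (Fin n), ∀ i ∈ S, ∫⁻ x, ENNReal.ofReal (walshPart S f x ^ 2) ∂π ≤
      ENNReal.ofReal (1 / (q - 1)) * D S i := by
    intro S i hi
    simp only [hD]
    rw [← lintegral_lintegral_update i (hm S i), ← lintegral_const_mul',
      ← lintegral_lintegral_update i ((measurable_walshPart S hf).pow_const 2).ennreal_ofReal]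
    · refine lintegral_mono_ae ((hae S i).mono fun x hx => ?_)
      refine (lintegral_sq_evenMeasure_le hk hq ((measurable_walshPart S hf).comp (hupd x i))
        ((measurable_walshDeriv S i (hg i)).comp (hupd x i)) hx ?_).trans_eq ?_
      · have := walshPart_update_neg S f x i 0
        rw [if_pos hi, neg_zero] at this
        change walshPart S f (Function.update x i 0) = 0
        linarith
      · simp [hν]
    · exact ENNReal.ofReal_ne_top
  have hc0 : 0 ≤ c := by linarith
  have h2 : ∀ S ∈ Finset.univ.erase (∅ : Finset (Fin n)),
      ∫⁻ x, ENNReal.ofReal (walshPart S f x ^ 2) ∂π ≤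
        ∑ i, ENNReal.ofReal (c / (q - 1)) * D S i := by
    intro S hS
    rcases Nat.even_or_odd S.card with he | ho
    · have hne : S.Nonempty := Finset.nonempty_iff_ne_empty.2 (Finset.ne_of_mem_erase hS)
      have hcard : 1 < S.card := by
        have := hne.card_pos
        obtain ⟨m, hm⟩ := he
        omega
      obtain ⟨i, hi, j, hj, hij⟩ := Finset.one_lt_card.1 hcard
      set A := ∫⁻ x, ENNReal.ofReal (walshPart S f x ^ 2) ∂π
      -- A nonempty set of even size has two elements i and j. Half of the second moment is charged
      -- to each direction, whence the condition c ≥ 1/2.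
      have e1 : A = ENNReal.ofReal (1 / 2) * A + ENNReal.ofReal (1 / 2) * A := by
        rw [← add_mul, ← ENNReal.ofReal_add (by norm_num) (by norm_num)]
        norm_num
      have e2 : ∀ i ∈ S, ENNReal.ofReal (1 / 2) * A ≤ ENNReal.ofReal (c / (q - 1)) * D S i := by
        intro i hi
        refine (mul_le_mul_right (h1 S i hi) _).trans ?_
        rw [← mul_assoc, ← ENNReal.ofReal_mul (by norm_num)]
        refine mul_le_mul_left (ENNReal.ofReal_le_ofReal ?_) _
        rw [← mul_div_assoc, mul_one]
        gcongr
      calc A ≤ ENNReal.ofReal (c / (q - 1)) * D S i + ENNReal.ofReal (c / (q - 1)) * D S j := by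
            conv_lhs => rw [e1]
            exact add_le_add (e2 i hi) (e2 j hj)
        _ = ∑ l ∈ {i, j}, ENNReal.ofReal (c / (q - 1)) * D S l := by
            rw [Finset.sum_pair hij]
        _ ≤ _ := Finset.sum_le_sum_of_subset (Finset.subset_univ _)
    · simp [walshPart_eq_zero_of_odd_card ho heven]
  calc pairVar π f ≤ pairVar π (walshPart ∅ f) + ∑ S ∈ Finset.univ.erase (∅ : Finset (Fin n)),
        ∫⁻ x, ENNReal.ofReal (walshPart S f x ^ 2) ∂π := pairVar_pi_le_walsh hneg hf
    _ ≤ ∑ i, ENNReal.ofReal (c / (q - 1)) * D ∅ i + ∑ S ∈ Finset.univ.erase (∅ : Finset (Fin n)),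
        ∑ i, ENNReal.ofReal (c / (q - 1)) * D S i := by
      refine add_le_add (h0.trans (Finset.sum_le_sum fun i _ => mul_le_mul_left
        (ENNReal.ofReal_le_ofReal ?_) _)) (Finset.sum_le_sum h2)
      rw [div_le_div_iff₀ (by linarith) hq1]
      have : (1 - 1 / q) * q ≤ c * q := mul_le_mul_of_nonneg_right hc1 (by linarith)
      have e : (1 - 1 / q) * q = q - 1 := by field_simp
      linarith
    _ = ENNReal.ofReal (c / (q - 1)) * ∑ i, ∑ S, D S i := by
      rw [Finset.add_sum_erase _ (fun S => ∑ i, ENNReal.ofReal (c / (q - 1)) * D S i)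
        (Finset.mem_univ _), Finset.sum_comm, Finset.mul_sum]
      exact Finset.sum_congr rfl fun i _ => by rw [Finset.mul_sum]
    _ = _ := by simp_rw [hsum]

end ProductInequality

/-! ### The `ℓ^q` norm and polar coordinates -/

/-- The `ℓ^q` norm on `ℝⁿ`. -/
noncomputable def lqNorm {n : ℕ} (q : ℝ) (x : Fin n → ℝ) : ℝ := (∑ i, |x i| ^ q) ^ (1 / q)

section LqNorm

variable {n : ℕ} {q : ℝ}

theorem lqNorm_nonneg (x : Fin n → ℝ) : 0 ≤ lqNorm q x := by
  unfold lqNorm; positivity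

theorem lqNorm_rpow (hq : 0 < q) (x : Fin n → ℝ) : lqNorm q x ^ q = ∑ i, |x i| ^ q := by
  unfold lqNorm
  rw [← Real.rpow_mul (by positivity), one_div_mul_cancel hq.ne', Real.rpow_one]

theorem lqNorm_smul (hq : 0 < q) {r : ℝ} (hr : 0 ≤ r) (x : Fin n → ℝ) :
    lqNorm q (r • x) = r * lqNorm q x := by
  unfold lqNorm
  simp only [Pi.smul_apply, smul_eq_mul, abs_mul, abs_of_nonneg hr]
  simp_rw [Real.mul_rpow hr (abs_nonneg _)]
  rw [← Finset.mul_sum, Real.mul_rpow (by positivity) (by positivity), ← Real.rpow_mul hr,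
    mul_one_div_cancel hq.ne', Real.rpow_one]

theorem continuous_lqNorm (hq : 0 < q) : Continuous (lqNorm q : (Fin n → ℝ) → ℝ) := by
  unfold lqNorm
  have h1 := Real.continuous_rpow_const hq.le
  have h2 := Real.continuous_rpow_const (q := 1 / q) (by positivity)
  fun_prop

theorem lqNorm_pos {x : Fin n → ℝ} {i : Fin n} (hx : x i ≠ 0) : 0 < lqNorm q x := by
  unfold lqNorm
  refine Real.rpow_pos_of_pos ?_ _
  refine Finset.sum_pos' (fun _ _ => by positivity) ⟨i, Finset.mem_univ i, ?_⟩
  exact Real.rpow_pos_of_pos (abs_pos.2 hx) _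

theorem lqNorm_neg (x : Fin n → ℝ) : lqNorm q (-x) = lqNorm q x := by
  simp [lqNorm]

theorem lqNorm_eq_norm_toLp [Fact (1 ≤ ENNReal.ofReal q)] (hq : 1 ≤ q) (x : Fin n → ℝ) :
    lqNorm q x = ‖WithLp.toLp (ENNReal.ofReal q) x‖ := by
  rw [PiLp.norm_eq_sum (by rw [ENNReal.toReal_ofReal] <;> linarith)]
  simp [lqNorm, ENNReal.toReal_ofReal (zero_le_one.trans hq)]

/-- Lebesgue measure, carried to the normed space `PiLp`, is a Haar measure, and polar integration
holds there for any norm. The sphere measure is normalised to a probability measure, K being its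
total mass. -/
theorem exists_polar_lintegral (hn : 1 ≤ n) (hq : 1 ≤ q) :
    ∃ (σ : Measure (Fin n → ℝ)) (K : ℝ), 0 ≤ K ∧ IsProbabilityMeasure σ ∧
      (∀ᵐ θ ∂σ, lqNorm q θ = 1) ∧ ∀ Φ : (Fin n → ℝ) → ENNReal, Measurable Φ →
        ∫⁻ x, Φ x = ENNReal.ofReal K * ∫⁻ θ, (∫⁻ r in Ioi (0 : ℝ),
          ENNReal.ofReal (r ^ ((n : ℝ) - 1)) * Φ (r • θ)) ∂σ := by
  have hfact : Fact (1 ≤ ENNReal.ofReal q) := ⟨by simpa using hq⟩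
  set E := PiLp (ENNReal.ofReal q) (fun _ : Fin n => ℝ) with hE
  set e : E ≃L[ℝ] (Fin n → ℝ) := PiLp.continuousLinearEquiv (ENNReal.ofReal q) ℝ (fun _ => ℝ) with he
  have : Nonempty (Fin n) := ⟨⟨0, hn⟩⟩
  have : Nontrivial E := e.toEquiv.nontrivial
  set μ : Measure E := Measure.map e.symm volume with hμ
  have : μ.IsAddHaarMeasure := e.symm.isAddHaarMeasure_map volume
  have hdim : Module.finrank ℝ E = n := by
    rw [e.toLinearEquiv.finrank_eq]; simp
  have hnorm : ∀ y : E, lqNorm q (e y) = ‖y‖ := fun y => by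
    rw [lqNorm_eq_norm_toLp hq]; rfl
  have hem : Measurable e := e.continuous.measurable
  set S := μ.toSphere univ with hS
  have hS0 : S ≠ 0 := by
    rw [hS, Ne, Measure.measure_univ_eq_zero]
    exact μ.toSphere_ne_zero
  have hSt : S ≠ ⊤ := measure_ne_top _ _
  set σ₀ : Measure (Fin n → ℝ) := Measure.map (fun θ : Metric.sphere (0 : E) 1 => e θ) μ.toSphere
    with hσ₀
  have hmap : Measurable (fun θ : Metric.sphere (0 : E) 1 => e θ) := hem.comp measurable_subtype_coe
  refine ⟨S⁻¹ • σ₀, S.toReal, ENNReal.toReal_nonneg, ?_, ?_, ?_⟩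
  · constructor
    rw [Measure.smul_apply, hσ₀, Measure.map_apply hmap MeasurableSet.univ, preimage_univ,
      smul_eq_mul, ENNReal.inv_mul_cancel hS0 hSt]
  · refine Measure.ae_smul_measure ?_ _
    rw [hσ₀, ae_map_iff hmap.aemeasurable
      (measurableSet_eq_fun (continuous_lqNorm (by linarith)).measurable measurable_const)]
    refine ae_of_all _ fun θ => ?_
    rw [hnorm]
    simp
  · intro Φ hΦ
    have hm2 : Measurable fun z : (Fin n → ℝ) × ℝ =>
        ENNReal.ofReal (z.2 ^ ((n : ℝ) - 1)) * Φ (z.2 • z.1) := by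
      have : Measurable fun z : (Fin n → ℝ) × ℝ => z.2 • z.1 := by fun_prop
      exact (by fun_prop : Measurable fun z : (Fin n → ℝ) × ℝ =>
        ENNReal.ofReal (z.2 ^ ((n : ℝ) - 1))).mul (hΦ.comp this)
    rw [lintegral_smul_measure, ENNReal.ofReal_toReal hSt, smul_eq_mul, ← mul_assoc,
      ENNReal.mul_inv_cancel hS0 hSt, one_mul, hσ₀, lintegral_map hm2.lintegral_prod_right' hmap]
    have h1 : ∫⁻ x, Φ x = ∫⁻ y, Φ (e y) ∂μ := by
      rw [hμ, lintegral_map (f := fun y => Φ (e y)) (hΦ.comp hem) e.symm.continuous.measurable]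
      simp
    have h2 : ∫⁻ y, Φ (e y) ∂μ = ∫⁻ y : ({0}ᶜ : Set E), Φ (e y) ∂(μ.comap Subtype.val) := by
      rw [lintegral_subtype_comap (measurableSet_singleton 0).compl (fun y => Φ (e y)),
        restrict_compl_singleton]
    have h3 := μ.measurePreserving_homeomorphUnitSphereProd.lintegral_comp_emb
      (homeomorphUnitSphereProd E).measurableEmbedding
      (fun z => Φ (e ((homeomorphUnitSphereProd E).symm z)))
    simp only [Homeomorph.symm_apply_apply] at h3
    have hm3 : Measurable fun z : Metric.sphere (0 : E) 1 × Ioi (0 : ℝ) =>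
        Φ (e ((homeomorphUnitSphereProd E).symm z)) :=
      hΦ.comp (hem.comp (measurable_subtype_coe.comp (Homeomorph.measurable _)))
    rw [h1, h2, h3, lintegral_prod _ hm3.aemeasurable]
    refine lintegral_congr fun θ => ?_
    have hm4 : Measurable fun r : Ioi (0 : ℝ) => Φ (e ((homeomorphUnitSphereProd E).symm (θ, r))) :=
      hm3.comp measurable_prodMk_left
    have hm5 : Measurable fun r : Ioi (0 : ℝ) =>
        ENNReal.ofReal ((r : ℝ) ^ (Module.finrank ℝ E - 1)) := by fun_prop
    rw [Measure.volumeIoiPow, lintegral_withDensity_eq_lintegral_mul _ hm5 hm4,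
      ← lintegral_subtype_comap measurableSet_Ioi]
    refine lintegral_congr fun r => ?_
    have hr : (0 : ℝ) < r := r.2
    have e1 : ((r : ℝ) ^ ((n : ℝ) - 1)) = (r : ℝ) ^ (n - 1) := by
      rw [← Real.rpow_natCast, Nat.cast_sub hn, Nat.cast_one]
    simp [hdim, e1]

end LqNorm

/-! ### Polar factorisation of the measures; moments -/

section PolarMeasure

variable {n : ℕ} {q : ℝ}

/-- `σ` represents Lebesgue measure in polar coordinates for the `ℓ^q` norm, up to the factor
`K`. -/
structure IsPolar (n : ℕ) (q K : ℝ) (σ : Measure (Fin n → ℝ)) : Prop where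
  nonneg : 0 ≤ K
  prob : IsProbabilityMeasure σ
  norm_eq : ∀ᵐ θ ∂σ, lqNorm q θ = 1
  lintegral_eq : ∀ Φ : (Fin n → ℝ) → ENNReal, Measurable Φ →
    ∫⁻ x, Φ x = ENNReal.ofReal K * ∫⁻ θ, (∫⁻ r in Ioi (0 : ℝ),
      ENNReal.ofReal (r ^ ((n : ℝ) - 1)) * Φ (r • θ)) ∂σ

/-- The same σ works for every exponent p. Hence an inequality on the sphere deduced from the
product case p = q can be used for all p. -/
theorem IsPolar.measurePreserving {K C p : ℝ} {σ : Measure (Fin n → ℝ)} (h : IsPolar n q K σ)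
    (hq : 0 < q) {μ : Measure (Fin n → ℝ)} [IsProbabilityMeasure μ]
    (hμ : μ = volume.withDensity fun x => ENNReal.ofReal (C * Real.exp (-(lqNorm q x ^ p / p)))) :
    IsProbabilityMeasure (radialMeasure (K * C) n p) ∧
      MeasurePreserving (fun z : ℝ × (Fin n → ℝ) => z.1 • z.2)
        ((radialMeasure (K * C) n p).prod σ) μ := by
  have := h.prob
  have hN : Measurable (lqNorm q : (Fin n → ℝ) → ℝ) := (continuous_lqNorm hq).measurable
  have hs : Measurable fun z : ℝ × (Fin n → ℝ) => z.1 • z.2 := by fun_prop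
  have key : ∀ Φ : (Fin n → ℝ) → ENNReal, Measurable Φ →
      ∫⁻ x, Φ x ∂μ = ∫⁻ θ, ∫⁻ r, Φ (r • θ) ∂radialMeasure (K * C) n p ∂σ := by
    intro Φ hΦ
    have hm : Measurable fun x : Fin n → ℝ => ENNReal.ofReal (C * Real.exp (-(lqNorm q x ^ p / p))) := by
      fun_prop
    rw [hμ, lintegral_withDensity_eq_lintegral_mul _ hm hΦ, h.lintegral_eq _ (hm.mul hΦ),
      ← lintegral_const_mul' _ _ ENNReal.ofReal_ne_top]
    refine lintegral_congr_ae (h.norm_eq.mono fun θ hθ => ?_)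
    have hsθ : Measurable fun r : ℝ => r • θ := by fun_prop
    simp only
    rw [lintegral_radialMeasure _ _ _ (fun r => Φ (r • θ)) (hΦ.comp hsθ),
      ← lintegral_const_mul' _ _ ENNReal.ofReal_ne_top]
    refine setLIntegral_congr_fun measurableSet_Ioi fun r hr => ?_
    have hr0 : (0 : ℝ) < r := hr
    have hK := h.nonneg
    simp only [Pi.mul_apply]
    rw [lqNorm_smul hq hr0.le, hθ, mul_one, ← mul_assoc, ← mul_assoc,
      ← ENNReal.ofReal_mul hK, ← ENNReal.ofReal_mul (by positivity)]
    congr 2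
    ring
  have hprob : IsProbabilityMeasure (radialMeasure (K * C) n p) := by
    constructor
    simpa using (key (fun _ => 1) measurable_const).symm
  refine ⟨hprob, hs, ?_⟩
  refine Measure.ext_of_lintegral _ fun Φ hΦ => ?_
  rw [lintegral_map hΦ hs, key Φ hΦ, 
    lintegral_prod_symm (fun z : ℝ × (Fin n → ℝ) => Φ (z.1 • z.2)) (hΦ.comp hs).aemeasurable]

theorem exists_isPolar (hn : 1 ≤ n) (hq : 1 ≤ q) :
    ∃ (σ : Measure (Fin n → ℝ)) (K : ℝ), IsPolar n q K σ := by
  obtain ⟨σ, K, h1, h2, h3, h4⟩ := exists_polar_lintegral hn hq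
  exact ⟨σ, K, h1, h2, h3, h4⟩

theorem integral_radial_pos {s p : ℝ} (hs : -1 < s) (hp : 0 < p) :
    0 < ∫ r in Ioi 0, r ^ s * Real.exp (-(r ^ p / p)) := by
  rw [setIntegral_pos_iff_support_of_nonneg_ae]
  · have : Ioi (0 : ℝ) ⊆ (Function.support fun r : ℝ => r ^ s * Real.exp (-(r ^ p / p))) ∩ Ioi 0 :=
      fun r hr => ⟨by
        have hr0 : (0 : ℝ) < r := hr
        have : 0 < r ^ s * Real.exp (-(r ^ p / p)) := by positivity
        exact this.ne', hr⟩
    exact lt_of_lt_of_le (by simp) (measure_mono this)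
  · refine (ae_restrict_mem measurableSet_Ioi).mono fun r hr => ?_
    have hr0 : (0 : ℝ) < r := hr
    simp only [Pi.zero_apply]
    positivity
  · exact integrableOn_radial hs hp

theorem exists_isProbabilityMeasure_evenMeasure (hq : 0 < q) :
    ∃ k, 0 < k ∧ IsProbabilityMeasure (evenMeasure k q) := by
  set I := ∫ r in Ioi 0, r ^ ((1 : ℝ) - 1) * Real.exp (-(r ^ q / q)) with hI
  have hI0 : 0 < I := integral_radial_pos (by norm_num) hq
  refine ⟨1 / (2 * I), by positivity, ⟨?_⟩⟩
  have h1 : radialMeasure (1 / (2 * I)) 1 q univ = ENNReal.ofReal (1 / 2) := by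
    have h := setLIntegral_radialMeasure_ofReal (k := 1 / (2 * I)) (d := 1) (p := q) (by positivity)
      (S := univ) MeasurableSet.univ (fun _ => 1) measurable_const (fun _ _ _ => zero_le_one)
      (by simpa using integrableOn_radial (s := (1:ℝ) - 1) (by norm_num) hq)
    simp only [ENNReal.ofReal_one, lintegral_const, Measure.restrict_univ, one_mul, inter_univ,
      ← hI] at h
    rw [h]
    congr 1
    field_simp
  rw [evenMeasure, Measure.add_apply, Measure.map_apply measurable_neg MeasurableSet.univ,
    preimage_univ, h1, ← ENNReal.ofReal_add (by norm_num) (by norm_num)]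
  norm_num

theorem evenMeasure_eq_withDensity (k q : ℝ) :
    evenMeasure k q = volume.withDensity fun t => ENNReal.ofReal (k * Real.exp (-(|t| ^ q / q))) := by
  refine Measure.ext_of_lintegral _ fun F hF => ?_
  set d : ℝ → ENNReal := fun t => ENNReal.ofReal (k * Real.exp (-(|t| ^ q / q))) with hd
  have hdm : Measurable d := by fun_prop
  have hs := lintegral_add_compl (μ := volume) (fun a => (d * F) a) (measurableSet_Ioi (a := (0 : ℝ)))
  rw [compl_Ioi, setLIntegral_congr Iio_ae_eq_Iic.symm] at hs
  rw [lintegral_evenMeasure _ _ hF, lintegral_withDensity_eq_lintegral_mul _ hdm hF,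
    ← hs, lintegral_radialMeasure _ _ _ _ hF,
    lintegral_radialMeasure _ _ _ (fun t => F (-t)) (hF.comp measurable_neg)]
  have e : ∀ (G : ℝ → ENNReal), Measurable G →
      ∫⁻ r in Ioi 0, ENNReal.ofReal (k * (r ^ ((1 : ℝ) - 1) * Real.exp (-(r ^ q / q)))) * G r =
        ∫⁻ r in Ioi 0, d r * G r := by
    intro G hG
    refine setLIntegral_congr_fun measurableSet_Ioi fun r hr => ?_
    have hr0 : (0 : ℝ) < r := hr
    simp only [hd]
    rw [sub_self, Real.rpow_zero, one_mul, abs_of_pos hr0]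
  rw [e F hF, e (fun t => F (-t)) (hF.comp measurable_neg)]
  congr 1
  have h := (Measure.measurePreserving_neg (volume : Measure ℝ)).setLIntegral_comp_preimage
    (s := Iio 0) measurableSet_Iio (hdm.mul hF)
  rw [← h]
  have e2 : Neg.neg ⁻¹' Iio (0 : ℝ) = Ioi 0 := by ext; simp
  rw [e2]
  refine lintegral_congr fun r => ?_
  simp [hd]

/-- For p = q the potential is a sum over the coordinates, so the measure is a product. -/
theorem pi_evenMeasure_eq_withDensity {k : ℝ} (hk : 0 ≤ k) (hq : 0 < q)
    [IsProbabilityMeasure (evenMeasure k q)] :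
    (Measure.pi fun _ : Fin n => evenMeasure k q) = volume.withDensity fun x =>
      ENNReal.ofReal (k ^ n * Real.exp (-(lqNorm q x ^ q / q))) := by
  set d : ℝ → ℝ := fun t => k * Real.exp (-(|t| ^ q / q)) with hd
  have hdm : Measurable d := by fun_prop
  have hd0 : ∀ t, 0 ≤ d t := fun t => by positivity
  have hdi : Integrable d := by
    refine ⟨hdm.aestronglyMeasurable, ?_⟩
    rw [hasFiniteIntegral_iff_ofReal (ae_of_all _ hd0)]
    have h1 : evenMeasure k q univ = 1 := measure_univ
    rw [evenMeasure_eq_withDensity, withDensity_apply _ MeasurableSet.univ,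
      Measure.restrict_univ] at h1
    rw [h1]; simp
  symm
  refine (Measure.pi_eq fun s hs => ?_).symm
  rw [withDensity_apply _ (MeasurableSet.univ_pi hs), ← lintegral_indicator (MeasurableSet.univ_pi hs)]
  have hi : ∀ i, Integrable ((s i).indicator d) := fun i => hdi.indicator (hs i)
  have e1 : ∀ x : Fin n → ℝ, (univ.pi s).indicator (fun x =>
      ENNReal.ofReal (k ^ n * Real.exp (-(lqNorm q x ^ q / q)))) x =
      ENNReal.ofReal (∏ i, (s i).indicator d (x i)) := by
    intro x
    by_cases hx : x ∈ univ.pi s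
    · rw [indicator_of_mem hx]
      have : ∀ i, (s i).indicator d (x i) = d (x i) := fun i =>
        indicator_of_mem (hx i (mem_univ i)) _
      simp_rw [this, hd, Finset.prod_mul_distrib, ← Real.exp_sum, lqNorm_rpow hq]
      simp [Finset.sum_div]
    · rw [indicator_of_notMem hx]
      simp only [Set.mem_pi, mem_univ, true_implies, not_forall] at hx
      obtain ⟨i, hi⟩ := hx
      rw [Finset.prod_eq_zero (Finset.mem_univ i) (indicator_of_notMem hi _)]
      simp
  simp_rw [e1]
  have hP : Integrable fun x : Fin n → ℝ => ∏ i, (s i).indicator d (x i) := by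
    rw [volume_pi]; exact Integrable.fintype_prod hi
  rw [← ofReal_integral_eq_lintegral_ofReal hP
    (ae_of_all _ fun x => Finset.prod_nonneg fun i _ => indicator_nonneg (fun _ _ => hd0 _) _),
    integral_fintype_prod_volume_eq_prod, ENNReal.ofReal_prod_of_nonneg
    fun i _ => integral_nonneg fun _ => indicator_nonneg (fun _ _ => hd0 _) _]
  refine Finset.prod_congr rfl fun i _ => ?_
  rw [integral_indicator (hs i), ofReal_integral_eq_lintegral_ofReal hdi.integrableOn
    (ae_of_all _ hd0), evenMeasure_eq_withDensity, withDensity_apply _ (hs i)]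

/-- The moments of a radial measure. -/
theorem exists_radial_moment {k d p a : ℝ} (hk : 0 ≤ k) (hd : 0 < d) (hp : 0 < p)
    [IsProbabilityMeasure (radialMeasure k d p)] (ha : 0 < a + d) :
    ∃ m : ℝ, 0 < m ∧ ∫⁻ r, ENNReal.ofReal (r ^ a) ∂radialMeasure k d p = ENNReal.ofReal m ∧
      ∫⁻ r, ENNReal.ofReal (r ^ (a + p)) ∂radialMeasure k d p = ENNReal.ofReal ((a + d) * m) := by
  have hk0 : 0 < k := by
    rcases hk.eq_or_lt with h | h
    · have := integral_radialMeasure_total (k := k) hk hd hp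
      rw [← h, zero_mul] at this
      exact absurd this zero_ne_one
    · exact h
  have hi : ∀ b, 0 < b + d → ∫⁻ r, ENNReal.ofReal (r ^ b) ∂radialMeasure k d p =
      ENNReal.ofReal (k * ∫ r in Ioi 0, r ^ (b + d - 1) * Real.exp (-(r ^ p / p))) := by
    intro b hb
    have e : EqOn (fun r : ℝ => r ^ b * (r ^ (d - 1) * Real.exp (-(r ^ p / p))))
        (fun r => r ^ (b + d - 1) * Real.exp (-(r ^ p / p))) (Ioi 0) := fun r hr => by
      simp only
      rw [← mul_assoc, ← Real.rpow_add hr]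
      ring_nf
    have h := setLIntegral_radialMeasure_ofReal (k := k) (d := d) (p := p) hk (S := univ)
      MeasurableSet.univ (fun r => r ^ b) (by fun_prop) (fun r _ hr => by positivity)
      (by
        rw [inter_univ]
        exact (integrableOn_radial (by linarith) hp).congr_fun e.symm measurableSet_Ioi)
    rw [inter_univ, setIntegral_congr_fun measurableSet_Ioi e, Measure.restrict_univ] at h
    exact h
  refine ⟨k * ∫ r in Ioi 0, r ^ (a + d - 1) * Real.exp (-(r ^ p / p)),
    mul_pos hk0 (integral_radial_pos (by linarith) hp), hi a ha, ?_⟩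
  rw [hi (a + p) (by linarith)]
  congr 1
  -- The exact-derivative identity with a + d in place of d is the recursion for the moments.
  have h := integral_Ioi_radial (d := a + d) (p := p) ha hp le_rfl
  rw [Real.zero_rpow ha.ne', zero_mul] at h
  have i1 := (integrableOn_radial (s := a + d - 1) (p := p) (by linarith) hp).const_mul (a + d)
  have i2 := integrableOn_radial (s := a + p + d - 1) (p := p) (by linarith) hp
  have e : EqOn (fun r : ℝ => (r ^ p - (a + d)) * (r ^ (a + d - 1) * Real.exp (-(r ^ p / p))))
      (fun r => r ^ (a + p + d - 1) * Real.exp (-(r ^ p / p)) -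
        (a + d) * (r ^ (a + d - 1) * Real.exp (-(r ^ p / p)))) (Ioi 0) := fun r hr => by
    have : r ^ (a + p + d - 1) = r ^ p * r ^ (a + d - 1) := by
      rw [← Real.rpow_add hr]; ring_nf
    simp only
    rw [this]; ring
  rw [setIntegral_congr_fun measurableSet_Ioi e, integral_sub i2 i1, integral_const_mul] at h
  rw [sub_eq_zero.1 h]; ring

end PolarMeasure

/-! ### Locally Lipschitz functions -/

section LocallyLipschitzFunctions

theorem LocallyLipschitz.real_mul {X : Type*} [PseudoEMetricSpace X] {u v : X → ℝ}
    (hu : LocallyLipschitz u) (hv : LocallyLipschitz v) : LocallyLipschitz fun x => u x * v x := by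
  have h : LocallyLipschitz fun z : ℝ × ℝ => z.1 * z.2 :=
    ContDiff.locallyLipschitz (𝕂 := ℝ) (by fun_prop)
  exact h.comp (hu.prodMk hv)

theorem LocallyLipschitz.ae_differentiableAt {E : Type*} [NormedAddCommGroup E] [NormedSpace ℝ E]
    [FiniteDimensional ℝ E] [MeasurableSpace E] [BorelSpace E] (μ : Measure E) [μ.IsAddHaarMeasure]
    {f : E → ℝ} (hf : LocallyLipschitz f) : ∀ᵐ x ∂μ, DifferentiableAt ℝ f x := by
  have : ProperSpace E := FiniteDimensional.proper ℝ E
  have h : ∀ m : ℕ, ∀ᵐ x ∂μ, x ∈ Metric.ball (0 : E) m → DifferentiableAt ℝ f x := by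
    intro m
    obtain ⟨K, hK⟩ := hf.locallyLipschitzOn.exists_lipschitzOnWith_of_compact
      (isCompact_closedBall (0 : E) m)
    refine (hK.mono Metric.ball_subset_closedBall).ae_differentiableWithinAt_of_mem.mono
      fun x hx hxm => (hx hxm).differentiableAt (Metric.isOpen_ball.mem_nhds hxm)
  filter_upwards [ae_all_iff.2 h] with x hx
  obtain ⟨m, hm⟩ := exists_nat_gt ‖x‖
  exact hx m (by simpa using hm)

theorem LocallyLipschitz.exists_norm_fderiv_le {E : Type*} [NormedAddCommGroup E] [NormedSpace ℝ E]
    [FiniteDimensional ℝ E] {f : E → ℝ} (hf : LocallyLipschitz f) (R : ℝ) :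
    ∃ K : ℝ, 0 ≤ K ∧ ∀ x, ‖x‖ < R → ‖fderiv ℝ f x‖ ≤ K := by
  have : ProperSpace E := FiniteDimensional.proper ℝ E
  obtain ⟨K, hK⟩ := hf.locallyLipschitzOn.exists_lipschitzOnWith_of_compact
    (isCompact_closedBall (0 : E) R)
  refine ⟨K, K.2, fun x hx => norm_fderiv_le_of_lipschitzOn ℝ (s := Metric.ball 0 R)
    (Metric.isOpen_ball.mem_nhds (by simpa using hx)) (hK.mono Metric.ball_subset_closedBall)⟩

theorem LocallyLipschitz.sub_eq_integral {φ ψ : ℝ → ℝ} (hφ : LocallyLipschitz φ) {s t : ℝ}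
    (h : ∀ᵐ u, u ∈ uIoc s t → HasDerivAt φ (ψ u) u) :
    IntervalIntegrable ψ volume s t ∧ φ t - φ s = ∫ u in s..t, ψ u := by
  obtain ⟨K, hK⟩ := hφ.locallyLipschitzOn.exists_lipschitzOnWith_of_compact
    (isCompact_uIcc (a := s) (b := t))
  have hac := hK.absolutelyContinuousOnInterval
  have e : ∀ᵐ u, u ∈ uIoc s t → deriv φ u = ψ u := h.mono fun u hu hm => (hu hm).deriv
  refine ⟨hac.intervalIntegrable_deriv.congr_ae ?_, ?_⟩
  · exact (ae_restrict_iff' measurableSet_uIoc).2 e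
  · rw [← hac.integral_deriv_eq_sub]
    exact intervalIntegral.integral_congr_ae e

theorem LocallyLipschitz.isPrimitive {φ ψ : ℝ → ℝ} (hφ : LocallyLipschitz φ)
    (h : ∀ᵐ u, HasDerivAt φ (ψ u) u) : IsPrimitive φ ψ :=
  fun _ _ => hφ.sub_eq_integral (h.mono fun _ hu _ => hu)

end LocallyLipschitzFunctions

/-! ### Differentiability of the `ℓ^q` norm -/

section LqNormCalculus

variable {n : ℕ} {q : ℝ}

theorem lqNorm_pos_of_ne_zero {x : Fin n → ℝ} (hx : x ≠ 0) : 0 < lqNorm q x := by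
  obtain ⟨i, hi⟩ := Function.ne_iff.1 hx
  exact lqNorm_pos hi

theorem contDiff_sum_abs_rpow (hq : 1 < q) :
    ContDiff ℝ 1 fun x : Fin n → ℝ => ∑ i, |x i| ^ q := by
  refine ContDiff.sum fun i _ => ?_
  have h := contDiff_norm_rpow (E := ℝ) hq
  exact h.comp (contDiff_apply ℝ ℝ i)

theorem contDiffAt_lqNorm (hq : 1 < q) {x : Fin n → ℝ} (hx : x ≠ 0) :
    ContDiffAt ℝ 1 (lqNorm q) x := by
  refine (contDiff_sum_abs_rpow hq).contDiffAt.rpow_const_of_ne ?_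
  rw [← lqNorm_rpow (by linarith)]
  exact (Real.rpow_pos_of_pos (lqNorm_pos_of_ne_zero hx) _).ne'

/-- The gradient of the `ℓ^q` norm. -/
noncomputable def lqNormal (q : ℝ) (x : Fin n → ℝ) (i : Fin n) : ℝ :=
  lqNorm q x ^ (1 - q) * (|x i| ^ (q - 2) * x i)

theorem hasFDerivAt_sum_abs_rpow (hq : 1 < q) (x : Fin n → ℝ) :
    HasFDerivAt (fun x : Fin n → ℝ => ∑ i, |x i| ^ q)
      (∑ i, (q * |x i| ^ (q - 2) * x i) • ContinuousLinearMap.proj (R := ℝ) (φ := fun _ : Fin n => ℝ) i) x := by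
  refine HasFDerivAt.fun_sum fun i _ => ?_
  have h : HasFDerivAt (fun y : Fin n → ℝ => y i)
      (ContinuousLinearMap.proj (R := ℝ) (φ := fun _ : Fin n => ℝ) i) x := hasFDerivAt_apply i x
  exact (hasDerivAt_abs_rpow (x i) hq).comp_hasFDerivAt x h

theorem hasFDerivAt_lqNorm (hq : 1 < q) {x : Fin n → ℝ} (hx : x ≠ 0) :
    HasFDerivAt (lqNorm q)
      (∑ i, lqNormal q x i • ContinuousLinearMap.proj (R := ℝ) (φ := fun _ : Fin n => ℝ) i) x := by
  have hN := lqNorm_pos_of_ne_zero (q := q) hx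
  have hS : ∑ i, |x i| ^ q = lqNorm q x ^ q := (lqNorm_rpow (by linarith) x).symm
  have h := (hasFDerivAt_sum_abs_rpow hq x).rpow_const (p := 1 / q) (Or.inl (by
    rw [hS]; positivity))
  refine h.congr_fderiv ?_
  rw [Finset.smul_sum]
  refine Finset.sum_congr rfl fun i _ => ?_
  rw [smul_smul, hS, ← Real.rpow_mul hN.le, lqNormal]
  congr 1
  have : q * (1 / q - 1) = 1 - q := by field_simp
  rw [this]
  field_simp

theorem measurable_lqNormal (hq : 0 < q) (i : Fin n) :
    Measurable fun x : Fin n → ℝ => lqNormal q x i := by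
  have hN : Measurable (lqNorm q : (Fin n → ℝ) → ℝ) := (continuous_lqNorm hq).measurable
  unfold lqNormal
  fun_prop

theorem lqNormal_smul (hq : 0 < q) {r : ℝ} (hr : 0 < r) (x : Fin n → ℝ) (i : Fin n) :
    lqNormal q (r • x) i = lqNormal q x i := by
  unfold lqNormal
  rw [lqNorm_smul hq hr.le, Real.mul_rpow hr.le (lqNorm_nonneg _), Pi.smul_apply, smul_eq_mul,
    abs_mul, abs_of_pos hr, Real.mul_rpow hr.le (abs_nonneg _)]
  have : r ^ (1 - q) * r ^ (q - 2) * r = 1 := by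
    nth_rw 3 [← Real.rpow_one r]
    rw [← Real.rpow_add hr, ← Real.rpow_add hr]
    ring_nf
    simp
  linear_combination (lqNorm q x ^ (1 - q) * |x i| ^ (q - 2) * x i) * this

/-- The last factor keeps the identity true at t = 0, whatever values the real powers of 0 take. -/
theorem abs_rpow_mul_abs_rpow (t : ℝ) : |t| ^ (2 - q) * (|t| ^ (q - 2) * t) = t := by
  by_cases ht : t = 0
  · simp [ht]
  · have h : 0 < |t| := abs_pos.2 ht
    rw [← mul_assoc, ← Real.rpow_add h]
    simp

theorem mul_abs_rpow_mul_self (hq : 0 < q) (t : ℝ) : t * (|t| ^ (q - 2) * t) = |t| ^ q := by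
  by_cases ht : t = 0
  · simp [ht, Real.zero_rpow hq.ne']
  · have h : 0 < |t| := abs_pos.2 ht
    have : t * (|t| ^ (q - 2) * t) = |t| ^ (q - 2) * |t| ^ (2 : ℝ) := by
      rw [Real.rpow_two, sq_abs]; ring
    rw [this, ← Real.rpow_add h]
    ring_nf

/-- Completing the square along the unit sphere of the `ℓ^q` norm. -/
theorem sum_abs_rpow_mul_sq {θ : Fin n → ℝ} (hq : 0 < q) (hθ : lqNorm q θ = 1) (a : Fin n → ℝ)
    (α r : ℝ) :
    ∑ i, |θ i| ^ (2 - q) * (α * lqNormal q θ i +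
      r * (a i - lqNormal q θ i * ∑ j, θ j * a j)) ^ 2 =
        α ^ 2 + r ^ 2 * (∑ i, |θ i| ^ (2 - q) * a i ^ 2 - (∑ j, θ j * a j) ^ 2) := by
  set E := ∑ j, θ j * a j with hE
  have hS : ∑ i, |θ i| ^ q = 1 := by rw [← lqNorm_rpow hq, hθ, Real.one_rpow]
  -- With weights |θ i|^(2-q) the normal has length 1, and its weighted product with a is E, so a -
  -- E · normal is orthogonal to it. Here the square is grouped by powers of α - r E.
  have e : ∀ i, |θ i| ^ (2 - q) * (α * lqNormal q θ i + r * (a i - lqNormal q θ i * E)) ^ 2 =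
      (α - r * E) ^ 2 * |θ i| ^ q + 2 * (α - r * E) * r * (θ i * a i) +
        r ^ 2 * (|θ i| ^ (2 - q) * a i ^ 2) := by
    intro i
    have h1 := abs_rpow_mul_abs_rpow (q := q) (θ i)
    have h2 := mul_abs_rpow_mul_self hq (θ i)
    rw [lqNormal, hθ, Real.one_rpow, one_mul]
    set b := |θ i| ^ (q - 2) * θ i
    linear_combination ((α - r * E) ^ 2 * b + 2 * (α - r * E) * r * a i) * h1 +
      (α - r * E) ^ 2 * h2
  simp_rw [e, Finset.sum_add_distrib, ← Finset.mul_sum, hS, ← hE]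
  ring

end LqNormCalculus

section PairVarBasic

variable {α : Type*} [MeasurableSpace α] {μ : Measure α}

theorem pairVar_const_mul (c : ℝ) (f : α → ℝ) :
    pairVar μ (fun x => c * f x) = ENNReal.ofReal (c ^ 2) * pairVar μ f := by
  have e : ∀ x y, ENNReal.ofReal ((c * f x - c * f y) ^ 2) =
      ENNReal.ofReal (c ^ 2) * ENNReal.ofReal ((f x - f y) ^ 2) := fun x y => by
    rw [← ENNReal.ofReal_mul (sq_nonneg c)]; congr 1; ring
  unfold pairVar
  simp_rw [e, lintegral_const_mul' _ _ ENNReal.ofReal_ne_top]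
  rw [← mul_assoc, ← mul_assoc, mul_comm (2⁻¹ : ENNReal)]

theorem pairVar_sub_const (f : α → ℝ) (m : ℝ) : pairVar μ (fun x => f x - m) = pairVar μ f := by
  simp [pairVar]

theorem pairVar_congr_ae {f g : α → ℝ} (h : f =ᵐ[μ] g) : pairVar μ f = pairVar μ g := by
  unfold pairVar
  congr 1
  refine lintegral_congr_ae (h.mono fun x hx => ?_)
  refine lintegral_congr_ae (h.mono fun y hy => ?_)
  simp only [hx, hy]

end PairVarBasic

/-! ### Homogeneous extensions of functions on the sphere -/

section SphereInequality

variable {n : ℕ} {q : ℝ}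

theorem volume_absolutelyContinuous_evenMeasure {k : ℝ} (hk : 0 < k) :
    (volume : Measure ℝ) ≪ evenMeasure k q := by
  rw [evenMeasure_eq_withDensity]
  refine withDensity_absolutelyContinuous' (by fun_prop) (ae_of_all _ fun t => ?_)
  simp only [ne_eq, ENNReal.ofReal_eq_zero, not_le]
  positivity

theorem clm_apply_eq_sum (L : (Fin n → ℝ) →L[ℝ] ℝ) (x : Fin n → ℝ) :
    L x = ∑ j, x j * L (Pi.single j 1) := by
  conv_lhs => rw [← Finset.univ_sum_single x]
  rw [map_sum]
  refine Finset.sum_congr rfl fun j _ => ?_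
  have : Pi.single j (x j) = x j • (Pi.single j 1 : Fin n → ℝ) := by
    rw [← Pi.single_smul]; simp
  rw [this, map_smul, smul_eq_mul]

/-- The extension of the restriction of `f - m` to the sphere of radius `r` to a `γ`-homogeneous
function. -/
noncomputable def homogExt (q γ r m : ℝ) (f : (Fin n → ℝ) → ℝ) (x : Fin n → ℝ) : ℝ :=
  lqNorm q x ^ γ * (f ((r / lqNorm q x) • x) - m)

/-- The partial derivatives of `homogExt`. -/
noncomputable def homogExtDeriv (q γ r m : ℝ) (f : (Fin n → ℝ) → ℝ) (i : Fin n) (x : Fin n → ℝ) :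
    ℝ :=
  lqNorm q x ^ (γ - 1) * (γ * (f ((r / lqNorm q x) • x) - m) * lqNormal q x i +
    r * (fderiv ℝ f ((r / lqNorm q x) • x) (Pi.single i 1) - lqNormal q x i *
      ∑ j, x j / lqNorm q x * fderiv ℝ f ((r / lqNorm q x) • x) (Pi.single j 1)))

theorem hasDerivAt_homogExt {γ r m : ℝ} {f : (Fin n → ℝ) → ℝ} (hq : 1 < q) (x : Fin n → ℝ)
    (i : Fin n) (t : ℝ) (hx : Function.update x i t ≠ 0)
    (hf : DifferentiableAt ℝ f ((r / lqNorm q (Function.update x i t)) • Function.update x i t)) :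
    HasDerivAt (fun t => homogExt q γ r m f (Function.update x i t))
      (homogExtDeriv q γ r m f i (Function.update x i t)) t := by
  have hN := lqNorm_pos_of_ne_zero (q := q) hx
  have hc := hasDerivAt_update (𝕜 := ℝ) x i t
  have hNd : HasDerivAt (fun t => lqNorm q (Function.update x i t))
      (lqNormal q (Function.update x i t) i) t := by
    refine ((hasFDerivAt_lqNorm hq hx).comp_hasDerivAt t hc).congr_deriv ?_
    simp [Pi.single_apply]
  have hy := ((hasDerivAt_const t r).fun_div hNd hN.ne').fun_smul hc
  have hfy := hf.hasFDerivAt.comp_hasDerivAt t hy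
  refine ((hNd.rpow_const (p := γ) (Or.inl hN.ne')).fun_mul (hfy.sub_const m)).congr_deriv ?_
  simp only [Function.comp, homogExtDeriv]
  set c := Function.update x i t
  set N := lqNorm q c
  set L := fderiv ℝ f ((r / N) • c)
  have hpow : N ^ γ = N ^ (γ - 1) * N := by
    rw [← Real.rpow_add_one hN.ne']; ring_nf
  have hsum : ∑ j, c j / N * L (Pi.single j 1) = L c / N := by
    rw [clm_apply_eq_sum L c, Finset.sum_div]
    exact Finset.sum_congr rfl fun j _ => by ring
  rw [hsum, hpow, map_add, map_smul, map_smul]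
  simp only [smul_eq_mul]
  field_simp
  ring

theorem locallyLipschitz_homogExt {γ r m : ℝ} {f : (Fin n → ℝ) → ℝ} (hq : 1 < q)
    (hf : LocallyLipschitz f) (x : Fin n → ℝ) (i : Fin n) (hx : ∀ t, Function.update x i t ≠ 0) :
    LocallyLipschitz fun t => homogExt q γ r m f (Function.update x i t) := by
  have hc : ContDiff ℝ 1 (Function.update x i) := contDiff_update 1 x i
  have hN : ContDiff ℝ 1 fun t => lqNorm q (Function.update x i t) :=
    contDiff_iff_contDiffAt.2 fun t =>
      (contDiffAt_lqNorm hq (hx t)).comp t hc.contDiffAt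
  have hN0 : ∀ t, lqNorm q (Function.update x i t) ≠ 0 := fun t =>
    (lqNorm_pos_of_ne_zero (hx t)).ne'
  have h1 : ContDiff ℝ 1 fun t => lqNorm q (Function.update x i t) ^ γ :=
    hN.rpow_const_of_ne hN0
  have h2 : ContDiff ℝ 1 fun t =>
      (r / lqNorm q (Function.update x i t)) • Function.update x i t :=
    (contDiff_const.div hN hN0).smul hc
  have h3 : LocallyLipschitz fun z : ℝ => z - m :=
    ContDiff.locallyLipschitz (𝕂 := ℝ) (by fun_prop)
  exact h1.locallyLipschitz.real_mul (h3.comp (hf.comp h2.locallyLipschitz))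

theorem measurable_fderiv_single {f : (Fin n → ℝ) → ℝ} (i : Fin n) :
    Measurable fun x => fderiv ℝ f x (Pi.single i 1) :=
  measurable_fderiv_apply_const ℝ f _

theorem measurable_homogExt {γ r m : ℝ} {f : (Fin n → ℝ) → ℝ} (hq : 0 < q) (hf : Measurable f) :
    Measurable (homogExt q γ r m f) := by
  have hN : Measurable (lqNorm q : (Fin n → ℝ) → ℝ) := (continuous_lqNorm hq).measurable
  have hy : Measurable fun x : Fin n → ℝ => (r / lqNorm q x) • x := by fun_prop
  have := hf.comp hy
  exact (hN.pow_const γ).mul (this.sub_const m)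

theorem measurable_homogExtDeriv {γ r m : ℝ} {f : (Fin n → ℝ) → ℝ} (hq : 0 < q)
    (hf : Measurable f) (i : Fin n) : Measurable (homogExtDeriv q γ r m f i) := by
  have hN : Measurable (lqNorm q : (Fin n → ℝ) → ℝ) := (continuous_lqNorm hq).measurable
  have hy : Measurable fun x : Fin n → ℝ => (r / lqNorm q x) • x := by fun_prop
  have h1 := hf.comp hy
  have h2 : ∀ j, Measurable fun x : Fin n → ℝ =>
      fderiv ℝ f ((r / lqNorm q x) • x) (Pi.single j 1) := fun j =>
    (measurable_fderiv_single j).comp hy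
  have h3 := measurable_lqNormal (n := n) hq i
  refine (hN.pow_const _).mul ((((h1.sub_const m).const_mul γ).mul h3).add
    (((h2 i).sub (h3.mul ?_)).const_mul r))
  refine Finset.measurable_fun_sum _ fun j _ => ?_
  exact ((measurable_pi_apply j).div hN).mul (h2 j)

theorem IsPolar.ae_norm_le {K : ℝ} {σ : Measure (Fin n → ℝ)} (h : IsPolar n q K σ) (hq : 0 < q) :
    ∀ᵐ θ ∂σ, ‖θ‖ ≤ 1 := by
  refine h.norm_eq.mono fun θ hθ => (pi_norm_le_iff_of_nonneg zero_le_one).2 fun i => ?_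
  have h1 : |θ i| ^ q ≤ 1 := by
    have := lqNorm_rpow hq θ
    rw [hθ, Real.one_rpow] at this
    rw [this]
    exact Finset.single_le_sum (f := fun i => |θ i| ^ q) (fun _ _ => by positivity)
      (Finset.mem_univ i)
  rw [Real.norm_eq_abs]
  by_contra hc
  exact absurd h1 (not_le.2 (Real.one_lt_rpow (not_le.1 hc) hq))

theorem exists_abs_le_of_norm_le {f : (Fin n → ℝ) → ℝ} (hf : Continuous f) (R : ℝ) :
    ∃ B, ∀ x, ‖x‖ ≤ R → |f x| ≤ B := by
  obtain ⟨B, hB⟩ := (isCompact_closedBall (0 : Fin n → ℝ) R).exists_bound_of_continuousOn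
    hf.continuousOn
  exact ⟨B, fun x hx => hB x (by simpa using hx)⟩

theorem IsPolar.memLp {K : ℝ} {σ : Measure (Fin n → ℝ)} (h : IsPolar n q K σ) (hq : 0 < q)
    {f : (Fin n → ℝ) → ℝ} (hf : Continuous f) (r : ℝ) (s : ENNReal) :
    MemLp (fun θ => f (r • θ)) s σ := by
  have := h.prob
  obtain ⟨B, hB⟩ := exists_abs_le_of_norm_le hf |r|
  refine MemLp.of_bound (by fun_prop) B ((h.ae_norm_le hq).mono fun θ hθ => ?_)
  refine hB _ ?_
  rw [norm_smul, Real.norm_eq_abs]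
  nlinarith [abs_nonneg r]

/-- The radial derivative of `f` at `r • θ`. -/
noncomputable def radialDeriv (f : (Fin n → ℝ) → ℝ) (r : ℝ) (θ : Fin n → ℝ) : ℝ :=
  ∑ j, θ j * fderiv ℝ f (r • θ) (Pi.single j 1)

/-- The weighted square of the tangential part of the gradient of `f` at `r • θ`. -/
noncomputable def tangentialSq (q : ℝ) (f : (Fin n → ℝ) → ℝ) (r : ℝ) (θ : Fin n → ℝ) : ℝ :=
  ∑ i, |θ i| ^ (2 - q) * fderiv ℝ f (r • θ) (Pi.single i 1) ^ 2 - radialDeriv f r θ ^ 2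

theorem tangentialSq_nonneg (hq : 0 < q) {θ : Fin n → ℝ} (hθ : lqNorm q θ = 1)
    (f : (Fin n → ℝ) → ℝ) (r : ℝ) : 0 ≤ tangentialSq q f r θ := by
  have h := sum_abs_rpow_mul_sq hq hθ (fun i => fderiv ℝ f (r • θ) (Pi.single i 1)) 0 1
  have h2 : 0 ≤ (0 : ℝ) ^ 2 + 1 ^ 2 * tangentialSq q f r θ := by
    rw [tangentialSq, radialDeriv, ← h]
    exact Finset.sum_nonneg fun i _ => by positivity
  linarith

theorem measurable_radialDeriv (f : (Fin n → ℝ) → ℝ) :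
    Measurable fun z : ℝ × (Fin n → ℝ) => radialDeriv f z.1 z.2 := by
  have hs : Measurable fun z : ℝ × (Fin n → ℝ) => z.1 • z.2 := by fun_prop
  refine Finset.measurable_fun_sum _ fun j _ => ?_
  have := (measurable_fderiv_single (f := f) j).comp hs
  exact ((measurable_pi_apply j).comp measurable_snd).mul this

theorem measurable_tangentialSq (f : (Fin n → ℝ) → ℝ) :
    Measurable fun z : ℝ × (Fin n → ℝ) => tangentialSq q f z.1 z.2 := by
  have hs : Measurable fun z : ℝ × (Fin n → ℝ) => z.1 • z.2 := by fun_prop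
  refine Measurable.sub (Finset.measurable_fun_sum _ fun j _ => ?_)
    ((measurable_radialDeriv f).pow_const 2)
  have := (measurable_fderiv_single (f := f) j).comp hs
  have h2 : Measurable fun z : ℝ × (Fin n → ℝ) => |z.2 j| ^ (2 - q) := by fun_prop
  exact h2.mul (this.pow_const 2)

theorem homogExt_smul {γ r m R : ℝ} {f : (Fin n → ℝ) → ℝ} (hq : 0 < q) (hR : 0 < R)
    {θ : Fin n → ℝ} (hθ : lqNorm q θ = 1) :
    homogExt q γ r m f (R • θ) = R ^ γ * (f (r • θ) - m) := by
  rw [homogExt, lqNorm_smul hq hR.le, hθ, mul_one, smul_smul, div_mul_cancel₀ _ hR.ne']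

/-- The radial derivative of the extension is γ times its value divided by R, and the tangential
derivatives are those of f at r • θ. Orthogonality of the two parts separates the energy,
homogeneity factors out R. -/
theorem sum_homogExtDeriv_smul {γ r m R : ℝ} {f : (Fin n → ℝ) → ℝ} (hq : 0 < q) (hR : 0 < R)
    {θ : Fin n → ℝ} (hθ : lqNorm q θ = 1) :
    ∑ i, |(R • θ) i| ^ (2 - q) * homogExtDeriv q γ r m f i (R • θ) ^ 2 =
      R ^ (2 * γ - q) * (γ ^ 2 * (f (r • θ) - m) ^ 2 + r ^ 2 * tangentialSq q f r θ) := by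
  have h := sum_abs_rpow_mul_sq hq hθ (fun i => fderiv ℝ f (r • θ) (Pi.single i 1))
    (γ * (f (r • θ) - m)) r
  rw [← mul_pow, tangentialSq, radialDeriv, ← h, Finset.mul_sum]
  refine Finset.sum_congr rfl fun i _ => ?_
  have e1 : ∀ j, (R • θ) j / R = θ j := fun j => by
    rw [Pi.smul_apply, smul_eq_mul, mul_div_cancel_left₀ _ hR.ne']
  rw [homogExtDeriv, lqNorm_smul hq hR.le, hθ, mul_one, smul_smul, div_mul_cancel₀ _ hR.ne',
    lqNormal_smul hq hR]
  simp_rw [e1]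
  rw [Pi.smul_apply, smul_eq_mul, abs_mul, abs_of_pos hR, Real.mul_rpow hR.le (abs_nonneg _),
    mul_pow (R ^ (γ - 1))]
  have e2 : R ^ (2 * γ - q) = R ^ (2 - q) * (R ^ (γ - 1)) ^ 2 := by
    rw [← Real.rpow_natCast, ← Real.rpow_mul hR.le, ← Real.rpow_add hR]
    congr 1; push_cast; ring
  rw [e2]; ring

end SphereInequality

/-! ### The Poincaré inequality on the ℓ^q sphere -/

section SphereInequality

variable {n : ℕ} {q : ℝ}

/-- Points where the radial projection to the sphere of radius r meets a point of differentiability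
of f have full measure, hence so does their trace on almost every line. With n ≥ 2, almost every
line parallel to an axis also avoids the origin, the one point where the extension may fail to be
locally Lipschitz. -/
theorem ae_isPrimitive_homogExt {k γ r m K : ℝ} {σ : Measure (Fin n → ℝ)} (h : IsPolar n q K σ)
    (hn : 2 ≤ n) (hq : 1 < q) (hk : 0 < k) [IsProbabilityMeasure (evenMeasure k q)]
    {f : (Fin n → ℝ) → ℝ} (hf : LocallyLipschitz f)
    (hd : ∀ᵐ θ ∂σ, DifferentiableAt ℝ f (r • θ)) (i : Fin n) :
    ∀ᵐ x ∂Measure.pi fun _ : Fin n => evenMeasure k q,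
      IsPrimitive (fun t => homogExt q γ r m f (Function.update x i t))
        (fun t => homogExtDeriv q γ r m f i (Function.update x i t)) := by
  have hq0 : 0 < q := by linarith
  have := h.prob
  obtain ⟨hρ, hmp⟩ := h.measurePreserving (p := q) hq0 (pi_evenMeasure_eq_withDensity hk.le hq0)
  have hN : Measurable (lqNorm q : (Fin n → ℝ) → ℝ) := (continuous_lqNorm hq0).measurable
  have hy : Measurable fun x : Fin n → ℝ => (r / lqNorm q x) • x := by fun_prop
  set D := {x : Fin n → ℝ | DifferentiableAt ℝ f ((r / lqNorm q x) • x)} with hD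
  have hDm : MeasurableSet D := hy (measurableSet_of_differentiableAt ℝ f)
  have h1 : ∀ᵐ x ∂Measure.pi fun _ : Fin n => evenMeasure k q, x ∈ D := by
    rw [← hmp.map_eq, 
      ae_map_iff (p := fun x => x ∈ D) hmp.measurable.aemeasurable hDm]
    have hDm' : MeasurableSet {z : ℝ × (Fin n → ℝ) | z.1 • z.2 ∈ D} := hmp.measurable hDm
    rw [Measure.ae_prod_iff_ae_ae hDm']
    filter_upwards [ae_pos_radialMeasure (K * k ^ n) n q] with R hR
    filter_upwards [hd, h.norm_eq] with θ hθ hθ1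
    rw [hD, mem_ofPred_eq, lqNorm_smul hq0 (le_of_lt hR), hθ1, mul_one, smul_smul,
      div_mul_cancel₀ _ (ne_of_gt hR)]
    exact hθ
  have h2 : ∀ᵐ x ∂Measure.pi fun _ : Fin n => evenMeasure k q,
      ∀ᵐ t ∂evenMeasure k q, Function.update x i t ∈ D := by
    have hmu := measurePreserving_update (ν := evenMeasure k q) i
    exact Measure.ae_ae_of_ae_prod (hmu.quasiMeasurePreserving.ae h1)
  have : Nontrivial (Fin n) := Fin.nontrivial_iff_two_le.2 hn
  obtain ⟨j, hj⟩ := exists_ne i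
  have hac : (Measure.pi fun _ : Fin n => evenMeasure k q) ≪ volume := by
    rw [pi_evenMeasure_eq_withDensity hk.le hq0]
    exact withDensity_absolutelyContinuous _ _
  have h3 : ∀ᵐ x ∂Measure.pi fun _ : Fin n => evenMeasure k q, x j ≠ 0 := by
    have h0 : ∀ᵐ x : Fin n → ℝ, x j ≠ 0 := by
      rw [ae_iff, volume_pi]
      simpa using Measure.pi_hyperplane (fun _ : Fin n => (volume : Measure ℝ)) j 0
    exact hac.ae_le h0
  filter_upwards [h2, h3] with x hx hxj
  have hne : ∀ t, Function.update x i t ≠ 0 := fun t h0 => hxj (by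
    have := congrFun h0 j
    rwa [Function.update_of_ne hj] at this)
  refine (locallyLipschitz_homogExt hq hf x i hne).isPrimitive ?_
  have hx' : ∀ᵐ t : ℝ, Function.update x i t ∈ D :=
    (volume_absolutelyContinuous_evenMeasure hk).ae_le hx
  exact hx'.mono fun t ht => hasDerivAt_homogExt hq x i t (hne t) ht

/-- Total variance over the radius, with the nonnegative term between different radii dropped. -/
theorem le_pairVar_homogExt {K γ r m M : ℝ} {σ : Measure (Fin n → ℝ)} (h : IsPolar n q K σ)
    (hq : 0 < q) {ρ : Measure ℝ} [IsProbabilityMeasure ρ] {ν : Measure (Fin n → ℝ)} [SFinite ν]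
    (hmp : MeasurePreserving (fun z : ℝ × (Fin n → ℝ) => z.1 • z.2) (ρ.prod σ) ν)
    (hpos : ∀ᵐ R ∂ρ, 0 < R) {f : (Fin n → ℝ) → ℝ} (hf : Continuous f)
    (hM : ∫⁻ R, ENNReal.ofReal (R ^ (2 * γ)) ∂ρ = ENNReal.ofReal M) :
    ENNReal.ofReal M * pairVar σ (fun θ => f (r • θ) - m) ≤ pairVar ν (homogExt q γ r m f) := by
  have := h.prob
  have hFm : Measurable (homogExt q γ r m f) := measurable_homogExt hq hf.measurable
  have hgL : MemLp (fun θ => f (r • θ) - m) 2 σ := (h.memLp hq hf r 2).sub (memLp_const m)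
  rw [← pairVar_comp hmp hFm]
  have hsl : ∀ᵐ R ∂ρ, (fun θ => homogExt q γ r m f (R • θ)) =ᵐ[σ]
      fun θ => R ^ γ * (f (r • θ) - m) := by
    filter_upwards [hpos] with R hR
    filter_upwards [h.norm_eq] with θ hθ
    exact homogExt_smul hq hR hθ
  rw [pairVar_prod (f := fun z : ℝ × (Fin n → ℝ) => homogExt q γ r m f (z.1 • z.2))
    (hFm.comp hmp.measurable) (hsl.mono fun R hR => (memLp_congr_ae hR).2 (hgL.const_mul _))]
  refine le_trans (le_of_eq ?_) le_self_add
  have e : ∀ᵐ R ∂ρ, (pairVar σ fun θ => homogExt q γ r m f (R • θ)) =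
      ENNReal.ofReal (R ^ (2 * γ)) * pairVar σ (fun θ => f (r • θ) - m) := by
    filter_upwards [hsl, hpos] with R hR hR0
    rw [pairVar_congr_ae hR, pairVar_const_mul, ← Real.rpow_natCast, ← Real.rpow_mul (le_of_lt hR0)]
    congr 3
    push_cast; ring
  rw [lintegral_congr_ae e, lintegral_mul_const _ (by fun_prop), hM]

theorem sum_ofReal_homogExtDeriv_smul {γ r m R : ℝ} {f : (Fin n → ℝ) → ℝ} (hq : 0 < q) (hR : 0 < R)
    {θ : Fin n → ℝ} (hθ : lqNorm q θ = 1) :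
    ∑ i, ENNReal.ofReal (|(R • θ) i| ^ (2 - q) * homogExtDeriv q γ r m f i (R • θ) ^ 2) =
      ENNReal.ofReal (R ^ (2 * γ - q)) * (ENNReal.ofReal (γ ^ 2) *
        ENNReal.ofReal ((f (r • θ) - m) ^ 2) +
          ENNReal.ofReal (r ^ 2 * tangentialSq q f r θ)) := by
  have h0 : 0 ≤ r ^ 2 * tangentialSq q f r θ :=
    mul_nonneg (sq_nonneg _) (tangentialSq_nonneg hq hθ f r)
  rw [← ENNReal.ofReal_mul (sq_nonneg γ), ← ENNReal.ofReal_add (by positivity) h0,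
    ← ENNReal.ofReal_mul (by positivity), ← sum_homogExtDeriv_smul hq hR hθ]
  refine (ENNReal.ofReal_sum_of_nonneg fun i _ => ?_).symm
  exact mul_nonneg (Real.rpow_nonneg (abs_nonneg _) _) (sq_nonneg _)

theorem measurable_tangentialSq_right (f : (Fin n → ℝ) → ℝ) (r : ℝ) :
    Measurable fun θ => tangentialSq q f r θ := by
  have h1 : Measurable fun θ : Fin n → ℝ => (r, θ) := measurable_prodMk_left
  have h2 := (measurable_tangentialSq (q := q) f).comp h1
  simpa only [Function.comp_def] using h2

theorem sum_lintegral_homogExtDeriv {K γ r m M : ℝ} {σ : Measure (Fin n → ℝ)}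
    (h : IsPolar n q K σ) (hq : 0 < q) {ρ : Measure ℝ} [IsProbabilityMeasure ρ]
    {ν : Measure (Fin n → ℝ)}
    (hmp : MeasurePreserving (fun z : ℝ × (Fin n → ℝ) => z.1 • z.2) (ρ.prod σ) ν)
    (hpos : ∀ᵐ R ∂ρ, 0 < R) {f : (Fin n → ℝ) → ℝ} (hf : Measurable f)
    (hM : ∫⁻ R, ENNReal.ofReal (R ^ (2 * γ - q)) ∂ρ = ENNReal.ofReal M) :
    ∑ i, ∫⁻ x, ENNReal.ofReal (|x i| ^ (2 - q) * homogExtDeriv q γ r m f i x ^ 2) ∂ν =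
      ENNReal.ofReal M * (ENNReal.ofReal (γ ^ 2) *
        ∫⁻ θ, ENNReal.ofReal ((f (r • θ) - m) ^ 2) ∂σ +
        ∫⁻ θ, ENNReal.ofReal (r ^ 2 * tangentialSq q f r θ) ∂σ) := by
  have := h.prob
  have hGm : ∀ i, Measurable (homogExtDeriv q γ r m f i) := measurable_homogExtDeriv hq hf
  have hgm : Measurable fun θ => f (r • θ) - m := by
    have : Measurable fun θ : Fin n → ℝ => r • θ := by fun_prop
    exact (hf.comp this).sub_const m
  have hmi : ∀ i, Measurable fun x : Fin n → ℝ =>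
      ENNReal.ofReal (|x i| ^ (2 - q) * homogExtDeriv q γ r m f i x ^ 2) := fun i => by
    have := hGm i
    fun_prop
  rw [← lintegral_finsetSum _ fun i _ => hmi i]
  have hms : Measurable fun x : Fin n → ℝ => ∑ i,
      ENNReal.ofReal (|x i| ^ (2 - q) * homogExtDeriv q γ r m f i x ^ 2) :=
    Finset.measurable_fun_sum _ fun i _ => hmi i
  have hTm : Measurable fun θ : Fin n → ℝ => tangentialSq q f r θ :=
    measurable_tangentialSq_right f r
  have hgm2 : Measurable fun θ => ENNReal.ofReal (γ ^ 2) *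
      ENNReal.ofReal ((f (r • θ) - m) ^ 2) := ((hgm.pow_const 2).ennreal_ofReal).const_mul _
  have hTm2 : Measurable fun θ : Fin n → ℝ => ENNReal.ofReal (r ^ 2 * tangentialSq q f r θ) :=
    (hTm.const_mul _).ennreal_ofReal
  have hRm : Measurable fun R : ℝ => ENNReal.ofReal (R ^ (2 * γ - q)) := by fun_prop
  rw [← hM, ← lintegral_const_mul' _ _ ENNReal.ofReal_ne_top, ← lintegral_add_left hgm2,
    ← lintegral_prod_mul (g := fun θ => ENNReal.ofReal (γ ^ 2) *
      ENNReal.ofReal ((f (r • θ) - m) ^ 2) + ENNReal.ofReal (r ^ 2 * tangentialSq q f r θ))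
      hRm.aemeasurable (hgm2.add hTm2).aemeasurable, ← hmp.lintegral_comp hms]
  refine lintegral_congr_ae ?_
  have a1 : ∀ᵐ z ∂ρ.prod σ, 0 < z.1 := Measure.quasiMeasurePreserving_fst.ae hpos
  have a2 : ∀ᵐ z ∂ρ.prod σ, lqNorm q z.2 = 1 := Measure.quasiMeasurePreserving_snd.ae h.norm_eq
  filter_upwards [a1, a2] with z hz1 hz2
  exact sum_ofReal_homogExtDeriv_smul hq hz1 hz2

/-- A weighted Poincaré inequality for even functions on the unit sphere of the `ℓ^q` norm. -/
theorem pairVar_sphere_le {K c γ r : ℝ} {σ : Measure (Fin n → ℝ)} (h : IsPolar n q K σ)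
    (hn : 2 ≤ n) (hq : 1 < q) (hc1 : 1 - 1 / q ≤ c) (hc2 : 1 / 2 ≤ c) (hγ : γ * c = q - 1)
    (hγn : 0 < 2 * γ - q + n) {f : (Fin n → ℝ) → ℝ} (hf : LocallyLipschitz f)
    (heven : ∀ x, f (-x) = f x) (hd : ∀ᵐ θ ∂σ, DifferentiableAt ℝ f (r • θ)) :
    ENNReal.ofReal (γ * (γ - q + n)) * pairVar σ (fun θ => f (r • θ)) ≤
      ∫⁻ θ, ENNReal.ofReal (r ^ 2 * tangentialSq q f r θ) ∂σ := by
  have hq0 : 0 < q := by linarith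
  have hc0 : 0 < c := by linarith
  have hγ0 : 0 < γ := by
    by_contra hcon
    nlinarith
  have := h.prob
  obtain ⟨k, hk, hprob⟩ := exists_isProbabilityMeasure_evenMeasure hq0
  obtain ⟨hρ, hmp⟩ := h.measurePreserving (p := q) hq0 (pi_evenMeasure_eq_withDensity hk.le hq0)
  set ρ := radialMeasure (K * k ^ n) n q with hρdef
  have hKk : 0 ≤ K * k ^ n := mul_nonneg h.nonneg (by positivity)
  set m := ∫ θ, f (r • θ) ∂σ with hm
  have hfm : Measurable f := hf.continuous.measurable
  have hFe : ∀ x, homogExt q γ r m f (-x) = homogExt q γ r m f x := fun x => by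
    simp only [homogExt, lqNorm_neg, smul_neg, heven]
  have hn0 : (0 : ℝ) < n := by
    have : 0 < n := by omega
    exact_mod_cast this
  obtain ⟨M, hM, hM1, hM2⟩ := exists_radial_moment (k := K * k ^ n) (d := n) (p := q)
    (a := 2 * γ - q) hKk hn0 hq0 hγn
  rw [sub_add_cancel] at hM2
  have hpos := ae_pos_radialMeasure (K * k ^ n) n q
  have key := pairVar_pi_evenMeasure_le hk.le hq (measurable_homogExt hq0 hfm)
    (measurable_homogExtDeriv hq0 hfm) hFe
    (fun i => ae_isPrimitive_homogExt h hn hq hk hf hd i) hc1 hc2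
  have hlow := le_pairVar_homogExt (m := m) (r := r) h hq0 hmp hpos hf.continuous hM2
  have hup := sum_lintegral_homogExtDeriv (m := m) (r := r) h hq0 hmp hpos hfm hM1
  have hgL : MemLp (fun θ => f (r • θ) - m) 2 σ :=
    (h.memLp hq0 hf.continuous r 2).sub (memLp_const m)
  have hV : pairVar σ (fun θ => f (r • θ) - m) = pairVar σ fun θ => f (r • θ) :=
    pairVar_sub_const _ _
  -- Subtracting the mean m turns the zeroth-order term of the energy into the variance, so that it
  -- can be absorbed on the left.
  have hg2 : ∫⁻ θ, ENNReal.ofReal ((f (r • θ) - m) ^ 2) ∂σ = pairVar σ fun θ => f (r • θ) - m := by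
    have hint := (h.memLp hq0 hf.continuous r 2).integrable one_le_two
    rw [lintegral_sq_eq_pairVar_add hgL, integral_sub hint (integrable_const m)]
    simp [hm]
  have hVt : pairVar σ (fun θ => f (r • θ) - m) ≠ ⊤ := by
    rw [pairVar_eq_ofReal hgL]; exact ENNReal.ofReal_ne_top
  rw [← hV]
  have hfin := hlow.trans key
  rw [hup, hg2] at hfin
  generalize ∫⁻ θ, ENNReal.ofReal (r ^ 2 * tangentialSq q f r θ) ∂σ = T at hfin ⊢
  by_cases hT : T = ⊤
  · rw [hT]; exact le_top
  generalize pairVar σ (fun θ => f (r • θ) - m) = V at hfin hVt ⊢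
  obtain ⟨v, hv0, rfl⟩ : ∃ v : ℝ, 0 ≤ v ∧ V = ENNReal.ofReal v :=
    ⟨V.toReal, ENNReal.toReal_nonneg, (ENNReal.ofReal_toReal hVt).symm⟩
  obtain ⟨τ, hτ0, rfl⟩ : ∃ τ : ℝ, 0 ≤ τ ∧ T = ENNReal.ofReal τ :=
    ⟨T.toReal, ENNReal.toReal_nonneg, (ENNReal.ofReal_toReal hT).symm⟩
  have hcq : 0 ≤ c / (q - 1) := div_nonneg hc0.le (by linarith)
  rw [← ENNReal.ofReal_mul (by positivity), ← ENNReal.ofReal_mul (by positivity),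
    ← ENNReal.ofReal_add (by positivity) hτ0, ← ENNReal.ofReal_mul hM.le,
    ← ENNReal.ofReal_mul hcq, ENNReal.ofReal_le_ofReal_iff (by positivity)] at hfin
  rw [← ENNReal.ofReal_mul' hv0]
  refine ENNReal.ofReal_le_ofReal ?_
  -- With the moment recursion, the inequality reads (2γ - q + n) V ≤ c/(q-1) (γ² V + τ). The choice
  -- γ = (q-1)/c maximises the resulting coefficient (2γ - q + n)(q-1)/c - γ² of V.
  have hcγ : c / (q - 1) = 1 / γ := by
    rw [← hγ]; field_simp
  rw [hcγ] at hfin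
  have h1 : (2 * γ - q + n) * v * γ ≤ γ ^ 2 * v + τ := by
    have : 1 / γ * (M * (γ ^ 2 * v + τ)) * γ = M * (γ ^ 2 * v + τ) := by field_simp
    have h2 := mul_le_mul_of_nonneg_right hfin hγ0.le
    rw [this] at h2
    refine le_of_mul_le_mul_left ?_ hM
    linarith
  linarith

end SphereInequality

/-! ### Radial derivatives and spherical means -/

section Rays

variable {n : ℕ} {q K C p : ℝ} {σ : Measure (Fin n → ℝ)} {f : (Fin n → ℝ) → ℝ}

theorem ofReal_abs_le_of_eq_intervalIntegral {a s t : ℝ} {ψ : ℝ → ℝ} (hst : s ≤ t)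
    (hψ : IntervalIntegrable ψ volume s t) (ha : a = ∫ u in s..t, ψ u) :
    ENNReal.ofReal |a| ≤ ∫⁻ u in Ioc s t, ENNReal.ofReal |ψ u| := by
  have h1 := (intervalIntegrable_iff_integrableOn_Ioc_of_le hst).1 hψ
  rw [ha, intervalIntegral.integral_of_le hst, ← ofReal_integral_eq_lintegral_ofReal h1.abs
    (ae_of_all _ fun _ => abs_nonneg _)]
  exact ENNReal.ofReal_le_ofReal abs_integral_le_integral_abs

theorem pos_of_isProbabilityMeasure_radialMeasure {k d p : ℝ} (hk : 0 ≤ k)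
    [hρ : IsProbabilityMeasure (radialMeasure k d p)] : 0 < k := by
  rcases hk.eq_or_lt with h | h
  · have h1 : radialMeasure k d p univ = 1 := measure_univ
    rw [← h] at h1
    simp [radialMeasure] at h1
  · exact h

theorem ae_of_ae_radialMeasure {k d p : ℝ} (hk : 0 < k) {P : ℝ → Prop}
    (h : ∀ᵐ r ∂radialMeasure k d p, P r) : ∀ᵐ r, 0 < r → P r := by
  have hac : (volume.restrict (Ioi (0 : ℝ))) ≪ radialMeasure k d p := by
    refine withDensity_absolutelyContinuous' (measurable_radialDensity k d p).aemeasurable ?_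
    refine (ae_restrict_mem measurableSet_Ioi).mono fun r hr => ?_
    have hr0 : (0 : ℝ) < r := hr
    simp only [ne_eq, ENNReal.ofReal_eq_zero, not_le]
    positivity
  have h2 : ∀ᵐ r ∂volume.restrict (Ioi (0 : ℝ)), P r := hac.ae_le h
  exact (ae_restrict_iff' measurableSet_Ioi).1 h2

theorem hasDerivAt_ray {r : ℝ} {θ : Fin n → ℝ} (hf : DifferentiableAt ℝ f (r • θ)) :
    HasDerivAt (fun t : ℝ => f (t • θ)) (radialDeriv f r θ) r := by
  have h1 : HasDerivAt (fun t : ℝ => t • θ) ((1 : ℝ) • θ) r := (hasDerivAt_id r).smul_const θ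
  refine (hf.hasFDerivAt.comp_hasDerivAt r h1).congr_deriv ?_
  rw [one_smul, clm_apply_eq_sum, radialDeriv]

theorem radialDeriv_eq (r : ℝ) (θ : Fin n → ℝ) : radialDeriv f r θ = fderiv ℝ f (r • θ) θ := by
  rw [radialDeriv, clm_apply_eq_sum]

theorem locallyLipschitz_ray (hf : LocallyLipschitz f) (θ : Fin n → ℝ) :
    LocallyLipschitz fun t : ℝ => f (t • θ) :=
  hf.comp (ContDiff.locallyLipschitz (𝕂 := ℝ) (f := fun t : ℝ => t • θ) (by fun_prop))

theorem sub_eq_integral_radialDeriv (hf : LocallyLipschitz f) {θ : Fin n → ℝ}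
    (hθ : ∀ᵐ r : ℝ, 0 < r → DifferentiableAt ℝ f (r • θ)) {s t : ℝ} (hs : 0 < s) (hst : s ≤ t) :
    IntervalIntegrable (fun r => radialDeriv f r θ) volume s t ∧
      f (t • θ) - f (s • θ) = ∫ r in s..t, radialDeriv f r θ := by
  refine (locallyLipschitz_ray hf θ).sub_eq_integral (hθ.mono fun r hr hm => ?_)
  rw [uIoc_of_le hst] at hm
  exact hasDerivAt_ray (hr (hs.trans hm.1))

theorem exists_abs_radialDeriv_le (hf : LocallyLipschitz f) (R : ℝ) :
    ∃ B, 0 ≤ B ∧ ∀ r θ, |r| ≤ R → ‖θ‖ ≤ 1 → |radialDeriv f r θ| ≤ B := by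
  obtain ⟨B, hB0, hB⟩ := hf.exists_norm_fderiv_le (R + 1)
  refine ⟨B, hB0, fun r θ hr hθ => ?_⟩
  have h1 : ‖r • θ‖ < R + 1 := by
    rw [norm_smul, Real.norm_eq_abs]
    nlinarith [abs_nonneg r, norm_nonneg θ]
  rw [radialDeriv_eq]
  refine ((fderiv ℝ f (r • θ)).le_opNorm θ).trans ?_
  have := hB _ h1
  nlinarith [norm_nonneg θ, norm_nonneg (fderiv ℝ f (r • θ))]

theorem measurable_radialDeriv_left (f : (Fin n → ℝ) → ℝ) (θ : Fin n → ℝ) :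
    Measurable fun r => radialDeriv f r θ := by
  have h1 : Measurable fun r : ℝ => (r, θ) := by fun_prop
  have h2 := (measurable_radialDeriv f).comp h1
  simpa only [Function.comp_def] using h2

theorem measurable_radialDeriv_right (f : (Fin n → ℝ) → ℝ) (r : ℝ) :
    Measurable fun θ => radialDeriv f r θ := by
  have h1 : Measurable fun θ : Fin n → ℝ => (r, θ) := measurable_prodMk_left
  have h2 := (measurable_radialDeriv f).comp h1
  simpa only [Function.comp_def] using h2

theorem IsPolar.memLp_radialDeriv (h : IsPolar n q K σ) (hq : 0 < q) (hf : LocallyLipschitz f)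
    (r : ℝ) (s : ENNReal) : MemLp (fun θ => radialDeriv f r θ) s σ := by
  have := h.prob
  obtain ⟨B, -, hB⟩ := exists_abs_radialDeriv_le hf |r|
  exact MemLp.of_bound (measurable_radialDeriv_right f r).aestronglyMeasurable B
    ((h.ae_norm_le hq).mono fun θ hθ => hB r θ le_rfl hθ)

theorem measurable_smul_comp (hf : Measurable f) :
    Measurable fun z : ℝ × (Fin n → ℝ) => f (z.1 • z.2) := by
  have h1 : Measurable fun z : ℝ × (Fin n → ℝ) => z.1 • z.2 := by fun_prop
  exact hf.comp h1

/-- The spherical mean of `f` is a primitive of the spherical mean of its radial derivative. -/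
theorem IsPolar.integral_sub_eq (h : IsPolar n q K σ) (hq : 0 < q) (hf : LocallyLipschitz f)
    (hd : ∀ᵐ θ ∂σ, ∀ᵐ r : ℝ, 0 < r → DifferentiableAt ℝ f (r • θ)) {s t : ℝ} (hs : 0 < s)
    (hst : s ≤ t) :
    IntervalIntegrable (fun r => ∫ θ, radialDeriv f r θ ∂σ) volume s t ∧
      ∫ θ, f (t • θ) ∂σ - ∫ θ, f (s • θ) ∂σ = ∫ r in s..t, ∫ θ, radialDeriv f r θ ∂σ := by
  have := h.prob
  obtain ⟨B, hB0, hB⟩ := exists_abs_radialDeriv_le hf t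
  have hint : Integrable (Function.uncurry fun r θ => radialDeriv f r θ)
      ((volume.restrict (Ioc s t)).prod σ) := by
    refine Integrable.of_bound (measurable_radialDeriv f).aestronglyMeasurable B ?_
    have a1 : ∀ᵐ z ∂(volume.restrict (Ioc s t)).prod σ, z.1 ∈ Ioc s t :=
      Measure.quasiMeasurePreserving_fst.ae (ae_restrict_mem measurableSet_Ioc)
    have a2 : ∀ᵐ z ∂(volume.restrict (Ioc s t)).prod σ, ‖z.2‖ ≤ 1 :=
      Measure.quasiMeasurePreserving_snd.ae (h.ae_norm_le hq)
    filter_upwards [a1, a2] with z hz1 hz2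
    exact hB _ _ (by rw [abs_of_pos (hs.trans hz1.1)]; exact hz1.2) hz2
  refine ⟨(intervalIntegrable_iff_integrableOn_Ioc_of_le hst).2 hint.integral_prod_left, ?_⟩
  have hi : ∀ r : ℝ, Integrable (fun θ => f (r • θ)) σ := fun r =>
    memLp_one_iff_integrable.1 (h.memLp hq hf.continuous r 1)
  rw [← integral_sub (hi t) (hi s), intervalIntegral.integral_of_le hst,
    integral_integral_swap hint]
  refine integral_congr_ae (hd.mono fun θ hθ => ?_)
  simp only
  rw [(sub_eq_integral_radialDeriv hf hθ hs hst).2, intervalIntegral.integral_of_le hst]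

end Rays

/-! ### Radial estimate of the variance on spheres -/

section PolarDecomposition

variable {n : ℕ} {q K p : ℝ} {σ : Measure (Fin n → ℝ)} {f : (Fin n → ℝ) → ℝ}

theorem pairVar_eq_lintegral_prod {α : Type*} [MeasurableSpace α] {μ : Measure α} [SFinite μ]
    {u : α → ℝ} (hu : Measurable u) :
    pairVar μ u = 2⁻¹ * ∫⁻ z, ENNReal.ofReal ((u z.1 - u z.2) ^ 2) ∂(μ.prod μ) := by
  rw [lintegral_prod (f := fun z : α × α => ENNReal.ofReal ((u z.1 - u z.2) ^ 2)) (by fun_prop)]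
  rfl

/-- The ground state inequality with d = n, applied along r to f(rθ) - f(rθ') and then integrated
over pairs (θ, θ'). -/
theorem lintegral_pairVar_le {k : ℝ} (h : IsPolar n q K σ) (hk : 0 ≤ k) (hn : 1 ≤ n)
    (hp : 0 < p) (hf : LocallyLipschitz f)
    (hd : ∀ᵐ θ ∂σ, ∀ᵐ r : ℝ, 0 < r → DifferentiableAt ℝ f (r • θ)) :
    ∫⁻ r, pairVar σ (fun θ => f (r • θ)) ∂radialMeasure k n p ≤
      ∫⁻ r, ENNReal.ofReal (n * r ^ (-p)) * pairVar σ (fun θ => f (r • θ)) ∂radialMeasure k n p +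
      ENNReal.ofReal (1 / p) * ∫⁻ r, ENNReal.ofReal (r ^ (2 - p)) *
        pairVar σ (fun θ => radialDeriv f r θ) ∂radialMeasure k n p := by
  have := h.prob
  have hn0 : (0 : ℝ) < n := by exact_mod_cast hn
  have hfm := hf.continuous.measurable
  set ρ := radialMeasure k n p with hρ
  have hpos : ∀ᵐ r ∂ρ, 0 < r := ae_pos_radialMeasure k n p
  -- both sides as integrals over pairs of points of the sphere
  have swap : ∀ (w : ℝ → ℝ) (u : ℝ → (Fin n → ℝ) → ℝ), Measurable w →
      Measurable (fun z : ℝ × (Fin n → ℝ) => u z.1 z.2) → (∀ r, 0 < r → 0 ≤ w r) →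
      ∫⁻ r, ENNReal.ofReal (w r) * pairVar σ (u r) ∂ρ = 2⁻¹ * ∫⁻ z, (∫⁻ r,
        ENNReal.ofReal (w r * (u r z.1 - u r z.2) ^ 2) ∂ρ) ∂(σ.prod σ) := by
    intro w u hw hu hw0
    have hur : ∀ r, Measurable (u r) := fun r => hu.comp measurable_prodMk_left
    have hum : Measurable (Function.uncurry fun (z : (Fin n → ℝ) × (Fin n → ℝ)) (r : ℝ) =>
        ENNReal.ofReal (w r * (u r z.1 - u r z.2) ^ 2)) := by
      have h1 : Measurable fun x : ((Fin n → ℝ) × (Fin n → ℝ)) × ℝ => u x.2 x.1.1 :=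
        hu.comp (by fun_prop : Measurable fun x : ((Fin n → ℝ) × (Fin n → ℝ)) × ℝ => (x.2, x.1.1))
      have h2 : Measurable fun x : ((Fin n → ℝ) × (Fin n → ℝ)) × ℝ => u x.2 x.1.2 :=
        hu.comp (by fun_prop : Measurable fun x : ((Fin n → ℝ) × (Fin n → ℝ)) × ℝ => (x.2, x.1.2))
      exact ((hw.comp measurable_snd).mul ((h1.sub h2).pow_const 2)).ennreal_ofReal
    rw [lintegral_lintegral_swap hum.aemeasurable, ← lintegral_const_mul' _ _ (by simp)]
    refine lintegral_congr_ae (hpos.mono fun r hr => ?_)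
    simp only
    rw [pairVar_eq_lintegral_prod (hur r), ← mul_assoc, mul_comm _ (2⁻¹ : ENNReal), mul_assoc,
      ← lintegral_const_mul' _ _ ENNReal.ofReal_ne_top]
    congr 1
    refine lintegral_congr fun z => ?_
    rw [ENNReal.ofReal_mul (hw0 r hr)]
  have s1 := swap (fun _ => 1) (fun r θ => f (r • θ)) measurable_const (measurable_smul_comp hfm)
    fun _ _ => zero_le_one
  simp only [ENNReal.ofReal_one, one_mul] at s1
  rw [s1, swap (fun r => n * r ^ (-p)) (fun r θ => f (r • θ)) (by fun_prop)
      (measurable_smul_comp hfm) (fun r hr => by positivity),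
    swap (fun r => r ^ (2 - p)) (fun r θ => radialDeriv f r θ) (by fun_prop)
      (measurable_radialDeriv f) (fun r hr => by positivity),
    mul_left_comm, ← mul_add]
  refine mul_le_mul_right ?_ _
  rw [← lintegral_const_mul' _ _ ENNReal.ofReal_ne_top]
  have hlm : Measurable fun z : (Fin n → ℝ) × (Fin n → ℝ) => ∫⁻ r,
      ENNReal.ofReal (n * r ^ (-p) * (f (r • z.1) - f (r • z.2)) ^ 2) ∂ρ := by
    have hm : Measurable fun x : ((Fin n → ℝ) × (Fin n → ℝ)) × ℝ =>
        ENNReal.ofReal (n * x.2 ^ (-p) * (f (x.2 • x.1.1) - f (x.2 • x.1.2)) ^ 2) := by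
      have hc := hf.continuous
      fun_prop
    exact hm.lintegral_prod_right'
  rw [← lintegral_add_left hlm]
  have a1 : ∀ᵐ z ∂σ.prod σ, ∀ᵐ r : ℝ, 0 < r → DifferentiableAt ℝ f (r • z.1) :=
    Measure.quasiMeasurePreserving_fst.ae hd
  have a2 : ∀ᵐ z ∂σ.prod σ, ∀ᵐ r : ℝ, 0 < r → DifferentiableAt ℝ f (r • z.2) :=
    Measure.quasiMeasurePreserving_snd.ae hd
  refine lintegral_mono_ae ?_
  filter_upwards [a1, a2] with z hz1 hz2
  have key := lintegral_sq_radialMeasure_le (k := k) (d := n) (p := p)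
    (h := fun r => f (r • z.1) - f (r • z.2))
    (η := fun r => radialDeriv f r z.1 - radialDeriv f r z.2) hk hn0 hp
    (by have hc := hf.continuous; fun_prop)
    ((measurable_radialDeriv_left f z.1).sub (measurable_radialDeriv_left f z.2))
    (fun s t hs hst => by
      obtain ⟨i1, e1⟩ := sub_eq_integral_radialDeriv hf hz1 hs hst
      obtain ⟨i2, e2⟩ := sub_eq_integral_radialDeriv hf hz2 hs hst
      refine ofReal_abs_le_of_eq_intervalIntegral hst (i1.sub i2) ?_
      rw [intervalIntegral.integral_sub i1 i2, ← e1, ← e2]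
      ring)
  refine key.trans (le_of_eq ?_)
  congr 1
  refine lintegral_congr fun r => ?_
  congr 1; ring

end PolarDecomposition

/-! ### The inverse Hessian form in polar coordinates -/

section QuadraticForm

variable {n : ℕ} {p q : ℝ}

/-- The quadratic form of the inverse of the Hessian of `|x|_q ^ p / p` at `x`. -/
noncomputable def lqForm (p q : ℝ) (x a : Fin n → ℝ) : ℝ :=
  lqNorm q x ^ (q - p) / (q - 1) *
    (∑ i, |x i| ^ (2 - q) * a i ^ 2 - lqNorm q x ^ (-q) * (∑ i, x i * a i) ^ 2) +
    lqNorm q x ^ (-p) * (∑ i, x i * a i) ^ 2 / (p - 1)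

theorem lqForm_smul (hq : 0 < q) {r : ℝ} (hr : 0 < r) {θ : Fin n → ℝ} (hθ : lqNorm q θ = 1)
    (f : (Fin n → ℝ) → ℝ) :
    lqForm p q (r • θ) (fun i => fderiv ℝ f (r • θ) (Pi.single i 1)) =
      r ^ (2 - p) * (tangentialSq q f r θ / (q - 1) + radialDeriv f r θ ^ 2 / (p - 1)) := by
  have e1 : ∑ i, (r • θ) i * fderiv ℝ f (r • θ) (Pi.single i 1) = r * radialDeriv f r θ := by
    rw [radialDeriv, Finset.mul_sum]
    exact Finset.sum_congr rfl fun i _ => by rw [Pi.smul_apply, smul_eq_mul]; ring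
  have e2 : ∑ i, |(r • θ) i| ^ (2 - q) * fderiv ℝ f (r • θ) (Pi.single i 1) ^ 2 =
      r ^ (2 - q) * ∑ i, |θ i| ^ (2 - q) * fderiv ℝ f (r • θ) (Pi.single i 1) ^ 2 := by
    rw [Finset.mul_sum]
    refine Finset.sum_congr rfl fun i _ => ?_
    rw [Pi.smul_apply, smul_eq_mul, abs_mul, abs_of_pos hr, Real.mul_rpow hr.le (abs_nonneg _)]
    ring
  have p1 : r ^ (q - p) * r ^ (2 - q) = r ^ (2 - p) := by
    rw [← Real.rpow_add hr]; ring_nf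
  have p2 : r ^ (q - p) * (r ^ (-q) * r ^ 2) = r ^ (2 - p) := by
    rw [← Real.rpow_natCast, ← Real.rpow_add hr, ← Real.rpow_add hr]
    congr 1; push_cast; ring
  have p3 : r ^ (-p) * r ^ 2 = r ^ (2 - p) := by
    rw [← Real.rpow_natCast, ← Real.rpow_add hr]
    congr 1; push_cast; ring
  rw [lqForm, lqNorm_smul hq hr.le, hθ, mul_one, e1, e2, tangentialSq]
  set S := ∑ i, |θ i| ^ (2 - q) * fderiv ℝ f (r • θ) (Pi.single i 1) ^ 2
  set E := radialDeriv f r θ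
  linear_combination S / (q - 1) * p1 - E ^ 2 / (q - 1) * p2 + E ^ 2 / (p - 1) * p3

theorem measurable_lqForm (hq : 0 < q) (f : (Fin n → ℝ) → ℝ) :
    Measurable fun x => lqForm p q x fun i => fderiv ℝ f x (Pi.single i 1) := by
  have hN : Measurable (lqNorm q : (Fin n → ℝ) → ℝ) := (continuous_lqNorm hq).measurable
  have hd := fun i => measurable_fderiv_single (f := f) i
  unfold lqForm
  fun_prop

theorem lintegral_ofReal_lqForm_smul {K : ℝ} {σ : Measure (Fin n → ℝ)} (h : IsPolar n q K σ)
    (hp : 1 < p) (hq : 1 < q) (f : (Fin n → ℝ) → ℝ) {r : ℝ} (hr : 0 < r) :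
    ∫⁻ θ, ENNReal.ofReal (lqForm p q (r • θ) fun i => fderiv ℝ f (r • θ) (Pi.single i 1)) ∂σ =
      ENNReal.ofReal (r ^ (2 - p)) * (ENNReal.ofReal (1 / (q - 1)) *
        ∫⁻ θ, ENNReal.ofReal (tangentialSq q f r θ) ∂σ +
        ENNReal.ofReal (1 / (p - 1)) * ∫⁻ θ, ENNReal.ofReal (radialDeriv f r θ ^ 2) ∂σ) := by
  have hq1 : 0 ≤ 1 / (q - 1) := by have : 0 < q - 1 := by linarith
                                   positivity
  have hp1 : 0 ≤ 1 / (p - 1) := by have : 0 < p - 1 := by linarith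
                                   positivity
  rw [← lintegral_const_mul' _ _ ENNReal.ofReal_ne_top,
    ← lintegral_const_mul' _ _ ENNReal.ofReal_ne_top, ← lintegral_add_left
      ((measurable_tangentialSq_right f r).ennreal_ofReal.const_mul _),
    ← lintegral_const_mul' _ _ ENNReal.ofReal_ne_top]
  refine lintegral_congr_ae (h.norm_eq.mono fun θ hθ => ?_)
  simp only
  have hT := tangentialSq_nonneg (by linarith) hθ f r
  rw [lqForm_smul (by linarith) hr hθ, ← ENNReal.ofReal_mul hq1, ← ENNReal.ofReal_mul hp1,
    ← ENNReal.ofReal_add (mul_nonneg hq1 hT) (mul_nonneg hp1 (sq_nonneg _)),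
    ← ENNReal.ofReal_mul (by positivity)]
  congr 1; ring

end QuadraticForm

/-! ### Reduction to the inequality on the sphere -/

section Core

variable {n : ℕ} {p q : ℝ}

/-- The weighted Poincaré inequality for the radial part of `μ`, combined with the one on the
sphere of the `ℓ^q` norm. -/
theorem pairVar_le_of_sphere {K C lam : ℝ} {σ : Measure (Fin n → ℝ)} (h : IsPolar n q K σ)
    (hn : 1 ≤ n) (hp : 1 < p) (hq : 1 < q) (hC : 0 ≤ C) {μ : Measure (Fin n → ℝ)}
    [IsProbabilityMeasure μ]
    (hμ : μ = volume.withDensity fun x => ENNReal.ofReal (C * Real.exp (-(lqNorm q x ^ p / p))))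
    {f : (Fin n → ℝ) → ℝ} (hf : LocallyLipschitz f) (hlam : 1 - 1 / p ≤ lam)
    (hS : ∀ r, 0 < r → (∀ᵐ θ ∂σ, DifferentiableAt ℝ f (r • θ)) →
      ENNReal.ofReal n * pairVar σ (fun θ => f (r • θ)) ≤ ENNReal.ofReal (lam / (q - 1)) *
        ∫⁻ θ, ENNReal.ofReal (r ^ 2 * tangentialSq q f r θ) ∂σ) :
    pairVar μ f ≤ ENNReal.ofReal lam *
      ∫⁻ x, ENNReal.ofReal (lqForm p q x fun i => fderiv ℝ f x (Pi.single i 1)) ∂μ := by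
  have hq0 : 0 < q := by linarith
  have hp0 : 0 < p := by linarith
  have hn0 : (0 : ℝ) < n := by exact_mod_cast hn
  have := h.prob
  obtain ⟨hρ, hmp⟩ := h.measurePreserving hq0 hμ
  have hKC : 0 ≤ K * C := mul_nonneg h.nonneg hC
  set ρ := radialMeasure (K * C) n p with hρdef
  have hpos : ∀ᵐ r ∂ρ, 0 < r := ae_pos_radialMeasure _ _ _
  have hfm := hf.continuous.measurable
  have hdμ : ∀ᵐ x ∂μ, DifferentiableAt ℝ f x := by
    have hac : μ ≪ volume := by rw [hμ]; exact withDensity_absolutelyContinuous _ _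
    exact hac.ae_le (hf.ae_differentiableAt volume)
  have hDm : MeasurableSet {z : ℝ × (Fin n → ℝ) | DifferentiableAt ℝ f (z.1 • z.2)} :=
    hmp.measurable (measurableSet_of_differentiableAt ℝ f)
  -- Rademacher's theorem and Fubini: individual spheres are null sets, so differentiability on them
  -- is available for almost every radius only.
  have hdr : ∀ᵐ r ∂ρ, ∀ᵐ θ ∂σ, DifferentiableAt ℝ f (r • θ) :=
    (Measure.ae_prod_iff_ae_ae hDm).1 (hmp.quasiMeasurePreserving.ae hdμ)
  have hdθ : ∀ᵐ θ ∂σ, ∀ᵐ r : ℝ, 0 < r → DifferentiableAt ℝ f (r • θ) :=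
    ((Measure.ae_ae_comm hDm).1 hdr).mono fun θ hθ =>
      ae_of_ae_radialMeasure (pos_of_isProbabilityMeasure_radialMeasure (d := n) (p := p) hKC) hθ
  rw [← pairVar_comp hmp hfm, pairVar_prod (f := fun z : ℝ × (Fin n → ℝ) => f (z.1 • z.2))
    (measurable_smul_comp hfm) (ae_of_all _ fun r => h.memLp hq0 hf.continuous r 2)]
  have hηm : Measurable fun r => ∫ θ, radialDeriv f r θ ∂σ :=
    (StronglyMeasurable.integral_prod_right (f := fun r θ => radialDeriv f r θ)
      (measurable_radialDeriv f).stronglyMeasurable).measurable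
  have b1 := lintegral_pairVar_le h hKC hn hp0 hf hdθ
  have b2 := pairVar_radialMeasure_le (k := K * C) (d := n) (p := p)
    (h := fun r => ∫ θ, f (r • θ) ∂σ) (η := fun r => ∫ θ, radialDeriv f r θ ∂σ) hKC hn0 hp0 hηm
    fun s t hs hst => by
      obtain ⟨i1, e1⟩ := h.integral_sub_eq hq0 hf hdθ hs hst
      exact ofReal_abs_le_of_eq_intervalIntegral hst i1 e1
  refine (add_le_add b1 b2).trans ?_
  have hV1 : Measurable fun r => pairVar σ fun θ => f (r • θ) :=
    measurable_lintegral_lintegral_sq (measurable_smul_comp hfm)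
  have hV2 : Measurable fun r => pairVar σ fun θ => radialDeriv f r θ :=
    measurable_lintegral_lintegral_sq (f := fun r θ => radialDeriv f r θ) (measurable_radialDeriv f)
  have hw : ∀ s c : ℝ, Measurable fun r : ℝ => ENNReal.ofReal (c * r ^ s) := fun s c => by fun_prop
  have hw' : Measurable fun r : ℝ => ENNReal.ofReal (r ^ (2 - p)) := by fun_prop
  have hm1 : Measurable fun r => ENNReal.ofReal (n * r ^ (-p)) * pairVar σ fun θ => f (r • θ) :=
    (hw (-p) n).mul hV1
  have hm2 : Measurable fun r => ENNReal.ofReal (r ^ (2 - p)) *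
      pairVar σ fun θ => radialDeriv f r θ := hw'.mul hV2
  rw [add_assoc, ← mul_add, ← lintegral_add_left hm2,
    ← lintegral_const_mul' _ _ ENNReal.ofReal_ne_top, ← lintegral_add_left hm1,
    ← hmp.lintegral_comp (measurable_lqForm hq0 f).ennreal_ofReal,
    lintegral_prod (f := fun z : ℝ × (Fin n → ℝ) => ENNReal.ofReal (lqForm p q (z.1 • z.2)
      fun i => fderiv ℝ f (z.1 • z.2) (Pi.single i 1)))
      (((measurable_lqForm hq0 f).ennreal_ofReal).comp hmp.measurable).aemeasurable,
    ← lintegral_const_mul' _ _ ENNReal.ofReal_ne_top]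
  refine lintegral_mono_ae ?_
  filter_upwards [hpos, hdr] with r hr hrd
  have hlam0 : 0 ≤ lam := le_trans (by
    rw [sub_nonneg, div_le_one hp0]; exact hp.le) hlam
  have hsph := hS r hr hrd
  rw [lintegral_ofReal_lqForm_smul h hp hq f hr]
  -- The two radial inequalities have the same constant 1/p and the same weight, so the variance and
  -- the squared mean of the radial derivative recombine into its full second moment.
  have e2 : pairVar σ (fun θ => radialDeriv f r θ) +
      ENNReal.ofReal ((∫ θ, radialDeriv f r θ ∂σ) ^ 2) =
      ∫⁻ θ, ENNReal.ofReal (radialDeriv f r θ ^ 2) ∂σ :=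
    (lintegral_sq_eq_pairVar_add (h.memLp_radialDeriv hq0 hf r 2)).symm
  have e3 : ∫⁻ θ, ENNReal.ofReal (r ^ 2 * tangentialSq q f r θ) ∂σ =
      ENNReal.ofReal (r ^ 2) * ∫⁻ θ, ENNReal.ofReal (tangentialSq q f r θ) ∂σ := by
    rw [← lintegral_const_mul' _ _ ENNReal.ofReal_ne_top]
    exact lintegral_congr fun θ => ENNReal.ofReal_mul (sq_nonneg r)
  have hr2 : 0 ≤ r ^ (2 - p) := by positivity
  rw [ENNReal.ofReal_mul hr2, ← mul_add, e2]
  rw [e3] at hsph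
  generalize (∫⁻ θ, ENNReal.ofReal (tangentialSq q f r θ) ∂σ) = T at hsph ⊢
  generalize (∫⁻ θ, ENNReal.ofReal (radialDeriv f r θ ^ 2) ∂σ) = E
  generalize pairVar σ (fun θ => f (r • θ)) = V at hsph ⊢
  have c1 : ENNReal.ofReal (n * r ^ (-p)) * V ≤
      ENNReal.ofReal lam * (ENNReal.ofReal (r ^ (2 - p)) * (ENNReal.ofReal (1 / (q - 1)) * T)) := by
    rw [mul_comm (n : ℝ), ENNReal.ofReal_mul (by positivity), mul_assoc]
    refine (mul_le_mul_right hsph _).trans (le_of_eq ?_)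
    simp only [← mul_assoc]
    rw [← ENNReal.ofReal_mul (by positivity), ← ENNReal.ofReal_mul (mul_nonneg (by positivity)
      (div_nonneg hlam0 (by linarith))), ← ENNReal.ofReal_mul hlam0,
      ← ENNReal.ofReal_mul (by positivity)]
    congr 2
    have : r ^ (2 - p) = r ^ (-p) * r ^ 2 := by
      rw [← Real.rpow_natCast, ← Real.rpow_add hr]
      congr 1; push_cast; ring
    rw [this]; ring
  -- The only place where λ ≥ 1 - 1/p decides the constant: 1/p = (1 - 1/p)/(p - 1).
  have c2 : ENNReal.ofReal (1 / p) * (ENNReal.ofReal (r ^ (2 - p)) * E) ≤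
      ENNReal.ofReal lam * (ENNReal.ofReal (r ^ (2 - p)) * (ENNReal.ofReal (1 / (p - 1)) * E)) := by
    rw [mul_left_comm, mul_left_comm (ENNReal.ofReal lam), ← mul_assoc (ENNReal.ofReal lam),
      ← ENNReal.ofReal_mul hlam0]
    refine mul_le_mul_right (mul_le_mul_left (ENNReal.ofReal_le_ofReal ?_) _) _
    have h1 : 1 / p = (1 - 1 / p) * (1 / (p - 1)) := by
      have : p - 1 ≠ 0 := by linarith
      field_simp
    rw [h1]
    exact mul_le_mul_of_nonneg_right hlam (div_nonneg zero_le_one (by linarith))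
  rw [mul_add, mul_add]
  exact add_le_add c1 c2

end Core

/-! ### Constants on the sphere for even functions -/

section EvenFunctions

variable {n : ℕ} {p q : ℝ}

/-- The smallest admissible product constant is c = max(1 - 1/q, 1/2). For q ≥ 2 it is 1 - 1/q with
γ = q, and the sphere constant γ(γ - q + n) is qn. For q ≤ 2 it is 1/2 with γ = 2(q-1), and the
sphere constant is 2(q-1)(n+q-2). -/
theorem IsPolar.natCast_mul_pairVar_le {K lam r : ℝ} {σ : Measure (Fin n → ℝ)}
    (h : IsPolar n q K σ) (hn : 2 ≤ n) (hq : 1 < q) (hlam1 : 2 ≤ q → 1 - 1 / q ≤ lam)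
    (hlam2 : q ≤ 2 → n / (2 * (n + q - 2)) ≤ lam) {f : (Fin n → ℝ) → ℝ} (hf : LocallyLipschitz f)
    (heven : ∀ x, f (-x) = f x) (hd : ∀ᵐ θ ∂σ, DifferentiableAt ℝ f (r • θ)) :
    ENNReal.ofReal n * pairVar σ (fun θ => f (r • θ)) ≤ ENNReal.ofReal (lam / (q - 1)) *
      ∫⁻ θ, ENNReal.ofReal (r ^ 2 * tangentialSq q f r θ) ∂σ := by
  have hn2 : (2 : ℝ) ≤ n := by exact_mod_cast hn
  have hq1 : 0 < q - 1 := by linarith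
  have reduce : ∀ κ : ℝ, 0 < κ → n / κ ≤ lam / (q - 1) →
      ENNReal.ofReal κ * pairVar σ (fun θ => f (r • θ)) ≤
        ∫⁻ θ, ENNReal.ofReal (r ^ 2 * tangentialSq q f r θ) ∂σ →
      ENNReal.ofReal n * pairVar σ (fun θ => f (r • θ)) ≤ ENNReal.ofReal (lam / (q - 1)) *
        ∫⁻ θ, ENNReal.ofReal (r ^ 2 * tangentialSq q f r θ) ∂σ := by
    intro κ hκ hle hV
    have e : (n : ℝ) = n / κ * κ := by field_simp
    rw [e, ENNReal.ofReal_mul (by positivity), mul_assoc]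
    exact mul_le_mul' (ENNReal.ofReal_le_ofReal hle) hV
  rcases le_total 2 q with h2 | h2
  · have hl := hlam1 h2
    have hc2 : 1 / 2 ≤ 1 - 1 / q := by
      rw [div_le_iff₀ two_pos, sub_mul, one_mul, div_mul_eq_mul_div, one_mul, le_sub_comm,
        div_le_iff₀ (by linarith)]
      linarith
    refine reduce (q * (q - q + n)) (by nlinarith) ?_ (pairVar_sphere_le h hn hq le_rfl hc2
      (by field_simp) (by linarith) hf heven hd)
    have e : n / (q * (q - q + n)) = (1 - 1 / q) / (q - 1) := by
      have : (n : ℝ) ≠ 0 := by linarith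
      field_simp
      ring
    rw [e]
    exact div_le_div_of_nonneg_right hl hq1.le
  · have hl := hlam2 h2
    have hc1 : 1 - 1 / q ≤ 1 / 2 := by
      rw [sub_le_comm, le_div_iff₀ (by linarith)]
      linarith
    have hnq : 0 < n + q - 2 := by linarith
    refine reduce (2 * (q - 1) * (2 * (q - 1) - q + n)) ?_ ?_
      (pairVar_sphere_le h hn hq hc1 le_rfl (by ring) (by linarith) hf heven hd)
    · have : 0 < 2 * (q - 1) - q + n := by linarith
      positivity
    · have e : n / (2 * (q - 1) * (2 * (q - 1) - q + n)) = n / (2 * (n + q - 2)) / (q - 1) := by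
        have e1 : 2 * (q - 1) - q + n = n + q - 2 := by ring
        rw [e1, div_div]
        congr 1; ring
      rw [e]
      exact div_le_div_of_nonneg_right hl hq1.le

/-- In dimension one the sphere is {1, -1}, where even functions are constant. No condition on q is
then needed, which covers the case n = 1 excluded by the homogeneous extension. -/
theorem IsPolar.pairVar_eq_zero {K r : ℝ} {σ : Measure (Fin 1 → ℝ)} (h : IsPolar 1 q K σ)
    (hq : 0 < q) {f : (Fin 1 → ℝ) → ℝ} (heven : ∀ x, f (-x) = f x) :
    pairVar σ (fun θ => f (r • θ)) = 0 := by
  have e : (fun θ => f (r • θ)) =ᵐ[σ] fun _ => f (r • 1) := by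
    refine h.norm_eq.mono fun θ hθ => ?_
    have h1 : |θ 0| = 1 := by
      have h2 := lqNorm_rpow hq θ
      rw [hθ, Real.one_rpow, Fin.sum_univ_one] at h2
      exact (Real.rpow_left_inj (abs_nonneg _) zero_le_one hq.ne').1
        (by rw [Real.one_rpow]; exact h2.symm)
    rcases (abs_eq zero_le_one).1 h1 with h3 | h3
    · have : θ = 1 := by ext i; rw [Fin.fin_one_eq_zero i, h3]; rfl
      simp only [this]
    · have : θ = -1 := by ext i; rw [Fin.fin_one_eq_zero i, h3]; rfl
      simp only [this, smul_neg, heven]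
  rw [pairVar_congr_ae e]
  simp [pairVar]

theorem pairVar_le_lqForm {C lam : ℝ} (hn : 1 ≤ n) (hp : 1 < p) (hq : 1 < q) (hC : 0 ≤ C)
    {μ : Measure (Fin n → ℝ)} [IsProbabilityMeasure μ]
    (hμ : μ = volume.withDensity fun x => ENNReal.ofReal (C * Real.exp (-(lqNorm q x ^ p / p))))
    (hlam : 1 - 1 / p ≤ lam)
    (hlamq : n = 1 ∨ (2 ≤ q → 1 - 1 / q ≤ lam) ∧ (q ≤ 2 → n / (2 * (n + q - 2)) ≤ lam))
    {f : (Fin n → ℝ) → ℝ} (hf : LocallyLipschitz f) (heven : ∀ x, f (-x) = f x) :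
    pairVar μ f ≤ ENNReal.ofReal lam *
      ∫⁻ x, ENNReal.ofReal (lqForm p q x fun i => fderiv ℝ f x (Pi.single i 1)) ∂μ := by
  obtain ⟨σ, K, h⟩ := exists_isPolar hn hq.le
  refine pairVar_le_of_sphere h hn hp hq hC hμ hf hlam fun r _ hd => ?_
  rcases eq_or_ne n 1 with h1 | h1
  · subst h1
    rw [h.pairVar_eq_zero (by linarith) heven, mul_zero]
    exact zero_le
  · have hl := hlamq.resolve_left h1
    exact h.natCast_mul_pairVar_le (by omega) hq hl.1 hl.2 hf heven hd

end EvenFunctions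

/-! ### The Hessian of the potential and its inverse -/

section Hessian

variable {n : ℕ} {p q : ℝ}

theorem hasDerivAt_abs_rpow_mul_self (s : ℝ) {t : ℝ} (ht : t ≠ 0) :
    HasDerivAt (fun t : ℝ => |t| ^ s * t) ((s + 1) * |t| ^ s) t := by
  have h := ((hasDerivAt_abs ht).rpow_const (p := s) (Or.inl (abs_pos.2 ht).ne')).fun_mul
    (hasDerivAt_id' t)
  refine h.congr_deriv ?_
  have h1 : (SignType.sign t : ℝ) * t = |t| := by rw [mul_comm, self_mul_sign]
  have h2 : |t| ^ s = |t| ^ (s - 1) * |t| := by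
    rw [← Real.rpow_add_one (abs_pos.2 ht).ne']; ring_nf
  rw [h2]
  linear_combination s * |t| ^ (s - 1) * h1

theorem hasFDerivAt_lqNorm_rpow (hq : 1 < q) (s : ℝ) {x : Fin n → ℝ} (hx : x ≠ 0) :
    HasFDerivAt (fun y => lqNorm q y ^ s) (∑ j, (s * lqNorm q x ^ (s - q) *
      (|x j| ^ (q - 2) * x j)) • ContinuousLinearMap.proj (R := ℝ) (φ := fun _ : Fin n => ℝ) j)
      x := by
  have hN := lqNorm_pos_of_ne_zero (q := q) hx
  refine ((hasFDerivAt_lqNorm hq hx).rpow_const (p := s) (Or.inl hN.ne')).congr_fderiv ?_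
  rw [Finset.smul_sum]
  refine Finset.sum_congr rfl fun j _ => ?_
  rw [smul_smul, lqNormal]
  congr 1
  have : lqNorm q x ^ (s - q) = lqNorm q x ^ (s - 1) * lqNorm q x ^ (1 - q) := by
    rw [← Real.rpow_add hN]; ring_nf
  rw [this]; ring

theorem fderiv_lqNorm_rpow_single (hp : p ≠ 0) (hq : 1 < q) {x : Fin n → ℝ} (hx : x ≠ 0)
    (i : Fin n) :
    fderiv ℝ (fun y => lqNorm q y ^ p / p) x (Pi.single i 1) =
      lqNorm q x ^ (p - q) * (|x i| ^ (q - 2) * x i) := by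
  have h := ((hasFDerivAt_lqNorm_rpow hq p hx).mul_const p⁻¹).fderiv
  simp only [← div_eq_mul_inv] at h
  rw [h]
  simp [Pi.single_apply]
  field_simp

/-- The Hessian of `|x|_q ^ p / p`. -/
noncomputable def lqHessian (p q : ℝ) (x : Fin n → ℝ) : (Fin n → ℝ) →L[ℝ] (Fin n → ℝ) :=
  ContinuousLinearMap.pi fun i => ((p - q) * lqNorm q x ^ (p - 2 * q) * (|x i| ^ (q - 2) * x i)) •
    (∑ j, (|x j| ^ (q - 2) * x j) • ContinuousLinearMap.proj (R := ℝ) (φ := fun _ : Fin n => ℝ) j) +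
    (lqNorm q x ^ (p - q) * ((q - 1) * |x i| ^ (q - 2))) •
      ContinuousLinearMap.proj (R := ℝ) (φ := fun _ : Fin n => ℝ) i

/-- The inverse of the Hessian of `|x|_q ^ p / p`. -/
noncomputable def lqHessianInv (p q : ℝ) (x : Fin n → ℝ) : (Fin n → ℝ) →L[ℝ] (Fin n → ℝ) :=
  ContinuousLinearMap.pi fun i => (lqNorm q x ^ (q - p) * |x i| ^ (2 - q) / (q - 1)) •
      ContinuousLinearMap.proj (R := ℝ) (φ := fun _ : Fin n => ℝ) i -
    ((p - q) / ((q - 1) * (p - 1)) * lqNorm q x ^ (-p) * x i) •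
    (∑ j, x j • ContinuousLinearMap.proj (R := ℝ) (φ := fun _ : Fin n => ℝ) j)

theorem lqHessian_apply (x v : Fin n → ℝ) (i : Fin n) : lqHessian p q x v i =
    (p - q) * lqNorm q x ^ (p - 2 * q) * (|x i| ^ (q - 2) * x i) *
      (∑ j, |x j| ^ (q - 2) * x j * v j) +
    lqNorm q x ^ (p - q) * ((q - 1) * |x i| ^ (q - 2)) * v i := by
  simp [lqHessian]

theorem lqHessianInv_apply (x v : Fin n → ℝ) (i : Fin n) : lqHessianInv p q x v i =
    lqNorm q x ^ (q - p) * |x i| ^ (2 - q) / (q - 1) * v i -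
      (p - q) / ((q - 1) * (p - 1)) * lqNorm q x ^ (-p) * x i * ∑ j, x j * v j := by
  simp [lqHessianInv]

theorem hasFDerivAt_gradient_lqNorm_rpow (hq : 1 < q) {x : Fin n → ℝ} (hx0 : x ≠ 0)
    (hx : ∀ i, x i ≠ 0) :
    HasFDerivAt (fun (y : Fin n → ℝ) i => lqNorm q y ^ (p - q) * (|y i| ^ (q - 2) * y i))
      (lqHessian p q x) x := by
  refine hasFDerivAt_pi.2 fun i => ?_
  have h1 : HasFDerivAt (fun y : Fin n → ℝ => y i)
      (ContinuousLinearMap.proj (R := ℝ) (φ := fun _ : Fin n => ℝ) i) x := hasFDerivAt_apply i x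
  have h2 := (hasDerivAt_abs_rpow_mul_self (q - 2) (hx i)).comp_hasFDerivAt x h1
  refine ((hasFDerivAt_lqNorm_rpow hq (p - q) hx0).mul h2).congr_fderiv ?_
  have e : p - q - q = p - 2 * q := by ring
  have e2 : q - 2 + 1 = q - 1 := by ring
  ext v
  simp [e, e2, Finset.mul_sum]
  rw [add_comm]
  congr 1
  · exact Finset.sum_congr rfl fun j _ => by ring
  · ring

/-- The Hessian is a diagonal matrix plus a rank-one term, and the inverse is the Sherman–Morrison
formula. All coordinates must be nonzero for the powers |x i|^(q-2) and |x i|^(2-q) to be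
reciprocal. -/
theorem lqHessian_comp_inv (hp : 1 < p) (hq : 1 < q) {x : Fin n → ℝ} (hx0 : x ≠ 0)
    (hx : ∀ i, x i ≠ 0) :
    lqHessian p q x ∘SL lqHessianInv p q x = ContinuousLinearMap.id ℝ (Fin n → ℝ) := by
  have hN := lqNorm_pos_of_ne_zero (q := q) hx0
  have hp1 : p - 1 ≠ 0 := by linarith
  have hq1 : q - 1 ≠ 0 := by linarith
  ext1 v
  ext i
  set N := lqNorm q x with hNdef
  set P := ∑ j, x j * v j with hP
  have g1 : ∀ j, |x j| ^ (q - 2) * x j * (|x j| ^ (2 - q)) = x j := fun j => by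
    have := abs_rpow_mul_abs_rpow (q := q) (x j); linarith
  have g2 : ∀ j, |x j| ^ (q - 2) * x j * x j = |x j| ^ q := fun j => by
    have := mul_abs_rpow_mul_self (q := q) (by linarith) (x j); linarith
  have g3 : |x i| ^ (q - 2) * |x i| ^ (2 - q) = 1 := by
    rw [← Real.rpow_add (abs_pos.2 (hx i))]; simp
  have n1 : N ^ (-p) * N ^ q = N ^ (q - p) := by rw [← Real.rpow_add hN]; ring_nf
  have n2 : N ^ (p - q) * N ^ (q - p) = 1 := by rw [← Real.rpow_add hN]; simp
  have n3 : N ^ (p - q) * N ^ (-p) = N ^ (-q) := by rw [← Real.rpow_add hN]; ring_nf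
  have n4 : N ^ (p - 2 * q) * N ^ (q - p) = N ^ (-q) := by rw [← Real.rpow_add hN]; ring_nf
  have hsum : ∑ j, |x j| ^ (q - 2) * x j * lqHessianInv p q x v j = N ^ (q - p) * P / (p - 1) := by
    have e : ∀ j, |x j| ^ (q - 2) * x j * lqHessianInv p q x v j =
        N ^ (q - p) / (q - 1) * (x j * v j) -
          (p - q) / ((q - 1) * (p - 1)) * N ^ (-p) * P * |x j| ^ q := fun j => by
      rw [lqHessianInv_apply, ← hP, ← hNdef]
      linear_combination N ^ (q - p) / (q - 1) * v j * g1 j -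
        (p - q) / ((q - 1) * (p - 1)) * N ^ (-p) * P * g2 j
    simp_rw [e]
    rw [Finset.sum_sub_distrib, ← Finset.mul_sum, ← Finset.mul_sum, ← hP,
      ← lqNorm_rpow (by linarith), ← hNdef]
    have : (p - q) / ((q - 1) * (p - 1)) * N ^ (-p) * P * N ^ q =
      (p - q) / ((q - 1) * (p - 1)) * N ^ (q - p) * P := by rw [← n1]; ring
    rw [this]
    field_simp
    ring
  simp only [ContinuousLinearMap.comp_apply, ContinuousLinearMap.id_apply]
  rw [lqHessian_apply, hsum, lqHessianInv_apply, ← hP, ← hNdef]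
  have hA : (p - q) * N ^ (p - 2 * q) * (|x i| ^ (q - 2) * x i) * (N ^ (q - p) * P / (p - 1)) =
      (p - q) / (p - 1) * N ^ (-q) * (|x i| ^ (q - 2) * x i) * P := by
    rw [← n4]; ring
  have hB : N ^ (p - q) * ((q - 1) * |x i| ^ (q - 2)) * (N ^ (q - p) * |x i| ^ (2 - q) / (q - 1) *
      v i - (p - q) / ((q - 1) * (p - 1)) * N ^ (-p) * x i * P) =
      (N ^ (p - q) * N ^ (q - p)) * (|x i| ^ (q - 2) * |x i| ^ (2 - q)) * v i -
      (p - q) / (p - 1) * (N ^ (p - q) * N ^ (-p)) * (|x i| ^ (q - 2) * x i) * P := by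
    field_simp
  rw [hA, hB, n2, g3, n3]
  ring

theorem lqHessianInv_comp (hp : 1 < p) (hq : 1 < q) {x : Fin n → ℝ} (hx0 : x ≠ 0)
    (hx : ∀ i, x i ≠ 0) : lqHessianInv p q x ∘SL lqHessian p q x =
      ContinuousLinearMap.id ℝ (Fin n → ℝ) := by
  have h := lqHessian_comp_inv hp hq hx0 hx
  have h1 : (lqHessian p q x : (Fin n → ℝ) →ₗ[ℝ] (Fin n → ℝ)) ∘ₗ
      (lqHessianInv p q x : (Fin n → ℝ) →ₗ[ℝ] (Fin n → ℝ)) = LinearMap.id :=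
    congrArg ContinuousLinearMap.toLinearMap h
  exact ContinuousLinearMap.coe_injective ((LinearMap.comp_eq_id_comm _ _).1 h1)

theorem sum_lqHessianInv_mul (hp : 1 < p) (hq : 1 < q) {x : Fin n → ℝ} (hx0 : x ≠ 0)
    (a : Fin n → ℝ) : ∑ i, lqHessianInv p q x a i * a i = lqForm p q x a := by
  have hN := lqNorm_pos_of_ne_zero (q := q) hx0
  have hp1 : p - 1 ≠ 0 := by linarith
  have hq1 : q - 1 ≠ 0 := by linarith
  rw [lqForm]
  set N := lqNorm q x with hNdef
  set P := ∑ j, x j * a j with hP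
  have e : ∀ i, lqHessianInv p q x a i * a i = N ^ (q - p) / (q - 1) * (|x i| ^ (2 - q) * a i ^ 2) -
      (p - q) / ((q - 1) * (p - 1)) * N ^ (-p) * P * (x i * a i) := fun i => by
    rw [lqHessianInv_apply, ← hP, ← hNdef]; ring
  have n1 : N ^ (q - p) * N ^ (-q) = N ^ (-p) := by rw [← Real.rpow_add hN]; ring_nf
  simp_rw [e]
  rw [Finset.sum_sub_distrib, ← Finset.mul_sum, ← Finset.mul_sum, ← hP, mul_sub, ← n1]
  field_simp
  ring

end Hessian

/-! ### Extended variance and the double integral -/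

section Variance

theorem evariance_eq_pairVar {α : Type*} [MeasurableSpace α] {μ : Measure α}
    [IsProbabilityMeasure μ] {u : α → ℝ} (hu : MemLp u 2 μ) :
    ProbabilityTheory.evariance u μ = pairVar μ u := by
  rw [← ProbabilityTheory.ofReal_variance hu, ProbabilityTheory.variance_eq_sub hu,
    pairVar_eq_ofReal hu]
  rfl

/-- If the double integral is finite, some slice is: u differs from a constant u x by a square
integrable function. -/
theorem memLp_two_of_pairVar_ne_top {α : Type*} [MeasurableSpace α] {μ : Measure α}
    [IsProbabilityMeasure μ] {u : α → ℝ} (hu : Measurable u) (h : pairVar μ u ≠ ⊤) :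
    MemLp u 2 μ := by
  have h1 : ∫⁻ x, ∫⁻ y, ENNReal.ofReal ((u x - u y) ^ 2) ∂μ ∂μ ≠ ⊤ := fun h2 => h (by
    rw [pairVar, h2]; exact ENNReal.mul_top (by simp))
  have hm : Measurable fun x => ∫⁻ y, ENNReal.ofReal ((u x - u y) ^ 2) ∂μ := by
    have : Measurable fun z : α × α => ENNReal.ofReal ((u z.1 - u z.2) ^ 2) := by fun_prop
    exact this.lintegral_prod_right'
  obtain ⟨x, hx⟩ := (ae_lt_top hm h1).exists
  have h3 : MemLp (fun y => u x - u y) 2 μ := by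
    refine (memLp_two_iff_integrable_sq (by fun_prop)).2 ⟨by fun_prop, ?_⟩
    rw [hasFiniteIntegral_iff_ofReal (ae_of_all _ fun _ => sq_nonneg _)]
    exact hx
  have h4 := (memLp_const (u x)).sub h3
  refine (memLp_congr_ae (ae_of_all _ fun y => ?_)).1 h4
  simp

/-- A bound on the double integral thus also yields square integrability, so nothing about f need be
assumed. -/
theorem evariance_le_pairVar {α : Type*} [MeasurableSpace α] {μ : Measure α}
    [IsProbabilityMeasure μ] {u : α → ℝ} (hu : Measurable u) :
    ProbabilityTheory.evariance u μ ≤ pairVar μ u := by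
  by_cases h : pairVar μ u = ⊤
  · rw [h]; exact le_top
  · exact (evariance_eq_pairVar (memLp_two_of_pairVar_ne_top hu h)).le

end Variance

/-! ### Transfer to Euclidean space -/

section Euclidean

variable {n : ℕ} {p q : ℝ}

/-- The identification of Euclidean space with the product space. -/
noncomputable abbrev euclideanEquiv (n : ℕ) : EuclideanSpace ℝ (Fin n) ≃L[ℝ] (Fin n → ℝ) :=
  PiLp.continuousLinearEquiv 2 ℝ fun _ => ℝ

theorem gradient_comp_euclideanEquiv (F : (Fin n → ℝ) → ℝ) (x : EuclideanSpace ℝ (Fin n)) :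
    gradient (F ∘ euclideanEquiv n) x = (euclideanEquiv n).symm fun i =>
      fderiv ℝ F (euclideanEquiv n x) (Pi.single i 1) := by
  ext i
  have h1 : gradient (F ∘ euclideanEquiv n) x i =
      inner ℝ (gradient (F ∘ euclideanEquiv n) x) (EuclideanSpace.single i (1 : ℝ)) := by
    rw [EuclideanSpace.inner_single_right]; simp
  rw [h1, inner_gradient_left, ContinuousLinearEquiv.comp_right_fderiv]
  rfl

theorem lqPotential_eq (n : ℕ) (p q : ℝ) :
    lqPotential n p q = (fun y => lqNorm q y ^ p / p) ∘ euclideanEquiv n := by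
  ext x
  have h : (∑ i, |x i| ^ q) ^ (p / q) = lqNorm q (euclideanEquiv n x) ^ p := by
    rw [lqNorm, ← Real.rpow_mul (Finset.sum_nonneg fun i _ => Real.rpow_nonneg (abs_nonneg _) _),
      one_div_mul_eq_div]
    rfl
  rw [lqPotential, h, Function.comp]
  ring

theorem hessianOp_lqPotential (hn : 1 ≤ n) (hp : 1 < p) (hq : 1 < q)
    {x : EuclideanSpace ℝ (Fin n)} (hx : ∀ i, x i ≠ 0) :
    hessianOp (lqPotential n p q) x = ((euclideanEquiv n).symm : (Fin n → ℝ) →L[ℝ] _) ∘SL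
      lqHessian p q (euclideanEquiv n x) ∘SL (euclideanEquiv n : _ →L[ℝ] (Fin n → ℝ)) := by
  have hx0 : euclideanEquiv n x ≠ 0 := fun h => hx ⟨0, hn⟩ (congrFun h _)
  set G : (Fin n → ℝ) → Fin n → ℝ := fun y i =>
    fderiv ℝ (fun y => lqNorm q y ^ p / p) y (Pi.single i 1) with hG
  have h1 : gradient (lqPotential n p q) =
      (euclideanEquiv n).symm ∘ G ∘ euclideanEquiv n := by
    ext1 y
    rw [lqPotential_eq, gradient_comp_euclideanEquiv]
    rfl
  have h2 : G =ᶠ[𝓝 (euclideanEquiv n x)]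
      fun y i => lqNorm q y ^ (p - q) * (|y i| ^ (q - 2) * y i) := by
    filter_upwards [isOpen_ne.mem_nhds hx0] with y hy
    ext i
    exact fderiv_lqNorm_rpow_single (by linarith) hq hy i
  have h3 : fderiv ℝ G (euclideanEquiv n x) = lqHessian p q (euclideanEquiv n x) := by
    rw [h2.fderiv_eq]
    exact (hasFDerivAt_gradient_lqNorm_rpow hq hx0 hx).fderiv
  rw [hessianOp, h1, ContinuousLinearEquiv.comp_fderiv, ContinuousLinearEquiv.comp_right_fderiv, h3]

theorem blIntegrand_lqPotential (hn : 1 ≤ n) (hp : 1 < p) (hq : 1 < q)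
    {x : EuclideanSpace ℝ (Fin n)} (hx : ∀ i, x i ≠ 0) (F : (Fin n → ℝ) → ℝ) :
    blIntegrand (lqPotential n p q) (F ∘ euclideanEquiv n) x =
      lqForm p q (euclideanEquiv n x) fun i => fderiv ℝ F (euclideanEquiv n x) (Pi.single i 1) := by
  have hx0 : euclideanEquiv n x ≠ 0 := fun h => hx ⟨0, hn⟩ (congrFun h _)
  have hinv : (hessianOp (lqPotential n p q) x).inverse =
      ((euclideanEquiv n).symm : (Fin n → ℝ) →L[ℝ] _) ∘SL
      lqHessianInv p q (euclideanEquiv n x) ∘SL (euclideanEquiv n : _ →L[ℝ] (Fin n → ℝ)) := by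
    rw [hessianOp_lqPotential hn hp hq hx]
    refine ContinuousLinearMap.inverse_eq ?_ ?_
    · ext1 v
      have h := DFunLike.congr_fun (lqHessian_comp_inv hp hq hx0 hx) (euclideanEquiv n v)
      simp only [ContinuousLinearMap.comp_apply, ContinuousLinearMap.id_apply,
        ContinuousLinearEquiv.coe_coe, ContinuousLinearEquiv.apply_symm_apply] at h ⊢
      rw [h, ContinuousLinearEquiv.symm_apply_apply]
    · ext1 v
      have h := DFunLike.congr_fun (lqHessianInv_comp hp hq hx0 hx) (euclideanEquiv n v)
      simp only [ContinuousLinearMap.comp_apply, ContinuousLinearMap.id_apply,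
        ContinuousLinearEquiv.coe_coe, ContinuousLinearEquiv.apply_symm_apply] at h ⊢
      rw [h, ContinuousLinearEquiv.symm_apply_apply]
  rw [blIntegrand, hinv, gradient_comp_euclideanEquiv, ← sum_lqHessianInv_mul hp hq hx0]
  simp only [ContinuousLinearMap.comp_apply, ContinuousLinearEquiv.coe_coe,
    ContinuousLinearEquiv.apply_symm_apply]
  rw [PiLp.inner_apply]
  refine Finset.sum_congr rfl fun i _ => ?_
  simp only [RCLike.inner_apply, conj_trivial]
  rw [mul_comm]
  rfl

theorem measurePreserving_euclideanEquiv {w : (Fin n → ℝ) → ENNReal} (hw : Measurable w) :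
    MeasurePreserving (euclideanEquiv n) (volume.withDensity fun x => w (euclideanEquiv n x))
      (volume.withDensity w) := by
  have hv : MeasurePreserving (euclideanEquiv n) volume volume := PiLp.volume_preserving_ofLp (Fin n)
  refine ⟨hv.measurable, ?_⟩
  ext s hs
  rw [Measure.map_apply hv.measurable hs, withDensity_apply _ hs,
    withDensity_apply _ (hv.measurable hs), hv.setLIntegral_comp_preimage hs hw]

/-- The explicit Hessian is available only off the coordinate hyperplanes; these are null sets. -/
theorem ae_forall_ne_zero {w : (Fin n → ℝ) → ENNReal} :
    ∀ᵐ x ∂(volume : Measure (Fin n → ℝ)).withDensity w, ∀ i, x i ≠ 0 := by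
  refine (withDensity_absolutelyContinuous _ _).ae_le (ae_all_iff.2 fun i => ?_)
  rw [ae_iff, volume_pi]
  simpa using Measure.pi_hyperplane (fun _ : Fin n => (volume : Measure ℝ)) i 0

theorem lintegral_blIntegrand_lqPotential (hn : 1 ≤ n) (hp : 1 < p) (hq : 1 < q)
    {w : (Fin n → ℝ) → ENNReal} (hw : Measurable w) (F : (Fin n → ℝ) → ℝ) :
    ∫⁻ x, ENNReal.ofReal (blIntegrand (lqPotential n p q) (F ∘ euclideanEquiv n) x)
      ∂(volume.withDensity fun x => w (euclideanEquiv n x)) =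
    ∫⁻ y, ENNReal.ofReal (lqForm p q y fun i => fderiv ℝ F y (Pi.single i 1))
      ∂(volume.withDensity w) := by
  have hmp := measurePreserving_euclideanEquiv hw
  rw [← hmp.lintegral_comp (measurable_lqForm (by linarith) F).ennreal_ofReal]
  refine lintegral_congr_ae ?_
  filter_upwards [hmp.quasiMeasurePreserving.ae ae_forall_ne_zero] with x hx
  rw [blIntegrand_lqPotential hn hp hq hx]

end Euclidean

/-! ### The potential as extremal function -/

section Extremal

variable {n : ℕ} {p q C : ℝ}

theorem locallyLipschitz_lqNorm_rpow (hp : 1 < p) (hq : 1 ≤ q) :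
    LocallyLipschitz fun y : Fin n → ℝ => lqNorm q y ^ p / p := by
  have hfact : Fact (1 ≤ ENNReal.ofReal q) := ⟨by simpa using hq⟩
  have h1 : LocallyLipschitz (lqNorm q : (Fin n → ℝ) → ℝ) := by
    have h : (lqNorm q : (Fin n → ℝ) → ℝ) =
        norm ∘ (PiLp.continuousLinearEquiv (ENNReal.ofReal q) ℝ fun _ : Fin n => ℝ).symm := by
      ext y
      exact lqNorm_eq_norm_toLp hq y
    rw [h]
    exact (lipschitzWith_one_norm.comp (ContinuousLinearEquiv.lipschitz _)).locallyLipschitz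
  have h2 : LocallyLipschitz fun t : ℝ => ‖t‖ ^ p / p :=
    ContDiff.locallyLipschitz (𝕂 := ℝ) ((contDiff_norm_rpow hp).div_const p)
  have h3 := h2.comp h1
  have e : ((fun t : ℝ => ‖t‖ ^ p / p) ∘ lqNorm q : (Fin n → ℝ) → ℝ) =
      fun y => lqNorm q y ^ p / p := by
    ext y
    rw [Function.comp, Real.norm_of_nonneg (lqNorm_nonneg y)]
  rwa [e] at h3

/-- The potential depends on |x|_q only, so the tangential part of the form vanishes (`e3`) and the
radial part alone remains. -/
theorem lqForm_lqNorm_rpow (hp : 1 < p) (hq : 1 < q) {x : Fin n → ℝ} (hx : x ≠ 0) :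
    lqForm p q x (fun i => fderiv ℝ (fun y => lqNorm q y ^ p / p) x (Pi.single i 1)) =
      lqNorm q x ^ p / (p - 1) := by
  have hN := lqNorm_pos_of_ne_zero (q := q) hx
  simp_rw [fderiv_lqNorm_rpow_single (by linarith : p ≠ 0) hq hx]
  have hS := lqNorm_rpow (by linarith : 0 < q) x
  set N := lqNorm q x with hNdef
  have e1 : ∑ i, |x i| ^ (2 - q) * (N ^ (p - q) * (|x i| ^ (q - 2) * x i)) ^ 2 =
      (N ^ (p - q)) ^ 2 * N ^ q := by
    rw [hS, Finset.mul_sum]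
    refine Finset.sum_congr rfl fun i _ => ?_
    have h1 := abs_rpow_mul_abs_rpow (q := q) (x i)
    have h2 := mul_abs_rpow_mul_self (by linarith : 0 < q) (x i)
    linear_combination (N ^ (p - q)) ^ 2 * (|x i| ^ (q - 2) * x i) * h1 + (N ^ (p - q)) ^ 2 * h2
  have e2 : ∑ i, x i * (N ^ (p - q) * (|x i| ^ (q - 2) * x i)) = N ^ (p - q) * N ^ q := by
    rw [hS, Finset.mul_sum]
    refine Finset.sum_congr rfl fun i _ => ?_
    have h2 := mul_abs_rpow_mul_self (by linarith : 0 < q) (x i)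
    linear_combination N ^ (p - q) * h2
  have n1 : N ^ (-q) * N ^ q = 1 := by rw [← Real.rpow_add hN]; simp
  have n2 : N ^ (p - q) * N ^ q = N ^ p := by rw [← Real.rpow_add hN]; ring_nf
  have n3 : N ^ (-p) * N ^ p = 1 := by rw [← Real.rpow_add hN]; simp
  have e3 : (N ^ (p - q)) ^ 2 * N ^ q - N ^ (-q) * (N ^ (p - q) * N ^ q) ^ 2 = 0 := by
    linear_combination -(N ^ (p - q)) ^ 2 * N ^ q * n1
  rw [lqForm, e1, e2, ← hNdef, e3, n2]
  linear_combination N ^ p / (p - 1) * n3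

theorem lintegral_lqNorm_rpow {K : ℝ} {σ : Measure (Fin n → ℝ)} (h : IsPolar n q K σ)
    (hq : 0 < q) {ρ : Measure ℝ} [SFinite ρ] {ν : Measure (Fin n → ℝ)} (hpos : ∀ᵐ r ∂ρ, 0 < r)
    (hmp : MeasurePreserving (fun z : ℝ × (Fin n → ℝ) => z.1 • z.2) (ρ.prod σ) ν) (s : ℝ) :
    ∫⁻ x, ENNReal.ofReal (lqNorm q x ^ s) ∂ν = ∫⁻ r, ENNReal.ofReal (r ^ s) ∂ρ := by
  have := h.prob
  have hN : Measurable (lqNorm q : (Fin n → ℝ) → ℝ) := (continuous_lqNorm hq).measurable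
  have hm : Measurable fun x : Fin n → ℝ => ENNReal.ofReal (lqNorm q x ^ s) := by fun_prop
  rw [← hmp.lintegral_comp hm, lintegral_prod
    (f := fun z : ℝ × (Fin n → ℝ) => ENNReal.ofReal (lqNorm q (z.1 • z.2) ^ s))
    (hm.comp hmp.measurable).aemeasurable]
  refine lintegral_congr_ae (hpos.mono fun r hr => ?_)
  have e : ∀ᵐ θ ∂σ, ENNReal.ofReal (lqNorm q (r • θ) ^ s) = ENNReal.ofReal (r ^ s) :=
    h.norm_eq.mono fun θ hθ => by rw [lqNorm_smul hq (le_of_lt hr), hθ, mul_one]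
  simp only
  rw [lintegral_congr_ae e]
  simp

/-- The variance of the potential and its Brascamp–Lieb energy. -/
theorem pairVar_lqNorm_rpow (hn : 1 ≤ n) (hp : 1 < p) (hq : 1 < q) (hC : 0 ≤ C)
    {ν : Measure (Fin n → ℝ)} [IsProbabilityMeasure ν]
    (hν : ν = volume.withDensity fun x => ENNReal.ofReal (C * Real.exp (-(lqNorm q x ^ p / p)))) :
    MemLp (fun x => lqNorm q x ^ p / p) 2 ν ∧
    pairVar ν (fun x => lqNorm q x ^ p / p) = ENNReal.ofReal (n / p) ∧
    ∫⁻ x, ENNReal.ofReal (lqForm p q x fun i =>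
      fderiv ℝ (fun y => lqNorm q y ^ p / p) x (Pi.single i 1)) ∂ν =
        ENNReal.ofReal (n / (p - 1)) := by
  have hq0 : 0 < q := by linarith
  have hp0 : 0 < p := by linarith
  have hp1 : 0 < p - 1 := by linarith
  have hn0 : (0 : ℝ) < n := by exact_mod_cast hn
  obtain ⟨σ, K, h⟩ := exists_isPolar hn hq.le
  have := h.prob
  obtain ⟨hρ, hmp⟩ := h.measurePreserving hq0 hν
  have hKC : 0 ≤ K * C := mul_nonneg h.nonneg hC
  have hpos := ae_pos_radialMeasure (K * C) n p
  have hN : Measurable (lqNorm q : (Fin n → ℝ) → ℝ) := (continuous_lqNorm hq0).measurable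
  have hVm : Measurable fun x : Fin n → ℝ => lqNorm q x ^ p / p := by fun_prop
  have mom := lintegral_lqNorm_rpow h hq0 hpos hmp
  -- The moment recursion from a = 0, where the moment is the total mass 1; the next moment follows
  -- from a = p.
  have hmom1 : ∫⁻ x, ENNReal.ofReal (lqNorm q x ^ p) ∂ν = ENNReal.ofReal n := by
    obtain ⟨m, hm0, hm1, hm2⟩ := exists_radial_moment (k := K * C) (d := n) (p := p) (a := 0) hKC hn0
      hp0 (by linarith)
    have h1 : m = 1 := by
      simp only [Real.rpow_zero, ENNReal.ofReal_one, lintegral_const, measure_univ, mul_one] at hm1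
      rw [eq_comm, ENNReal.ofReal_eq_one] at hm1
      exact hm1
    rw [zero_add p] at hm2
    rw [mom, hm2, h1]
    simp
  have hmom2 : ∫⁻ x, ENNReal.ofReal (lqNorm q x ^ (p + p)) ∂ν = ENNReal.ofReal ((p + n) * n) := by
    obtain ⟨m, hm0, hm1, hm2⟩ := exists_radial_moment (k := K * C) (d := n) (p := p) (a := p) hKC hn0
      hp0 (by linarith)
    have h1 : m = n := by
      rw [← mom, hmom1] at hm1
      exact ((ENNReal.ofReal_eq_ofReal_iff hn0.le hm0.le).1 hm1).symm
    rw [mom, hm2, h1]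
  have hsq : ∫⁻ x, ENNReal.ofReal ((lqNorm q x ^ p / p) ^ 2) ∂ν =
      ENNReal.ofReal ((p + n) * n / p ^ 2) := by
    rw [div_eq_inv_mul, ENNReal.ofReal_mul (by positivity), ← hmom2,
      ← lintegral_const_mul' _ _ ENNReal.ofReal_ne_top]
    refine lintegral_congr fun x => ?_
    rw [← ENNReal.ofReal_mul (by positivity), Real.rpow_add_of_nonneg (lqNorm_nonneg x) hp0.le hp0.le]
    congr 1
    field_simp
  have hL : MemLp (fun x => lqNorm q x ^ p / p) 2 ν := by
    refine (memLp_two_iff_integrable_sq hVm.aestronglyMeasurable).2 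
      ⟨(hVm.pow_const 2).aestronglyMeasurable, ?_⟩
    rw [hasFiniteIntegral_iff_ofReal (ae_of_all _ fun _ => sq_nonneg _), hsq]
    exact ENNReal.ofReal_lt_top
  have hV0 : ∀ x : Fin n → ℝ, 0 ≤ lqNorm q x ^ p / p := fun x =>
    div_nonneg (Real.rpow_nonneg (lqNorm_nonneg x) _) hp0.le
  have hmean : ∫ x, lqNorm q x ^ p / p ∂ν = n / p := by
    rw [integral_div, integral_eq_lintegral_of_nonneg_ae
      (ae_of_all _ fun x => Real.rpow_nonneg (lqNorm_nonneg x) _)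
      (hN.pow_const p).aestronglyMeasurable, hmom1,
      ENNReal.toReal_ofReal hn0.le]
  refine ⟨hL, ?_, ?_⟩
  · rw [pairVar_eq_ofReal hL, hmean, integral_eq_lintegral_of_nonneg_ae
      (ae_of_all _ fun x => sq_nonneg _) (hVm.pow_const 2).aestronglyMeasurable, hsq, ENNReal.toReal_ofReal (by positivity)]
    congr 1
    field_simp
    ring
  · have e : ∀ᵐ x ∂ν, ENNReal.ofReal (lqForm p q x fun i =>
        fderiv ℝ (fun y => lqNorm q y ^ p / p) x (Pi.single i 1)) =
        ENNReal.ofReal (1 / (p - 1)) * ENNReal.ofReal (lqNorm q x ^ p) := by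
      have h0 : ∀ᵐ x ∂ν, ∀ i, x i ≠ 0 := by rw [hν]; exact ae_forall_ne_zero
      refine h0.mono fun x hx => ?_
      have hx0 : x ≠ 0 := fun h => hx ⟨0, hn⟩ (congrFun h _)
      rw [lqForm_lqNorm_rpow hp hq hx0, ← ENNReal.ofReal_mul (by positivity)]
      congr 1; ring
    rw [lintegral_congr_ae e, lintegral_const_mul' _ _ ENNReal.ofReal_ne_top, hmom1,
      ← ENNReal.ofReal_mul (by positivity)]
    congr 1; ring

end Extremal

/-! ### The inequality on Euclidean space and its sharpness -/

section Main

variable {n : ℕ} {p q C : ℝ}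

theorem exists_measurePreserving_euclideanEquiv (hq : 0 < q)
    {μ : Measure (EuclideanSpace ℝ (Fin n))} [IsProbabilityMeasure μ]
    (hμ : μ = volume.withDensity fun x => ENNReal.ofReal (C * Real.exp (-lqPotential n p q x))) :
    ∃ w : (Fin n → ℝ) → ENNReal, Measurable w ∧
      (w = fun x => ENNReal.ofReal (C * Real.exp (-(lqNorm q x ^ p / p)))) ∧
      (μ = volume.withDensity fun x => w (euclideanEquiv n x)) ∧
      MeasurePreserving (euclideanEquiv n) μ (volume.withDensity w) ∧
      IsProbabilityMeasure ((volume : Measure (Fin n → ℝ)).withDensity w) := by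
  have hN : Measurable (lqNorm q : (Fin n → ℝ) → ℝ) := (continuous_lqNorm hq).measurable
  set w : (Fin n → ℝ) → ENNReal := fun x => ENNReal.ofReal (C * Real.exp (-(lqNorm q x ^ p / p)))
    with hw
  have hwm : Measurable w := by fun_prop
  have hμw : μ = volume.withDensity fun x => w (euclideanEquiv n x) := by
    rw [hμ, lqPotential_eq]
    rfl
  have hmp : MeasurePreserving (euclideanEquiv n) μ (volume.withDensity w) := by
    rw [hμw]; exact measurePreserving_euclideanEquiv hwm
  refine ⟨w, hwm, rfl, hμw, hmp, ?_⟩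
  rw [← hmp.map_eq]
  exact Measure.isProbabilityMeasure_map hmp.measurable.aemeasurable

theorem strongBrascampLieb_lqPotential {lam : ℝ} (hn : 1 ≤ n) (hp : 1 < p) (hq : 1 < q)
    (hC : 0 ≤ C) {μ : Measure (EuclideanSpace ℝ (Fin n))} [IsProbabilityMeasure μ]
    (hμ : μ = volume.withDensity fun x => ENNReal.ofReal (C * Real.exp (-lqPotential n p q x)))
    (hlam : 1 - 1 / p ≤ lam)
    (hlamq : n = 1 ∨ (2 ≤ q → 1 - 1 / q ≤ lam) ∧ (q ≤ 2 → n / (2 * (n + q - 2)) ≤ lam)) :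
    StrongBrascampLieb μ (lqPotential n p q) lam := by
  obtain ⟨w, hwm, hw, hμw, hmp, hprob⟩ := exists_measurePreserving_euclideanEquiv (by linarith) hμ
  intro f hf heven
  set F : (Fin n → ℝ) → ℝ := f ∘ (euclideanEquiv n).symm with hF
  have hFf : f = F ∘ euclideanEquiv n := by
    ext x; simp [hF]
  have hFl : LocallyLipschitz F :=
    hf.comp (ContinuousLinearEquiv.lipschitz (euclideanEquiv n).symm).locallyLipschitz
  have hFe : ∀ y, F (-y) = F y := fun y => by
    simp only [hF, Function.comp, map_neg]
    exact heven _
  have key := pairVar_le_lqForm (μ := volume.withDensity w) hn hp hq hC (by rw [hw]) hlam hlamq hFl hFe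
  refine (evariance_le_pairVar hf.continuous.measurable).trans ?_
  rw [hFf]
  have e : ∫⁻ x, ENNReal.ofReal (blIntegrand (lqPotential n p q) (F ∘ euclideanEquiv n) x) ∂μ =
      ∫⁻ y, ENNReal.ofReal (lqForm p q y fun i => fderiv ℝ F y (Pi.single i 1))
        ∂(volume.withDensity w) := by
    rw [hμw]; exact lintegral_blIntegrand_lqPotential hn hp hq hwm F
  rw [e]
  exact (pairVar_comp hmp hFl.continuous.measurable).trans_le key

/-- The potential itself is an even locally Lipschitz test function; its variance n/p and energy
n/(p-1) have the ratio 1 - 1/p. -/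
theorem le_of_strongBrascampLieb_lqPotential {lam : ℝ} (hn : 1 ≤ n) (hp : 1 < p) (hq : 1 < q)
    (hC : 0 ≤ C) {μ : Measure (EuclideanSpace ℝ (Fin n))} [IsProbabilityMeasure μ]
    (hμ : μ = volume.withDensity fun x => ENNReal.ofReal (C * Real.exp (-lqPotential n p q x)))
    (h : StrongBrascampLieb μ (lqPotential n p q) lam) : 1 - 1 / p ≤ lam := by
  obtain ⟨w, hwm, hw, hμw, hmp, hprob⟩ := exists_measurePreserving_euclideanEquiv (by linarith) hμ
  have hn0 : (0 : ℝ) < n := by exact_mod_cast hn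
  have hp1 : 0 < p - 1 := by linarith
  have hV : LocallyLipschitz (lqPotential n p q) := by
    rw [lqPotential_eq]
    exact (locallyLipschitz_lqNorm_rpow hp hq.le).comp
      (ContinuousLinearEquiv.lipschitz (euclideanEquiv n)).locallyLipschitz
  have hVe : Function.Even (lqPotential n p q) := fun x => by simp [lqPotential]
  have key := h _ hV hVe
  obtain ⟨hL, hvar, hen⟩ := pairVar_lqNorm_rpow (ν := volume.withDensity w) hn hp hq hC (by rw [hw])
  have hLμ : MemLp (lqPotential n p q) 2 μ := by
    rw [lqPotential_eq]; exact hL.comp_measurePreserving hmp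
  have e : ∫⁻ x, ENNReal.ofReal (blIntegrand (lqPotential n p q) (lqPotential n p q) x) ∂μ =
      ENNReal.ofReal (n / (p - 1)) := by
    rw [← hen, hμw, ← lintegral_blIntegrand_lqPotential hn hp hq hwm, ← lqPotential_eq]
  have e2 : pairVar μ (lqPotential n p q) = ENNReal.ofReal (n / p) := by
    rw [← hvar, lqPotential_eq]
    exact pairVar_comp hmp (locallyLipschitz_lqNorm_rpow hp hq.le).continuous.measurable
  rw [evariance_eq_pairVar hLμ, e, e2, ← ENNReal.ofReal_mul' (by positivity)] at key
  have hnp : 0 < n / p := by positivity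
  -- Positivity of n/p rules out the alternative coming from the truncation in `ENNReal.ofReal`;
  -- this covers λ ≤ 0.
  have h1 : n / p ≤ lam * (n / (p - 1)) := (ENNReal.ofReal_le_ofReal_iff'.1 key).resolve_right
    (not_le.2 hnp)
  have h2 : 1 - 1 / p = n / p * ((p - 1) / n) := by
    field_simp
  have h3 : lam = lam * (n / (p - 1)) * ((p - 1) / n) := by
    field_simp
  rw [h2, h3]
  exact mul_le_mul_of_nonneg_right h1 (by positivity)

end Main

theorem theoremC (n : ℕ) (hn : 1 ≤ n) (p q : ℝ) (hp : 1 < p) (hq : 1 < q)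
    (C : ℝ) (hC : 0 ≤ C) (μ : MeasureTheory.Measure (EuclideanSpace ℝ (Fin n)))
    (hprob : MeasureTheory.IsProbabilityMeasure μ)
    (hμ : μ = (MeasureTheory.volume : MeasureTheory.Measure (EuclideanSpace ℝ (Fin n))).withDensity
      (fun x => ENNReal.ofReal (C * Real.exp (-lqPotential n p q x)))) :
    (∀ lam : ℝ,
      max (1 - 1 / p) (max (1 - 1 / q) (1 / (2 * (1 + (q - 2) / (n : ℝ))))) ≤ lam →
        StrongBrascampLieb μ (lqPotential n p q) lam) ∧
    (2 ≤ q → q ≤ p →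
      IsLeast {lam : ℝ | StrongBrascampLieb μ (lqPotential n p q) lam} (1 - 1 / p)) ∧
    (q ≤ 2 → (n : ℝ) + 2 * (q - 2) ≠ 0 →
      2 * ((n : ℝ) + q - 2) / ((n : ℝ) + 2 * (q - 2)) ≤ p →
        IsLeast {lam : ℝ | StrongBrascampLieb μ (lqPotential n p q) lam} (1 - 1 / p)) := by
  have hn0 : (0 : ℝ) < n := by exact_mod_cast hn
  have hp0 : 0 < p := by linarith
  have hq0 : 0 < q := by linarith
  have least : (n = 1 ∨ (2 ≤ q → 1 - 1 / q ≤ 1 - 1 / p) ∧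
      (q ≤ 2 → n / (2 * (n + q - 2)) ≤ 1 - 1 / p)) →
      IsLeast {lam : ℝ | StrongBrascampLieb μ (lqPotential n p q) lam} (1 - 1 / p) := fun h =>
    ⟨strongBrascampLieb_lqPotential hn hp hq hC hμ le_rfl h,
      fun _ hlam => le_of_strongBrascampLieb_lqPotential hn hp hq hC hμ hlam⟩
  refine ⟨fun lam hlam => ?_, fun h2 hqp => least (Or.inr ⟨fun _ => ?_, fun hq2 => ?_⟩),
    fun h2 _ hpn => least ?_⟩
  · have e : 1 / (2 * (1 + (q - 2) / (n : ℝ))) = n / (2 * (n + q - 2)) := by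
      have : 1 + (q - 2) / (n : ℝ) = (n + q - 2) / n := by field_simp; ring
      rw [this, mul_div_assoc', one_div_div]
    rw [e] at hlam
    exact strongBrascampLieb_lqPotential hn hp hq hC hμ ((le_max_left _ _).trans hlam)
      (Or.inr ⟨fun _ => ((le_max_left _ _).trans (le_max_right _ _)).trans hlam,
        fun _ => ((le_max_right _ _).trans (le_max_right _ _)).trans hlam⟩)
  · exact sub_le_sub_left (one_div_le_one_div_of_le hq0 hqp) 1
  -- The two regimes for q overlap only at q = 2, where both conditions reduce to 1/2 ≤ 1 - 1/p.
  · obtain rfl : q = 2 := le_antisymm hq2 h2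
    have e : n / (2 * ((n : ℝ) + 2 - 2)) = 1 - 1 / 2 := by
      rw [add_sub_cancel_right]; field_simp; norm_num
    rw [e]
    exact sub_le_sub_left (one_div_le_one_div_of_le hq0 hqp) 1
  · rcases eq_or_ne n 1 with h1 | h1
    · exact Or.inl h1
    · have hn2 : (2 : ℝ) ≤ n := by
        have : 2 ≤ n := by omega
        exact_mod_cast this
      have hd : 0 < (n : ℝ) + 2 * (q - 2) := by linarith
      have hd2 : 0 < (n : ℝ) + q - 2 := by linarith
      -- The threshold for p is exactly the value at which 1 - 1/p equals the sphere constant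
      -- n/(2(n+q-2)). For n ≥ 2 its denominator n + 2(q-2) is positive because q > 1.
      have hmain : n / (2 * ((n : ℝ) + q - 2)) ≤ 1 - 1 / p := by
        have e : n / (2 * ((n : ℝ) + q - 2)) =
            1 - 1 / (2 * ((n : ℝ) + q - 2) / ((n : ℝ) + 2 * (q - 2))) := by
          field_simp
          ring
        rw [e]
        exact sub_le_sub_left (one_div_le_one_div_of_le (by positivity) hpn) 1
      refine Or.inr ⟨fun hq2 => ?_, fun _ => hmain⟩
      obtain rfl : q = 2 := le_antisymm h2 hq2
      have e : n / (2 * ((n : ℝ) + 2 - 2)) = 1 - 1 / 2 := by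
        rw [add_sub_cancel_right]; field_simp; norm_num
      rwa [e] at hmain
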